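/- **Setting.** Put $\lambda=e^{i\pi/4}$. Consider the square lattice of unit squares (faces) with centres $x\bar\lambda+y\lambda$, $(x,y)\in\mathbb Z^2$; the face $(x,y)$ is black if $x+y$ is even and white if $x+y$ is odd. Let $\Omega$ be a finite set of faces forming a simply connected domain bounded by a single simple closed lattice path; let $\mathcal V$ be its vertex set. Let $u_0\in\Omega$ be a black face with $x,y$ even and $v_0\in\Omega$ a white face with $x$ even, $y$ odd, each having a side on $\partial\Omega$ (if a face has several boundary sides, they are assumed to be consecutive along $\partial\Omega$, and one of them is chosen). Assume that $\Omega$ and $\Omega'=\Omega\smallsetminus\{u_0,v_0\}$ both admit a domino tiling. Let $(u_0v_0)$ be the part of $\partial\Omega$ going in the positive (counterclockwise) direction from the middle of the boundary side of $u_0$ to the middle of the boundary side of $v_0$, and let $(v_0u_0)$ be the complementary part. For a function $f$ on faces let $$[\bar\partial f](s)=\tfrac12\Big(\tfrac{f(s+\lambda)-f(s-\lambda)}{2\bar\lambda}+\tfrac{f(s+\bar\lambda)-f(s-\bar\lambda)}{2\lambda}\Big).$$ Let $F$ be the function on the black faces of $\Omega$, extended by $0$ to the other black faces, which is real for $x,y$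 even and purely imaginary for $x,y$ odd, with $[\bar\partial F](v)=0$ at all white $v\in\Omega\smallsetminus\{v_0\}$ and $[\bar\partial F](v_0)=\lambda$. Let $G$ be the function on the white faces of $\Omega$, extended by $0$ to the other white faces, with values in $\lambda\mathbb R$ for $x$ even, $y$ odd and in $\bar\lambda\mathbb R$ for $x$ odd, $y$ even, with $[\bar\partial G](u)=0$ at all black $u\in\Omega\smallsetminus\{u_0\}$ and $[\bar\partial G](u_0)=i$. Let $H$ be the real-valued function with $$H(z')-H(z)=(z'-z)F(u)G(v)$$ for every side $zz'$ of a face of $\Omega$ that is not a boundary side of $u_0$ or of $v_0$, where $u,v$ are the black and the white face adjacent to $zz'$, normalized by $H=0$ on $(v_0u_0)$. It is defined on all endpoints of such sides; these are all of $\mathcal V$ if $u_0$ and $v_0$ have one boundary side each. The height function of a domino tiling of a set of faces vanishes at a fixed vertex $z_0$ and, along an edge path in that set, changes by $+\frac14$ (resp. $-\frac34$) when the traversed edge has a black face on its left and does not cross (resp. crosses) a domino, and by $-\frac14$ (resp. $+\frac34$) when it has a white face on its left. Let $h=h_\Omega-h_{\Omega'}$ be the double-dimer height function, where $h_\Omega,h_{\Omega'}$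 are the height functions of independent uniform domino tilings of $\Omega$ and $\Omega'$, both vanishing at the same vertex $z_0\in(v_0u_0)$. **Statement.** The height functions do not depend on the choice of edge paths; $F$, $G$ and $H$ exist and are unique; $H$ is constant on $(u_0v_0)$ (where it is defined), with $$H|_{(u_0v_0)}=4iG(v_0)[\bar\partial F](v_0)=-4iF(u_0)[\bar\partial G](u_0)\neq0.$$ If $u_0$ and $v_0$ have exactly one boundary side each and are not adjacent, then for every $z_0\in(v_0u_0)$ and all $z\in\mathcal V$ $$\mathbb E[h(z)]=\frac{H(z)}{H|_{(u_0v_0)}}.$$ In the remaining cases the same equality holds whenever $z_0\in(v_0u_0)$ and $z$ are vertices of $\Omega'$ joined by an edge path in $\Omega'$ (so that $h_{\Omega'}(z)$ is defined). -/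

import Mathlib

/-!
The square lattice with mesh size one, rotated by 45 degrees.

* The pair `(x, y)` of integers, read as a face, is the unit square centred at `x * conj l + y * l`,
  where `l = exp (i * pi / 4)`. Its coordinates on the lattice of points `(n / sqrt 2, m / sqrt 2)`
  with `n + m` even are `n = x + y` and `m = y - x`.
* The pair `(x, y)`, read as a vertex, is the point `(x - 1/2) * conj l + (y - 1/2) * l`, a corner
  of the face `(x, y)`.

The basis `(conj l, l)` is positively oriented, so `left` and `counterclockwise` have the same
meaning in the coordinates `(x, y)` and in the complex plane.
-/

noncomputable section

namespace DoubleDimer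

open Complex

/-- Unit squares of the lattice. -/
abbrev Face := ℤ × ℤ

/-- Corners of the unit squares. -/
abbrev Vertex := ℤ × ℤ

/-- The number `exp (i pi / 4)`. -/
def lam : ℂ := exp (I * (Real.pi / 4 : ℝ))

/-- The number `exp (- i pi / 4)`. -/
def lamBar : ℂ := exp (-(I * (Real.pi / 4 : ℝ)))

/-- The position of a vertex in the complex plane. -/
def pos (z : Vertex) : ℂ := ((z.1 : ℂ) - 1 / 2) * lamBar + ((z.2 : ℂ) - 1 / 2) * lam

/-! ### Colours of faces -/

/-- Black faces: both lattice coordinates `n = x + y`, `m = y - x` are even. -/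
def IsBlack (s : Face) : Prop := Even (s.1 + s.2)

/-- White faces: both lattice coordinates are odd. -/
def IsWhite (s : Face) : Prop := Odd (s.1 + s.2)

/-- Black faces of type 0: `n`, `m` are even and `n + m = 2 y` is divisible by four. -/
def IsBlack0 (s : Face) : Prop := Even s.1 ∧ Even s.2

/-- Black faces of type 1: `n`, `m` are even and `n + m = 2 y` is not divisible by four. -/
def IsBlack1 (s : Face) : Prop := Odd s.1 ∧ Odd s.2

/-- White faces of type 0: `n`, `m` are odd and `n + m = 2 y` is not divisible by four. -/
def IsWhite0 (s : Face) : Prop := Even s.1 ∧ Odd s.2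

/-- White faces of type 1: `n`, `m` are odd and `n + m = 2 y` is divisible by four. -/
def IsWhite1 (s : Face) : Prop := Odd s.1 ∧ Even s.2

/-- The four faces that share a side with a given face. -/
def nbrs (s : Face) : Finset Face := {s + (1, 0), s - (1, 0), s + (0, 1), s - (0, 1)}

/-! ### Edges and domains -/

/-- `z` and `w` are the ends of a side of a unit square. -/
def IsLatticeEdge (z w : Vertex) : Prop :=
  w = z + (1, 0) ∨ w = z + (0, 1) ∨ z = w + (1, 0) ∨ z = w + (0, 1)

/-- The face on the left of the directed lattice edge from `z` to `w`. -/
def leftFace (z w : Vertex) : Face :=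
  if w = z + (1, 0) then z
  else if w = z + (0, 1) then z - (1, 0)
  else if z = w + (1, 0) then z - (1, 1)
  else z - (0, 1)

/-- The face on the right of the directed lattice edge from `z` to `w`. -/
def rightFace (z w : Vertex) : Face := leftFace w z

/-- The set of corners of the faces of `D`. -/
def vertexSet (D : Finset Face) : Set Vertex :=
  {z | ∃ s ∈ D, z = s ∨ z = s + (1, 0) ∨ z = s + (0, 1) ∨ z = s + (1, 1)}

theorem IsLatticeEdge.symm {z w : Vertex} (h : IsLatticeEdge z w) : IsLatticeEdge w z := by
  unfold IsLatticeEdge at *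
  tauto

theorem IsLatticeEdge.ne {z w : Vertex} (h : IsLatticeEdge z w) : z ≠ w := by
  rintro rfl
  simp [IsLatticeEdge] at h

/-- The graph formed by the sides of the faces of `D`. -/
def edgeGraph (D : Finset Face) : SimpleGraph Vertex where
  Adj z w := IsLatticeEdge z w ∧ (leftFace z w ∈ D ∨ rightFace z w ∈ D)
  symm := ⟨fun _ _ h => ⟨h.1.symm, h.2.symm⟩⟩
  loopless := ⟨fun _ h => h.1.ne rfl⟩

/-- The finite set of faces `Ω` is a simply connected discrete domain bounded by the simple closed
lattice path `c`, run counterclockwise: the vertices `c i` are distinct, and the directed edges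
from `c i` to `c (i + 1)` are exactly the directed lattice edges with a face of `Ω` on the left and
a face outside `Ω` on the right. -/
structure IsBoundaryLoop (Ω : Finset Face) {n : ℕ} (c : ZMod n → Vertex) : Prop where
  injective : Function.Injective c
  edge : ∀ i, IsLatticeEdge (c i) (c (i + 1)) ∧
    leftFace (c i) (c (i + 1)) ∈ Ω ∧ rightFace (c i) (c (i + 1)) ∉ Ω
  exhaust : ∀ z w, IsLatticeEdge z w → leftFace z w ∈ Ω → rightFace z w ∉ Ω →
    ∃ i, c i = z ∧ c (i + 1) = w

/-- The vertices of the closed path `c` that lie between the middle of its edge number `a` and the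
middle of its edge number `b`, when `c` is run in the positive direction. -/
def boundaryArc {n : ℕ} (c : ZMod n → Vertex) (a b : ZMod n) : Set Vertex :=
  {z | ∃ k : ℕ, 1 ≤ k ∧ k ≤ (b - a).val ∧ z = c (a + k)}

/-- The face `s` has exactly two boundary sides, and they are opposite to each other. A face of
a simply connected domain for which this fails has its boundary sides consecutive on the
boundary. -/
def IsStrait (Ω : Finset Face) (s : Face) : Prop :=
  (s + (1, 0) ∈ Ω ∧ s - (1, 0) ∈ Ω ∧ s + (0, 1) ∉ Ω ∧ s - (0, 1) ∉ Ω) ∨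
  (s + (1, 0) ∉ Ω ∧ s - (1, 0) ∉ Ω ∧ s + (0, 1) ∈ Ω ∧ s - (0, 1) ∈ Ω)

/-- The face `s` has exactly one side on the boundary of `Ω`. -/
def HasOneBoundarySide (Ω : Finset Face) (s : Face) : Prop :=
  ∃! t, t ∈ nbrs s ∧ t ∉ Ω

/-- The edge between `z` and `w` is a side of the face `s` that lies on the boundary of `Ω`. -/
def IsBoundarySide (Ω : Finset Face) (s : Face) (z w : Vertex) : Prop :=
  (leftFace z w = s ∧ rightFace z w ∉ Ω) ∨ (rightFace z w = s ∧ leftFace z w ∉ Ω)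

/-- All sides of faces of `Ω` except the boundary sides of `u₀` and of `v₀`. -/
def slitGraph (Ω : Finset Face) (u₀ v₀ : Face) : SimpleGraph Vertex where
  Adj z w := (edgeGraph Ω).Adj z w ∧ ¬ IsBoundarySide Ω u₀ z w ∧ ¬ IsBoundarySide Ω v₀ z w
  symm := ⟨fun _ _ h => ⟨h.1.symm, fun h' => h.2.1 h'.symm, fun h' => h.2.2 h'.symm⟩⟩
  loopless := ⟨fun _ h => h.1.1.ne rfl⟩

/-! ### Dimer coverings and height functions -/

/-- A dimer covering of `D`, given as the set of pairs (black face, white face) of its dominoes. -/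
def IsTiling (D : Finset Face) (T : Finset (Face × Face)) : Prop :=
  (∀ p ∈ T, p.1 ∈ D ∧ p.2 ∈ D ∧ IsBlack p.1 ∧ IsWhite p.2 ∧ p.2 ∈ nbrs p.1) ∧
  ∀ s ∈ D, ∃! p, p ∈ T ∧ (p.1 = s ∨ p.2 = s)

open Classical in
/-- The set of all dimer coverings of `D`. -/
def tilings (D : Finset Face) : Finset (Finset (Face × Face)) :=
  (D ×ˢ D).powerset.filter (IsTiling D)

open Classical in
/-- The increment of the height along the directed edge from `z` to `w`: with a black face on the
left it is `1/4`, or `-3/4` if the edge crosses a domino; with a white face on the left it is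
`-1/4`, or `3/4` if the edge crosses a domino. -/
def heightStep (T : Finset (Face × Face)) (z w : Vertex) : ℝ :=
  if IsBlack (leftFace z w) then
    (if (leftFace z w, rightFace z w) ∈ T then -3 / 4 else 1 / 4)
  else
    (if (rightFace z w, leftFace z w) ∈ T then 3 / 4 else -1 / 4)

/-- The total increment of the height along an edge path. -/
def heightAlong {D : Finset Face} (T : Finset (Face × Face)) {z w : Vertex}
    (γ : (edgeGraph D).Walk z w) : ℝ :=
  (γ.darts.map fun d => heightStep T d.fst d.snd).sum

open Classical in
/-- The height function on the vertices of `D` of the dimer covering `T`, with value zero at `z₀`: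
the increment of the height along an edge path in `D` from `z₀` to `z`. -/
def height (D : Finset Face) (T : Finset (Face × Face)) (z₀ z : Vertex) : ℝ :=
  if h : (edgeGraph D).Reachable z₀ z then heightAlong T h.some else 0

/-- The height functions on `D` do not depend on the choice of the edge paths. -/
def HeightWellDefined (D : Finset Face) : Prop :=
  ∀ T ∈ tilings D, ∀ (z₀ z : Vertex) (γ : (edgeGraph D).Walk z₀ z),
    heightAlong T γ = height D T z₀ z

/-- The expectation at `z` of the double-dimer height function, which is the difference of the
height functions, both equal to zero at `z₀`, of two independent uniform dimer coverings, the first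
one of `D₁` and the second one of `D₂`. -/
def expectedHeight (D₁ D₂ : Finset Face) (z₀ z : Vertex) : ℝ :=
  (∑ T₁ ∈ tilings D₁, ∑ T₂ ∈ tilings D₂, (height D₁ T₁ z₀ z - height D₂ T₂ z₀ z)) /
    ((tilings D₁).card * (tilings D₂).card : ℝ)

/-! ### Discrete holomorphic functions

A function on the black (white) faces of `Ω` and of its outer boundary that vanishes on the outer
boundary is represented by its extension by zero to all faces. -/

/-- The discrete operator `∂̄` with mesh size one. -/
def dbar (f : Face → ℂ) (s : Face) : ℂ :=
  1 / 2 * ((f (s + (0, 1)) - f (s - (0, 1))) / (2 * lamBar) +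
    (f (s + (1, 0)) - f (s - (1, 0))) / (2 * lam))

/-- The function `F` on black faces: zero on the outer boundary, real on type 0, purely imaginary
on type 1, discrete holomorphic at the white faces other than `v₀`, with `∂̄ F (v₀) = lam`. -/
structure IsF (Ω : Finset Face) (v₀ : Face) (F : Face → ℂ) : Prop where
  zero : ∀ s, ¬ (s ∈ Ω ∧ IsBlack s) → F s = 0
  real : ∀ s, IsBlack0 s → (F s).im = 0
  imag : ∀ s, IsBlack1 s → (F s).re = 0
  holo : ∀ v ∈ Ω, IsWhite v → v ≠ v₀ → dbar F v = 0
  pole : dbar F v₀ = lam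

/-- The function `G` on white faces: zero on the outer boundary, in `lam * ℝ` on type 0, in
`lamBar * ℝ` on type 1, discrete holomorphic at the black faces other than `u₀`, with
`∂̄ G (u₀) = i`. -/
structure IsG (Ω : Finset Face) (u₀ : Face) (G : Face → ℂ) : Prop where
  zero : ∀ s, ¬ (s ∈ Ω ∧ IsWhite s) → G s = 0
  type0 : ∀ s, IsWhite0 s → ∃ r : ℝ, G s = lam * r
  type1 : ∀ s, IsWhite1 s → ∃ r : ℝ, G s = lamBar * r
  holo : ∀ u ∈ Ω, IsBlack u → u ≠ u₀ → dbar G u = 0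
  pole : dbar G u₀ = I

/-- The discrete primitive `H` of `Re (F G dz)` on the vertices of `slitGraph Ω u₀ v₀` (extended by
zero to all other lattice points), normalized to vanish on the boundary arc `A`. -/
structure IsPrimitive (Ω : Finset Face) (u₀ v₀ : Face) (A : Set Vertex) (F G : Face → ℂ)
    (H : Vertex → ℝ) : Prop where
  supp : ∀ z, z ∉ (slitGraph Ω u₀ v₀).support → H z = 0
  increment : ∀ (z w : Vertex) (u v : Face), (slitGraph Ω u₀ v₀).Adj z w → IsBlack u → IsWhite v →
    ((leftFace z w = u ∧ rightFace z w = v) ∨ (leftFace z w = v ∧ rightFace z w = u)) →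
    (H w : ℂ) - (H z : ℂ) = (pos w - pos z) * F u * G v
  normalized : ∀ z ∈ A, H z = 0

end DoubleDimer

end

namespace DoubleDimer

/-! ### Directed edges and sums along walks -/

/-! Write K for the matrix of `dbar` with white rows and black columns. A nonzero entry K(v,u) is a
quarter of the displacement from the centre of v to the centre of u. Hence at every vertex the two
ways of pairing the four surrounding faces into dominoes have opposite products of entries
(`IsSquare.dbarCoeff`), and a flip, which also changes the sign of the permutation, keeps the signed
weight of a tiling. Flips connect all tilings of a set with connected complement
(`eq_of_flip_invariant`). So all terms of the determinant that come from tilings are equal, and a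
domino (u,v) has probability K(v,u) K⁻¹(u,v) (`kasteleyn`).

In these terms F = λ K⁻¹(·,v₀) and G = -i K⁻¹(u₀,·). Removing u₀ and v₀ changes the inverse by a
matrix of rank one, K⁻¹(u,v₀) K⁻¹(u₀,v) / K⁻¹(u₀,v₀) (`inv_updateRow_single`). The denominator is
nonzero because, up to the determinant for Ω, it is the determinant that counts the tilings of Ω'.
Thus the domino probabilities in Ω and in Ω' differ by a constant times K(v,u) F(u) G(v) (`green`).
The mean height step along an edge is, up to sign, 1/4 minus a domino probability, and the edge
vector is -4i times an entry of K (`pos_sub_pos`). So the increments of H are J = 4iG(v₀)∂̄F(v₀)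
times those of the mean double-dimer height (`pos_sub_pos_mul`).

The value of H on the second arc comes from the geometry of heights. No domino crosses the boundary,
so the mean steps of Ω and Ω' agree along it. The form of mean steps of Ω' has circulation +1 around
u₀ and -1 around v₀. Correcting it by unit flows through the two chosen boundary sides makes it
closed on Ω; its primitive is 0 on one arc and 1 on the other (`exists_meanHeight`), and J times
this primitive is H.

Two topological facts are needed. Closed forms are exact because the complement is connected, which
is deduced from the boundary loop and used through winding numbers (`stokes`,
`IsBoundaryLoop.complementConnected`). H is unique because a function constant along the edges of
the slit graph is determined by the arc and the isolated corners of the poles (`eq_zero_of_arc`). -/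

theorem leftFace_east (z : Vertex) : leftFace z (z + (1, 0)) = z := by
  simp [leftFace]

theorem leftFace_north (z : Vertex) : leftFace z (z + (0, 1)) = z - (1, 0) := by
  simp [leftFace]

theorem leftFace_west (z : Vertex) : leftFace (z + (1, 0)) z = z - (0, 1) := by
  obtain ⟨x, y⟩ := z
  simp [leftFace, Prod.ext_iff]
  omega

theorem leftFace_south (z : Vertex) : leftFace (z + (0, 1)) z = z := by
  obtain ⟨x, y⟩ := z
  simp [leftFace, Prod.ext_iff]
  omega

theorem leftFace_swap (z w : Vertex) : leftFace w z = rightFace z w := rfl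

theorem rightFace_swap (z w : Vertex) : rightFace w z = leftFace z w := rfl

/-- The two ends and the two sides of a directed lattice edge. -/
theorem IsLatticeEdge.cases {z w : Vertex} (h : IsLatticeEdge z w) :
    (w = z + (1, 0) ∧ leftFace z w = z ∧ rightFace z w = z - (0, 1)) ∨
    (w = z + (0, 1) ∧ leftFace z w = z - (1, 0) ∧ rightFace z w = z) ∨
    (z = w + (1, 0) ∧ leftFace z w = w - (0, 1) ∧ rightFace z w = w) ∨
    (z = w + (0, 1) ∧ leftFace z w = w ∧ rightFace z w = w - (1, 0)) := by
  rcases h with rfl | rfl | rfl | rfl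
  · exact Or.inl ⟨rfl, leftFace_east z, leftFace_west z⟩
  · exact Or.inr (Or.inl ⟨rfl, leftFace_north z, leftFace_south z⟩)
  · exact Or.inr (Or.inr (Or.inl ⟨rfl, leftFace_west w, leftFace_east w⟩))
  · exact Or.inr (Or.inr (Or.inr ⟨rfl, leftFace_south w, leftFace_north w⟩))

/-- The sum of a function of directed edges along a walk. -/
def walkSum {A : Type*} [AddCommMonoid A] {Γ : SimpleGraph Vertex} (α : Vertex → Vertex → A)
    {z w : Vertex} (γ : Γ.Walk z w) : A :=
  (γ.darts.map fun d => α d.fst d.snd).sum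

section walkSum

variable {A : Type*} [AddCommGroup A] {Γ : SimpleGraph Vertex} (α : Vertex → Vertex → A)

@[simp] theorem walkSum_nil (z : Vertex) : walkSum α (SimpleGraph.Walk.nil : Γ.Walk z z) = 0 := by
  simp [walkSum]

@[simp] theorem walkSum_cons {z w t : Vertex} (h : Γ.Adj z w) (γ : Γ.Walk w t) :
    walkSum α (γ.cons h) = α z w + walkSum α γ := by
  simp [walkSum]

@[simp] theorem walkSum_append {z w t : Vertex} (γ : Γ.Walk z w) (γ' : Γ.Walk w t) :
    walkSum α (γ.append γ') = walkSum α γ + walkSum α γ' := by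
  simp [walkSum]

theorem walkSum_reverse (hα : ∀ z w, Γ.Adj z w → α w z = -α z w) {z w : Vertex}
    (γ : Γ.Walk z w) : walkSum α γ.reverse = -walkSum α γ := by
  induction γ with
  | nil => simp
  | cons h γ ih => simp [ih, hα _ _ h, add_comm]

theorem walkSum_telescope (f : Vertex → A) (hf : ∀ z w, Γ.Adj z w → α z w = f w - f z)
    {z w : Vertex} (γ : Γ.Walk z w) : walkSum α γ = f w - f z := by
  induction γ with
  | nil => simp
  | cons h γ ih => simp [ih, hf _ _ h]

/-- A form with vanishing sums along closed walks has a primitive. -/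
theorem exists_potential (hα : ∀ z w, Γ.Adj z w → α w z = -α z w)
    (hc : ∀ z (γ : Γ.Walk z z), walkSum α γ = 0) :
    ∃ f : Vertex → A, ∀ z w, Γ.Adj z w → f w - f z = α z w := by
  have key : ∀ z, Γ.Reachable (Γ.connectedComponentMk z).out z := fun z =>
    SimpleGraph.ConnectedComponent.exact (Quot.out_eq _)
  refine ⟨fun z => walkSum α (key z).some, fun z w h => ?_⟩
  have h1 : ∀ t (γ : Γ.Walk t z) (γ' : Γ.Walk t w), walkSum α γ' - walkSum α γ = α z w := by
    intro t γ γ'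
    have := hc t ((γ.append (SimpleGraph.Walk.cons h SimpleGraph.Walk.nil)).append γ'.reverse)
    simp only [walkSum_append, walkSum_cons, walkSum_nil, walkSum_reverse α hα] at this
    rw [sub_eq_iff_eq_add, ← sub_eq_zero, ← neg_eq_zero, ← this]
    abel
  have h2 : (Γ.connectedComponentMk w) = Γ.connectedComponentMk z :=
    SimpleGraph.ConnectedComponent.sound h.symm.reachable
  -- The potential is the sum along a walk from the chosen representative of the component. Adjacent
  -- vertices have equal representatives, but only propositionally, so the walk has to be
  -- transported.
  have h3 : ∀ (t t' : Vertex) (e : t = t') (r : Γ.Reachable t w) (r' : Γ.Reachable t' w),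
      walkSum α r.some = walkSum α r'.some := by rintro t _ rfl _ _; rfl
  show walkSum α (key w).some - walkSum α (key z).some = α z w
  rw [h3 _ (Γ.connectedComponentMk z).out (by rw [h2]) (key w) ((key z).trans h.reachable)]
  exact h1 _ _ _

end walkSum

/-! ### Winding numbers and the discrete Stokes formula -/

/-- The signed crossing of the ray from the face `s` in the direction `(1, 0)` by the directed
edge from `z` to `w`. -/
def crossing (s : Face) (z w : Vertex) : ℤ :=
  if w = z + (0, 1) ∧ s.2 = z.2 ∧ s.1 < z.1 then 1
  else if z = w + (0, 1) ∧ s.2 = w.2 ∧ s.1 < w.1 then -1 else 0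

theorem crossing_east (s : Face) (v : Vertex) : crossing s v (v + (1, 0)) = 0 := by
  simp [crossing, Prod.ext_iff]

theorem crossing_west (s : Face) (v : Vertex) : crossing s (v + (1, 0)) v = 0 := by
  simp [crossing, Prod.ext_iff]

theorem crossing_north (s : Face) (v : Vertex) : crossing s v (v + (0, 1)) =
    if s.2 = v.2 ∧ s.1 < v.1 then 1 else 0 := by
  have : ¬ v.2 = v.2 + 1 + 1 := by omega
  simp [crossing, Prod.ext_iff, this]

theorem crossing_south (s : Face) (v : Vertex) : crossing s (v + (0, 1)) v =
    -(if s.2 = v.2 ∧ s.1 < v.1 then 1 else 0) := by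
  have : ¬ v.2 = v.2 + 1 + 1 := by omega
  simp only [crossing, Prod.ext_iff, Prod.fst_add, Prod.snd_add, this, and_false, false_and,
    if_false, add_zero, true_and]
  split_ifs <;> rfl

/-- The circulation of a form around a face. -/
def circ {A : Type*} [AddCommMonoid A] (α : Vertex → Vertex → A) (s : Face) : A :=
  α s (s + (1, 0)) + α (s + (1, 0)) (s + (1, 1)) + α (s + (1, 1)) (s + (0, 1)) + α (s + (0, 1)) s

/-- The winding number of a walk around a face. -/
def winding {Γ : SimpleGraph Vertex} {z w : Vertex} (γ : Γ.Walk z w) (s : Face) : ℤ :=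
  walkSum (crossing s) γ

/-- A walk meets finitely many columns, and the rays point to the right. -/
theorem winding_far {Γ : SimpleGraph Vertex} {z w : Vertex} (γ : Γ.Walk z w) :
    ∃ M : ℤ, ∀ s : Face, M ≤ s.1 → winding γ s = 0 := by
  induction γ with
  | nil => exact ⟨0, fun s _ => by simp [winding]⟩
  | @cons a b d h γ ih =>
    obtain ⟨M, hM⟩ := ih
    refine ⟨max M (max a.1 b.1), fun s hs => ?_⟩
    have h1 : walkSum (crossing s) γ = 0 := hM s (by omega)
    simp only [winding, walkSum_cons, h1, crossing]
    rw [if_neg (by omega), if_neg (by omega), add_zero]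

/-- For a vertical edge the rays from its two faces differ only by the edge itself, which the walk
avoids. For a horizontal edge the two parallel rays are compared by a telescoping sum. -/
theorem winding_left_eq_right {Γ : SimpleGraph Vertex} (hΓ : ∀ z w, Γ.Adj z w → IsLatticeEdge z w)
    {p : Vertex} (γ : Γ.Walk p p) {z w : Vertex} (h : IsLatticeEdge z w) (hn : ¬ Γ.Adj z w) :
    winding γ (leftFace z w) = winding γ (rightFace z w) := by
  have hn' : ¬ Γ.Adj w z := fun h => hn h.symm
  have vert : ∀ z : Vertex, ¬ Γ.Adj z (z + (0, 1)) → winding γ (z - (1, 0)) = winding γ z := by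
    intro z hz
    have hz' : ¬ Γ.Adj (z + (0, 1)) z := fun h => hz h.symm
    have : ∀ {p q : Vertex} (γ : Γ.Walk p q), winding γ (z - (1, 0)) = winding γ z := by
      intro p q γ
      induction γ with
      | nil => simp [winding]
      | @cons a b d hab γ ih =>
        simp only [winding, walkSum_cons] at ih ⊢
        rw [ih]
        congr 1
        have ha : ¬ (a = z ∧ b = z + (0, 1)) := by rintro ⟨rfl, rfl⟩; exact hz hab
        have hb : ¬ (a = z + (0, 1) ∧ b = z) := by rintro ⟨rfl, rfl⟩; exact hz' hab
        obtain ⟨z1, z2⟩ := z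
        obtain ⟨a1, a2⟩ := a
        obtain ⟨b1, b2⟩ := b
        simp only [crossing, Prod.ext_iff, Prod.fst_add, Prod.snd_add, Prod.fst_sub,
          Prod.snd_sub] at *
        split_ifs <;> omega
    exact this γ
  have hor : ∀ z : Vertex, ¬ Γ.Adj z (z + (1, 0)) → winding γ z = winding γ (z - (0, 1)) := by
    intro z hz
    have hz' : ¬ Γ.Adj (z + (1, 0)) z := fun h => hz h.symm
    -- Away from the excluded edge, the difference of the crossings of the two rays is the
    -- coboundary of the indicator of the vertices lying between them.
    have := walkSum_telescope (fun a b => crossing (z - (0, 1)) a b - crossing z a b)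
      (fun v => if v.2 = z.2 ∧ z.1 < v.1 then (1 : ℤ) else 0) (fun a b hab => by
        have ha : ¬ (a = z ∧ b = z + (1, 0)) := by rintro ⟨rfl, rfl⟩; exact hz hab
        have hb : ¬ (a = z + (1, 0) ∧ b = z) := by rintro ⟨rfl, rfl⟩; exact hz' hab
        have hl := hΓ _ _ hab
        obtain ⟨z1, z2⟩ := z
        rcases hl with rfl | rfl | rfl | rfl
        · obtain ⟨a1, a2⟩ := a
          simp only [crossing_east, Prod.ext_iff, Prod.fst_add, Prod.snd_add] at *
          split_ifs <;> omega
        · obtain ⟨a1, a2⟩ := a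
          simp only [crossing_north, Prod.fst_add, Prod.snd_add, Prod.fst_sub, Prod.snd_sub]
          split_ifs <;> omega
        · obtain ⟨b1, b2⟩ := b
          simp only [crossing_west, Prod.ext_iff, Prod.fst_add, Prod.snd_add] at *
          split_ifs <;> omega
        · obtain ⟨b1, b2⟩ := b
          simp only [crossing_south, Prod.fst_add, Prod.snd_add, Prod.fst_sub, Prod.snd_sub]
          split_ifs <;> omega) γ
    rw [sub_self] at this
    have h2 : ∀ {p q : Vertex} (γ : Γ.Walk p q),
        walkSum (fun a b => crossing (z - (0, 1)) a b - crossing z a b) γ =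
          winding γ (z - (0, 1)) - winding γ z := by
      intro p q γ
      induction γ with
      | nil => simp [winding]
      | cons h γ ih => simp only [winding, walkSum_cons] at ih ⊢; rw [ih]; ring
    rw [h2] at this
    omega
  rcases h.cases with ⟨rfl, h1, h2⟩ | ⟨rfl, h1, h2⟩ | ⟨rfl, h1, h2⟩ | ⟨rfl, h1, h2⟩ <;> rw [h1, h2]
  · exact hor _ hn
  · exact vert _ hn
  · exact (hor _ hn').symm
  · exact (vert _ hn').symm

/-- Integrating along paths that go first up a fixed column and then along a row writes the form as
an exact form plus the circulations weighted by signed ray crossings. Along a closed walk the exact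
part cancels and the crossings add up to winding numbers. -/
theorem stokes {Γ : SimpleGraph Vertex} (hΓ : ∀ z w, Γ.Adj z w → IsLatticeEdge z w)
    (α : Vertex → Vertex → ℝ) (hα : ∀ z w, IsLatticeEdge z w → α w z = -α z w)
    {p : Vertex} (γ : Γ.Walk p p) (h0 : ∀ s, winding γ s = 0 ∨ circ α s = 0) :
    walkSum α γ = 0 := by
  obtain ⟨m, hm⟩ : ∃ m : ℤ, ∀ v ∈ γ.support, m ≤ v.1 ∧ m ≤ v.2 ∧ v.1 ≤ -m ∧ v.2 ≤ -m := by
    have : ∀ l : List Vertex, ∃ m : ℤ, ∀ v ∈ l, m ≤ v.1 ∧ m ≤ v.2 ∧ v.1 ≤ -m ∧ v.2 ≤ -m := by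
      intro l
      induction l with
      | nil => exact ⟨0, by simp⟩
      | cons v l ih =>
        obtain ⟨m, hm⟩ := ih
        refine ⟨min m (min (min v.1 v.2) (min (-v.1) (-v.2))), fun w hw => ?_⟩
        rcases List.mem_cons.1 hw with rfl | hw
        · omega
        · have := hm w hw
          omega
    exact this _
  have hsum : ∀ (f : ℤ → ℝ) (x : ℤ), m ≤ x →
      ∑ i ∈ Finset.Ico m (x + 1), f i = ∑ i ∈ Finset.Ico m x, f i + f x := by
    intro f x hx
    rw [← Finset.insert_Ico_right_eq_Ico_add_one hx, Finset.sum_insert (by simp), add_comm]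
  -- The integral from the corner (m, m) of a box containing the walk: up the left side, then right.
  -- Its horizontal increments are exact; the vertical ones miss the circulations of the faces to
  -- the left in the same row.
  set P : Vertex → ℝ := fun v => ∑ y ∈ Finset.Ico m v.2, α (m, y) (m, y + 1) +
    ∑ x ∈ Finset.Ico m v.1, α (x, v.2) (x + 1, v.2) with hP
  set box : Finset Face := Finset.Ico m (-m) ×ˢ Finset.Ico m (-m) with hbox
  have hPe : ∀ v : Vertex, m ≤ v.1 → P (v + (1, 0)) - P v = α v (v + (1, 0)) := by
    rintro ⟨x, y⟩ hx
    have := hsum (fun x => α (x, y) (x + 1, y)) x hx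
    simp only [hP, Prod.mk_add_mk, add_zero, this]
    ring
  have row : ∀ (y x : ℤ), m ≤ x → ∑ i ∈ Finset.Ico m x, circ α (i, y) =
      ∑ i ∈ Finset.Ico m x, α (i, y) (i + 1, y) - ∑ i ∈ Finset.Ico m x, α (i, y + 1) (i + 1, y + 1)
        + α (x, y) (x, y + 1) - α (m, y) (m, y + 1) := by
    intro y x hx
    induction x, hx using Int.leInduction with
    | base => simp
    | succ x hx ih =>
      rw [hsum _ _ hx, hsum _ _ hx, hsum _ _ hx, ih]
      have h1 := hα (x, y) (x, y + 1) (by simp [IsLatticeEdge])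
      have h2 := hα (x, y + 1) (x + 1, y + 1) (by simp [IsLatticeEdge])
      simp only [circ, Prod.mk_add_mk, add_zero, h1, h2]
      ring
  have hPn : ∀ v : Vertex, m ≤ v.1 → m ≤ v.2 → P (v + (0, 1)) - P v +
      ∑ i ∈ Finset.Ico m v.1, circ α (i, v.2) = α v (v + (0, 1)) := by
    rintro ⟨x, y⟩ hx hy
    have := hsum (fun y => α (m, y) (m, y + 1)) y hy
    simp only [hP, Prod.mk_add_mk, add_zero, this, row y x hx]
    ring
  have hbx : ∀ v : Vertex, m ≤ v.1 → m ≤ v.2 → v.1 ≤ -m → v.2 + 1 ≤ -m →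
      ∑ s ∈ box, (crossing s v (v + (0, 1)) : ℝ) * circ α s =
        ∑ i ∈ Finset.Ico m v.1, circ α (i, v.2) := by
    rintro ⟨x, y⟩ hx hy hx' hy'
    have : Finset.Ico m x ×ˢ {y} ⊆ box := by
      intro s hs
      simp only [hbox, Finset.mem_product, Finset.mem_Ico, Finset.mem_singleton] at hs hx hy hx' hy' ⊢
      omega
    rw [← Finset.sum_subset this, Finset.sum_product]
    · refine Finset.sum_congr rfl fun i hi => ?_
      simp only [Finset.mem_Ico] at hi
      simp [crossing, hi.2]
    · intro s hs hs'
      simp only [hbox, Finset.mem_product, Finset.mem_Ico, Finset.mem_singleton] at hs hs'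
      have : crossing s (x, y) ((x, y) + (0, 1)) = 0 := by
        simp only [crossing, Prod.ext_iff, Prod.fst_add, Prod.snd_add]
        rw [if_neg (by omega), if_neg (by omega)]
      rw [this]
      simp
  have dart : ∀ a b : Vertex, IsLatticeEdge a b → (m ≤ a.1 ∧ m ≤ a.2 ∧ a.1 ≤ -m ∧ a.2 ≤ -m) →
      (m ≤ b.1 ∧ m ≤ b.2 ∧ b.1 ≤ -m ∧ b.2 ≤ -m) →
      α a b = P b - P a + ∑ s ∈ box, (crossing s a b : ℝ) * circ α s := by
    rintro a b (rfl | rfl | rfl | rfl) ha hb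
    · simp [crossing_east, hPe a ha.1]
    · rw [hbx a ha.1 ha.2.1 ha.2.2.1 (by simpa using hb.2.2.2), hPn a ha.1 ha.2.1]
    · rw [hα b (b + (1, 0)) (by simp [IsLatticeEdge]), ← hPe b hb.1]
      simp [crossing_west]
    · have h1 : ∑ s ∈ box, (crossing s (b + (0, 1)) b : ℝ) * circ α s =
          -∑ s ∈ box, (crossing s b (b + (0, 1)) : ℝ) * circ α s := by
        rw [← Finset.sum_neg_distrib]
        exact Finset.sum_congr rfl fun s _ => by
            rw [crossing_south, crossing_north]; push_cast; ring
      rw [h1, hα b (b + (0, 1)) (by simp [IsLatticeEdge]), ← hPn b hb.1 hb.2.1,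
        hbx b hb.1 hb.2.1 hb.2.2.1 (by simpa using ha.2.2.2)]
      ring
  have main : ∀ {a b : Vertex} (δ : Γ.Walk a b),
      (∀ v ∈ δ.support, m ≤ v.1 ∧ m ≤ v.2 ∧ v.1 ≤ -m ∧ v.2 ≤ -m) →
      walkSum α δ = P b - P a + ∑ s ∈ box, (winding δ s : ℝ) * circ α s := by
    intro a b δ hδ
    induction δ with
    | nil => simp [winding]
    | @cons a b d hab δ ih =>
      have hb : b ∈ (SimpleGraph.Walk.cons hab δ).support := by simp
      rw [walkSum_cons, ih fun v hv => hδ v (by simp [hv]),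
        dart a b (hΓ _ _ hab) (hδ a (by simp)) (hδ b hb)]
      have : ∑ s ∈ box, (winding (SimpleGraph.Walk.cons hab δ) s : ℝ) * circ α s =
          ∑ s ∈ box, (crossing s a b : ℝ) * circ α s + ∑ s ∈ box, (winding δ s : ℝ) * circ α s := by
        rw [← Finset.sum_add_distrib]
        exact Finset.sum_congr rfl fun s _ => by
          simp only [winding, walkSum_cons]; push_cast; ring
      rw [this]
      ring
  rw [main γ hm, sub_self, zero_add]
  refine Finset.sum_eq_zero fun s _ => ?_
  rcases h0 s with h | h <;> simp [h]


/-! ### Connectedness of the complement -/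

/-- The faces outside `D` are connected to infinity through sides with both faces outside `D`. -/
def ComplementConnected (D : Finset Face) : Prop :=
  ∀ w : Face → ℤ, (∃ M : ℤ, ∀ s : Face, M ≤ s.1 → w s = 0) →
    (∀ z z', IsLatticeEdge z z' → leftFace z z' ∉ D → rightFace z z' ∉ D →
      w (leftFace z z') = w (rightFace z z')) →
    ∀ s, s ∉ D → w s = 0

section Loop

variable {Ω : Finset Face} {n : ℕ} {c : ZMod n → Vertex}

theorem zmod_induction [NeZero n] {P : ZMod n → Prop} (i : ZMod n) (h : P i) (hs : ∀ j, P j → P (j + 1))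
    (j : ZMod n) : P j := by
  have : ∀ k : ℕ, P (i + k) := by
    intro k
    induction k with
    | zero => simpa using h
    | succ k ih => rw [Nat.cast_succ, ← add_assoc]; exact hs _ ih
  simpa using this (j - i).val

/-- The boundary loop leaves every vertex at most once. -/
theorem IsBoundaryLoop.next_unique (hc : IsBoundaryLoop Ω c) {z p q : Vertex}
    (h1 : IsLatticeEdge z p) (h1l : leftFace z p ∈ Ω) (h1r : rightFace z p ∉ Ω)
    (h2 : IsLatticeEdge z q) (h2l : leftFace z q ∈ Ω) (h2r : rightFace z q ∉ Ω) : p = q := by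
  obtain ⟨i, hi, rfl⟩ := hc.exhaust _ _ h1 h1l h1r
  obtain ⟨j, hj, rfl⟩ := hc.exhaust _ _ h2 h2l h2r
  rw [hc.injective (hi.trans hj.symm)]

/-- At a vertex where two diagonal faces lie in Ω and the other two do not, two boundary edges would
start, whereas a simple loop leaves each vertex once. -/
theorem IsBoundaryLoop.not_pinched (hc : IsBoundaryLoop Ω c) (z : Vertex) :
    ¬ (z ∈ Ω ∧ z - (1, 1) ∈ Ω ∧ z - (1, 0) ∉ Ω ∧ z - (0, 1) ∉ Ω) ∧
    ¬ (z ∉ Ω ∧ z - (1, 1) ∉ Ω ∧ z - (1, 0) ∈ Ω ∧ z - (0, 1) ∈ Ω) := by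
  have hw : leftFace z (z - (1, 0)) = z - (1, 1) ∧ rightFace z (z - (1, 0)) = z - (1, 0) := by
    have h1 := leftFace_west (z - (1, 0))
    have h2 := leftFace_east (z - (1, 0))
    rw [sub_add_cancel] at h1 h2
    exact ⟨h1.trans (by simp [sub_sub]), h2⟩
  have hs : leftFace z (z - (0, 1)) = z - (0, 1) ∧ rightFace z (z - (0, 1)) = z - (1, 1) := by
    have h1 := leftFace_south (z - (0, 1))
    have h2 := leftFace_north (z - (0, 1))
    rw [sub_add_cancel] at h1 h2
    exact ⟨h1, h2.trans (by simp [sub_sub])⟩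
  constructor
  · rintro ⟨h1, h2, h3, h4⟩
    have := hc.next_unique (z := z) (p := z + (1, 0)) (q := z - (1, 0)) (by simp [IsLatticeEdge])
      (by rwa [leftFace_east]) (by rwa [← leftFace_swap, leftFace_west])
      (by simp [IsLatticeEdge]) (by rwa [hw.1]) (by rwa [hw.2])
    simp [Prod.ext_iff] at this
    omega
  · rintro ⟨h1, h2, h3, h4⟩
    have := hc.next_unique (z := z) (p := z + (0, 1)) (q := z - (0, 1)) (by simp [IsLatticeEdge])
      (by rwa [leftFace_north]) (by rwa [← leftFace_swap, leftFace_south])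
      (by simp [IsLatticeEdge]) (by rwa [hs.1]) (by rwa [hs.2])
    simp [Prod.ext_iff] at this
    omega

/-- The four faces with the corner `z`. -/
def IsAround (z : Vertex) (s : Face) : Prop :=
  s = z ∨ s = z - (1, 0) ∨ s = z - (1, 1) ∨ s = z - (0, 1)

theorem IsLatticeEdge.isAround {z w : Vertex} (h : IsLatticeEdge z w) :
    IsAround z (rightFace z w) ∧ IsAround w (rightFace z w) ∧ IsAround z (leftFace z w) ∧
      IsAround w (leftFace z w) := by
  rcases h.cases with ⟨rfl, h1, h2⟩ | ⟨rfl, h1, h2⟩ | ⟨rfl, h1, h2⟩ | ⟨rfl, h1, h2⟩ <;>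
    rw [h1, h2] <;> simp [IsAround, Prod.ext_iff]

theorem edge_left_right (w : Face → ℤ) {D : Finset Face}
    (hw : ∀ z z', IsLatticeEdge z z' → leftFace z z' ∉ D → rightFace z z' ∉ D →
      w (leftFace z z') = w (rightFace z z')) (s : Face) (hs : s ∉ D) :
    (s + (1, 0) ∉ D → w s = w (s + (1, 0))) ∧ (s + (0, 1) ∉ D → w s = w (s + (0, 1))) := by
  constructor
  · intro h
    have := hw (s + (1, 0)) (s + (1, 0) + (0, 1)) (by simp [IsLatticeEdge])
    rw [leftFace_north, ← leftFace_swap, leftFace_south, add_sub_cancel_right] at this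
    exact this hs h
  · intro h
    have := hw (s + (0, 1)) (s + (0, 1) + (1, 0)) (by simp [IsLatticeEdge])
    rw [leftFace_east, ← leftFace_swap, leftFace_west, add_sub_cancel_right] at this
    exact (this h hs).symm

/-- Without pinching, the outside faces around a vertex form a chain in which neighbours share a
side. -/
theorem IsBoundaryLoop.eq_of_isAround (hc : IsBoundaryLoop Ω c) (w : Face → ℤ)
    (hw : ∀ z z', IsLatticeEdge z z' → leftFace z z' ∉ Ω → rightFace z z' ∉ Ω →
      w (leftFace z z') = w (rightFace z z')) {z : Vertex} {s t : Face} (hs : IsAround z s)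
    (ht : IsAround z t) (hsΩ : s ∉ Ω) (htΩ : t ∉ Ω) : w s = w t := by
  have hp := hc.not_pinched z
  have e1 := fun h => (edge_left_right w hw (z - (1, 0)) h).1
  have e2 := fun h => (edge_left_right w hw (z - (1, 1)) h).1
  have e3 := fun h => (edge_left_right w hw (z - (0, 1)) h).2
  have e4 := fun h => (edge_left_right w hw (z - (1, 1)) h).2
  have a1 : z - (1, 1) + (1, 0) = z - (0, 1) := by simp [Prod.ext_iff]
  have a2 : z - (1, 1) + (0, 1) = z - (1, 0) := by simp [Prod.ext_iff]
  rw [sub_add_cancel] at e1 e3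
  rw [a1] at e2
  rw [a2] at e4
  clear hw a1 a2
  unfold IsAround at hs ht
  generalize z - (1, 0) = z1 at *
  generalize z - (0, 1) = z2 at *
  generalize z - (1, 1) = z3 at *
  by_cases h : z ∈ Ω <;> by_cases h1 : z1 ∈ Ω <;> by_cases h2 : z2 ∈ Ω <;>
    by_cases h3 : z3 ∈ Ω <;> simp only [h, h1, h2, h3, not_true, not_false_iff,
      and_true, and_false, forall_const, false_implies, and_self] at hp e1 e2 e3 e4 <;>
    rcases hs with rfl | rfl | rfl | rfl <;> rcases ht with rfl | rfl | rfl | rfl <;>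
    first | rfl | contradiction | omega

/-- The outside faces along the boundary loop are linked at its vertices, so `w` is constant along
the loop; to the right of a rightmost face of Ω this constant is 0. Any other outside face, moved to
the right, either escapes or stops at the loop. -/
theorem IsBoundaryLoop.complementConnected [NeZero n] (hc : IsBoundaryLoop Ω c) (hne : Ω.Nonempty) :
    ComplementConnected Ω := by
  rintro w ⟨M, hM⟩ hw
  have hE := fun s hs => (edge_left_right w hw s hs).1
  have around := fun z s t hs ht h1 h2 => hc.eq_of_isAround w hw (z := z) (s := s) (t := t) hs ht h1 h2
  have ray : ∀ M : ℤ, (∀ s : Face, M ≤ s.1 → s ∉ Ω → w s = 0) →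
      (∀ s : Face, s.1 < M → s ∉ Ω → s + (1, 0) ∈ Ω → w s = 0) → ∀ s ∉ Ω, w s = 0 := by
    intro M h1 h2
    have : ∀ k : ℕ, ∀ s : Face, M - k ≤ s.1 → s ∉ Ω → w s = 0 := by
      intro k
      induction k with
      | zero => simpa using h1
      | succ k ih =>
        intro s hs hsΩ
        by_cases h : M ≤ s.1
        · exact h1 s h hsΩ
        by_cases h' : s + (1, 0) ∈ Ω
        · exact h2 s (by omega) hsΩ h'
        · rw [hE s hsΩ h']
          exact ih _ (by simp; push_cast at hs; omega) h'
    exact fun s hs => this (M - s.1).toNat s (by omega) hs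
  obtain ⟨s, hs, hmax⟩ := Finset.exists_max_image Ω Prod.fst hne
  have far : ∀ t : Face, s.1 < t.1 → w t = 0 := by
    have : ∀ k : ℕ, ∀ t : Face, M - k ≤ t.1 → s.1 < t.1 → w t = 0 := by
      intro k
      induction k with
      | zero => exact fun t ht _ => hM t (by simpa using ht)
      | succ k ih =>
        intro t ht hst
        have h1 : t ∉ Ω := fun h => by have := hmax t h; omega
        have h2 : t + (1, 0) ∉ Ω := fun h => by have := hmax _ h; simp at this; omega
        rw [hE t h1 h2]
        exact ih _ (by simp; push_cast at ht; omega) (by simp; omega)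
    exact fun t => this (M - t.1).toNat t (by omega)
  have right0 : ∀ i, w (rightFace (c i) (c (i + 1))) = 0 := by
    have hs' : s + (1, 0) ∉ Ω := fun h => by have := hmax _ h; simp at this
    obtain ⟨i, hi, hi'⟩ := hc.exhaust (s + (1, 0)) (s + (1, 0) + (0, 1)) (by simp [IsLatticeEdge])
      (by rwa [leftFace_north, add_sub_cancel_right]) (by rwa [← leftFace_swap, leftFace_south])
    refine zmod_induction i ?_ fun j hj => ?_
    · rw [hi, hi', ← leftFace_swap, leftFace_south]
      exact far _ (by simp)
    · rw [← hj]
      exact around (c (j + 1)) _ _ (hc.edge (j + 1)).1.isAround.1 (hc.edge j).1.isAround.2.1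
        (hc.edge (j + 1)).2.2 (hc.edge j).2.2
  refine ray M (fun s hs _ => hM s hs) fun t _ ht ht' => ?_
  obtain ⟨i, hi, hi'⟩ := hc.exhaust (t + (1, 0) + (0, 1)) (t + (1, 0)) (by simp [IsLatticeEdge])
    (by rwa [leftFace_south]) (by rwa [← leftFace_swap, leftFace_north, add_sub_cancel_right])
  have := right0 i
  rwa [hi, hi', ← leftFace_swap, leftFace_north, add_sub_cancel_right] at this

/-- Each removed face has a boundary side, through which it is joined to the old complement. -/
theorem ComplementConnected.sdiff_pair {Ω : Finset Face} (h : ComplementConnected Ω)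
    {z z' p p' : Vertex} (hz : IsLatticeEdge z z') (hzr : rightFace z z' ∉ Ω)
    (hp : IsLatticeEdge p p') (hpr : rightFace p p' ∉ Ω) :
    ComplementConnected (Ω \ {leftFace z z', leftFace p p'}) := by
  intro w hM hw s hs
  have h0 : ∀ s, s ∉ Ω → w s = 0 := h w hM fun a b hab h1 h2 => hw a b hab (by simp [h1]) (by simp [h2])
  by_cases hsΩ : s ∈ Ω
  · have : s = leftFace z z' ∨ s = leftFace p p' := by
      simp only [Finset.mem_sdiff, Finset.mem_insert, Finset.mem_singleton] at hs
      tauto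
    rcases this with rfl | rfl
    · rw [hw z z' hz (by simp) (by simp [hzr]), h0 _ hzr]
    · rw [hw p p' hp (by simp) (by simp [hpr]), h0 _ hpr]
  · exact h0 s hsΩ

end Loop

/-- The winding number of the walk is a function of the kind that `ComplementConnected` forces to
vanish outside D; inside D the circulation vanishes. -/
theorem walkSum_eq_zero_of_complementConnected {D : Finset Face} (hD : ComplementConnected D)
    {Γ : SimpleGraph Vertex} (hΓ : ∀ z w, Γ.Adj z w → IsLatticeEdge z w)
    (hΓD : ∀ z w, Γ.Adj z w → leftFace z w ∈ D ∨ rightFace z w ∈ D)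
    (α : Vertex → Vertex → ℝ) (hα : ∀ z w, IsLatticeEdge z w → α w z = -α z w)
    (hcirc : ∀ s ∈ D, circ α s = 0) {p : Vertex} (γ : Γ.Walk p p) : walkSum α γ = 0 := by
  refine stokes hΓ α hα γ fun s => ?_
  by_cases hs : s ∈ D
  · exact Or.inr (hcirc s hs)
  · refine Or.inl (hD (winding γ) (winding_far γ) (fun z z' h h1 h2 => ?_) s hs)
    exact winding_left_eq_right hΓ γ h fun h' => by
      rcases hΓD _ _ h' with h | h
      · exact h1 h
      · exact h2 h


/-! ### Colours and pairings -/

theorem isWhite_iff_not_isBlack (s : Face) : IsWhite s ↔ ¬ IsBlack s := by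
  simp [IsWhite, IsBlack]

theorem mem_nbrs {s t : Face} : t ∈ nbrs s ↔
    t = s + (1, 0) ∨ t = s - (1, 0) ∨ t = s + (0, 1) ∨ t = s - (0, 1) := by
  simp [nbrs]

theorem mem_nbrs_comm {s t : Face} : t ∈ nbrs s ↔ s ∈ nbrs t := by
  obtain ⟨a, b⟩ := s
  obtain ⟨p, q⟩ := t
  simp only [mem_nbrs, Prod.mk_add_mk, Prod.mk_sub_mk, Prod.mk.injEq]
  omega

theorem isBlack_iff_of_mem_nbrs {s t : Face} (h : t ∈ nbrs s) : IsBlack t ↔ ¬ IsBlack s := by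
  obtain ⟨a, b⟩ := s
  obtain ⟨p, q⟩ := t
  simp only [mem_nbrs, Prod.mk_add_mk, Prod.mk_sub_mk, Prod.mk.injEq] at h
  simp only [IsBlack, Int.even_iff]
  omega

theorem IsLatticeEdge.mem_nbrs {z w : Vertex} (h : IsLatticeEdge z w) :
    rightFace z w ∈ nbrs (leftFace z w) := by
  rcases h.cases with ⟨rfl, h1, h2⟩ | ⟨rfl, h1, h2⟩ | ⟨rfl, h1, h2⟩ | ⟨rfl, h1, h2⟩ <;>
    rw [h1, h2] <;> simp [nbrs]

theorem IsLatticeEdge.isBlack_right {z w : Vertex} (h : IsLatticeEdge z w) :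
    IsBlack (rightFace z w) ↔ ¬ IsBlack (leftFace z w) :=
  isBlack_iff_of_mem_nbrs h.mem_nbrs

/-- A set of pairs (black face, white face) such that every face of `D` lies in exactly one pair;
the faces of a pair need not be adjacent. -/
def IsPairing (D : Finset Face) (T : Finset (Face × Face)) : Prop :=
  (∀ p ∈ T, p.1 ∈ D ∧ p.2 ∈ D ∧ IsBlack p.1 ∧ IsWhite p.2) ∧
  ∀ s ∈ D, ∃! p, p ∈ T ∧ (p.1 = s ∨ p.2 = s)

section Pairing

variable {D : Finset Face} {T : Finset (Face × Face)}

theorem IsTiling.isPairing (h : IsTiling D T) : IsPairing D T :=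
  ⟨fun p hp => ⟨(h.1 p hp).1, (h.1 p hp).2.1, (h.1 p hp).2.2.1, (h.1 p hp).2.2.2.1⟩, h.2⟩

theorem isTiling_iff : IsTiling D T ↔ IsPairing D T ∧ ∀ p ∈ T, p.2 ∈ nbrs p.1 :=
  ⟨fun h => ⟨h.isPairing, fun p hp => (h.1 p hp).2.2.2.2⟩, fun h =>
    ⟨fun p hp => ⟨(h.1.1 p hp).1, (h.1.1 p hp).2.1, (h.1.1 p hp).2.2.1, (h.1.1 p hp).2.2.2,
      h.2 p hp⟩, h.1.2⟩⟩

theorem IsPairing.exists_white (h : IsPairing D T) {u : Face} (hu : u ∈ D) (hb : IsBlack u) :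
    ∃ v, (u, v) ∈ T := by
  obtain ⟨⟨p, q⟩, ⟨hp, rfl | rfl⟩, -⟩ := h.2 u hu
  · exact ⟨_, hp⟩
  · exact absurd hb ((isWhite_iff_not_isBlack _).1 (h.1 _ hp).2.2.2)

theorem IsPairing.exists_black (h : IsPairing D T) {v : Face} (hv : v ∈ D) (hw : IsWhite v) :
    ∃ u, (u, v) ∈ T := by
  obtain ⟨⟨p, q⟩, ⟨hp, rfl | rfl⟩, -⟩ := h.2 v hv
  · exact absurd (h.1 _ hp).2.2.1 ((isWhite_iff_not_isBlack _).1 hw)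
  · exact ⟨_, hp⟩

theorem IsPairing.white_unique (h : IsPairing D T) {u v v' : Face} (h1 : (u, v) ∈ T)
    (h2 : (u, v') ∈ T) : v = v' :=
  congrArg Prod.snd ((h.2 u (h.1 _ h1).1).unique ⟨h1, Or.inl rfl⟩ ⟨h2, Or.inl rfl⟩)

theorem IsPairing.black_unique (h : IsPairing D T) {u u' v : Face} (h1 : (u, v) ∈ T)
    (h2 : (u', v) ∈ T) : u = u' :=
  congrArg Prod.fst ((h.2 v (h.1 _ h1).2.1).unique ⟨h1, Or.inr rfl⟩ ⟨h2, Or.inr rfl⟩)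

theorem isPairing_of (h0 : ∀ p ∈ T, p.1 ∈ D ∧ p.2 ∈ D ∧ IsBlack p.1 ∧ IsWhite p.2)
    (hb : ∀ u ∈ D, IsBlack u → ∃ v, (u, v) ∈ T) (hw : ∀ v ∈ D, IsWhite v → ∃ u, (u, v) ∈ T)
    (hbu : ∀ u v v', (u, v) ∈ T → (u, v') ∈ T → v = v')
    (hwu : ∀ u u' v, (u, v) ∈ T → (u', v) ∈ T → u = u') : IsPairing D T := by
  refine ⟨h0, fun s hs => ?_⟩
  by_cases hsb : IsBlack s
  · obtain ⟨v, hv⟩ := hb s hs hsb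
    refine ⟨(s, v), ⟨hv, Or.inl rfl⟩, ?_⟩
    rintro ⟨a, b⟩ ⟨hab, rfl | rfl⟩
    · rw [hbu _ _ _ hab hv]
    · exact absurd hsb ((isWhite_iff_not_isBlack _).1 (h0 _ hab).2.2.2)
  · obtain ⟨u, hu⟩ := hw s hs ((isWhite_iff_not_isBlack _).2 hsb)
    refine ⟨(u, s), ⟨hu, Or.inr rfl⟩, ?_⟩
    rintro ⟨a, b⟩ ⟨hab, rfl | rfl⟩
    · exact absurd (h0 _ hab).2.2.1 hsb
    · rw [hwu _ _ _ hab hu]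

theorem mem_tilings : T ∈ tilings D ↔ IsTiling D T := by
  simp only [tilings, Finset.mem_filter, Finset.mem_powerset, and_iff_right_iff_imp]
  exact fun h p hp => Finset.mem_product.2 ⟨(h.1 p hp).1, (h.1 p hp).2.1⟩

end Pairing

/-! ### Height functions are well defined -/

theorem heightStep_of_isBlack {T : Finset (Face × Face)} {z w : Vertex}
    (h : IsBlack (leftFace z w)) : heightStep T z w =
      1 / 4 - (if (leftFace z w, rightFace z w) ∈ T then 1 else 0) := by
  rw [heightStep, if_pos h]
  split_ifs <;> norm_num

theorem heightStep_of_not_isBlack {T : Finset (Face × Face)} {z w : Vertex}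
    (h : ¬ IsBlack (leftFace z w)) : heightStep T z w =
      (if (rightFace z w, leftFace z w) ∈ T then 1 else 0) - 1 / 4 := by
  rw [heightStep, if_neg h]
  split_ifs <;> norm_num

theorem heightStep_swap (T : Finset (Face × Face)) {z w : Vertex} (h : IsLatticeEdge z w) :
    heightStep T w z = -heightStep T z w := by
  by_cases hb : IsBlack (leftFace z w)
  · rw [heightStep_of_isBlack hb, heightStep_of_not_isBlack, leftFace_swap z w, rightFace_swap z w]
    · ring
    · rw [leftFace_swap z w, h.isBlack_right]
      exact not_not.2 hb
  · rw [heightStep_of_not_isBlack hb, heightStep_of_isBlack, leftFace_swap z w, rightFace_swap z w]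
    · ring
    · rw [leftFace_swap z w, h.isBlack_right]
      exact hb

/-- The four sides of a face, run counterclockwise. -/
theorem sides (s : Face) :
    (leftFace s (s + (1, 0)) = s ∧ rightFace s (s + (1, 0)) = s - (0, 1)) ∧
    (leftFace (s + (1, 0)) (s + (1, 1)) = s ∧ rightFace (s + (1, 0)) (s + (1, 1)) = s + (1, 0)) ∧
    (leftFace (s + (1, 1)) (s + (0, 1)) = s ∧ rightFace (s + (1, 1)) (s + (0, 1)) = s + (0, 1)) ∧
    (leftFace (s + (0, 1)) s = s ∧ rightFace (s + (0, 1)) s = s - (1, 0)) := by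
  have e1 : s + (1, 1) = s + (1, 0) + (0, 1) := by simp [Prod.ext_iff]
  have e2 : s + (1, 1) = s + (0, 1) + (1, 0) := by simp [Prod.ext_iff]
  refine ⟨⟨leftFace_east s, leftFace_west s⟩, ?_, ?_, leftFace_south s, leftFace_north s⟩
  · rw [e1]
    exact ⟨by rw [leftFace_north, add_sub_cancel_right], leftFace_south _⟩
  · rw [e2]
    exact ⟨by rw [leftFace_west, add_sub_cancel_right], leftFace_east _⟩

theorem circ_heightStep_black (T : Finset (Face × Face)) {s : Face} (hs : IsBlack s) :
    circ (heightStep T) s = 1 - ∑ t ∈ nbrs s, if (s, t) ∈ T then 1 else 0 := by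
  obtain ⟨⟨h1, h1'⟩, ⟨h2, h2'⟩, ⟨h3, h3'⟩, h4, h4'⟩ := sides s
  have hn : ∑ t ∈ nbrs s, (if (s, t) ∈ T then (1 : ℝ) else 0) =
      (if (s, s + (1, 0)) ∈ T then 1 else 0) + ((if (s, s - (1, 0)) ∈ T then 1 else 0) +
      ((if (s, s + (0, 1)) ∈ T then 1 else 0) + (if (s, s - (0, 1)) ∈ T then 1 else 0))) := by
    rw [nbrs, Finset.sum_insert, Finset.sum_insert, Finset.sum_insert, Finset.sum_singleton] <;>
      simp [Prod.ext_iff] <;> omega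
  rw [hn, circ, heightStep_of_isBlack (by rwa [h1]), heightStep_of_isBlack (by rwa [h2]),
    heightStep_of_isBlack (by rwa [h3]), heightStep_of_isBlack (by rwa [h4]), h1, h1', h2, h2', h3,
    h3', h4, h4']
  ring

theorem circ_heightStep_white (T : Finset (Face × Face)) {s : Face} (hs : ¬ IsBlack s) :
    circ (heightStep T) s = ∑ t ∈ nbrs s, (if (t, s) ∈ T then 1 else 0) - 1 := by
  obtain ⟨⟨h1, h1'⟩, ⟨h2, h2'⟩, ⟨h3, h3'⟩, h4, h4'⟩ := sides s
  have hn : ∑ t ∈ nbrs s, (if (t, s) ∈ T then (1 : ℝ) else 0) =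
      (if (s + (1, 0), s) ∈ T then 1 else 0) + ((if (s - (1, 0), s) ∈ T then 1 else 0) +
      ((if (s + (0, 1), s) ∈ T then 1 else 0) + (if (s - (0, 1), s) ∈ T then 1 else 0))) := by
    rw [nbrs, Finset.sum_insert, Finset.sum_insert, Finset.sum_insert, Finset.sum_singleton] <;>
      simp [Prod.ext_iff] <;> omega
  rw [hn, circ, heightStep_of_not_isBlack (by rwa [h1]), heightStep_of_not_isBlack (by rwa [h2]),
    heightStep_of_not_isBlack (by rwa [h3]), heightStep_of_not_isBlack (by rwa [h4]), h1, h1', h2,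
    h2', h3, h3', h4, h4']
  ring

/-- The four sides contribute four quarters of one sign, and exactly one of them is crossed by a
domino, which cancels the total. -/
theorem IsTiling.circ_eq_zero {D : Finset Face} {T : Finset (Face × Face)} (hT : IsTiling D T)
    {s : Face} (hs : s ∈ D) : circ (heightStep T) s = 0 := by
  by_cases hb : IsBlack s
  · obtain ⟨v, hv⟩ := hT.isPairing.exists_white hs hb
    rw [circ_heightStep_black T hb, Finset.sum_eq_single_of_mem v (hT.1 _ hv).2.2.2.2, if_pos hv,
      sub_self]
    exact fun t _ ht => if_neg fun h => ht (hT.isPairing.white_unique h hv)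
  · obtain ⟨u, hu⟩ := hT.isPairing.exists_black hs ((isWhite_iff_not_isBlack _).2 hb)
    rw [circ_heightStep_white T hb,
      Finset.sum_eq_single_of_mem u (mem_nbrs_comm.1 (hT.1 _ hu).2.2.2.2), if_pos hu, sub_self]
    exact fun t _ ht => if_neg fun h => ht (hT.isPairing.black_unique h hu)

theorem heightAlong_eq_walkSum {D : Finset Face} (T : Finset (Face × Face)) {z w : Vertex}
    (γ : (edgeGraph D).Walk z w) : heightAlong T γ = walkSum (heightStep T) γ := rfl

theorem heightWellDefined {D : Finset Face} (hD : ComplementConnected D) :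
    HeightWellDefined D := by
  intro T hT z₀ z γ
  rw [mem_tilings] at hT
  have hr : (edgeGraph D).Reachable z₀ z := ⟨γ⟩
  rw [height, dif_pos hr, heightAlong_eq_walkSum, heightAlong_eq_walkSum]
  have := walkSum_eq_zero_of_complementConnected hD (Γ := edgeGraph D) (fun _ _ h => h.1)
    (fun _ _ h => h.2) (heightStep T) (fun _ _ h => heightStep_swap T h)
    (fun s hs => hT.circ_eq_zero hs) (γ.append hr.some.reverse)
  rw [walkSum_append, walkSum_reverse (Γ := edgeGraph D) _ fun _ _ h => heightStep_swap T h.1] at this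
  linarith

theorem HeightWellDefined.height_eq {D : Finset Face} (h : HeightWellDefined D)
    {T : Finset (Face × Face)} (hT : IsTiling D T) {z₀ z : Vertex} (γ : (edgeGraph D).Walk z₀ z) :
    height D T z₀ z = walkSum (heightStep T) γ :=
  (h T (mem_tilings.2 hT) z₀ z γ).symm


/-! ### Flips -/

/-- The faces around the vertex `z` are the black faces `u₁`, `u₂` and the white faces `v₁`, `v₂`,
where an edge from `z` with a black face on the left has the faces `u₁`, `v₁` or `u₂`, `v₂` on its
sides. -/
def IsSquare (z : Vertex) (u₁ v₁ u₂ v₂ : Face) : Prop :=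
  (IsBlack z ∧ u₁ = z ∧ v₁ = z - (0, 1) ∧ u₂ = z - (1, 1) ∧ v₂ = z - (1, 0)) ∨
  (¬ IsBlack z ∧ u₁ = z - (1, 0) ∧ v₁ = z ∧ u₂ = z - (0, 1) ∧ v₂ = z - (1, 1))

/-- The exchange of the white faces of two pairs of `T`. -/
def IsExchange (T T' : Finset (Face × Face)) (u₁ v₁ u₂ v₂ : Face) : Prop :=
  u₁ ≠ u₂ ∧ v₁ ≠ v₂ ∧ ∃ R : Finset (Face × Face), (u₁, v₁) ∉ R ∧ (u₂, v₂) ∉ R ∧ (u₁, v₂) ∉ R ∧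
    (u₂, v₁) ∉ R ∧ T = insert (u₁, v₁) (insert (u₂, v₂) R) ∧
    T' = insert (u₁, v₂) (insert (u₂, v₁) R)

/-- The tiling `T'` is obtained from `T` by the rotation of two parallel dominoes around `z` which
lowers the height at `z` by one. -/
def IsFlipAt (z : Vertex) (T T' : Finset (Face × Face)) : Prop :=
  ∃ u₁ v₁ u₂ v₂, IsSquare z u₁ v₁ u₂ v₂ ∧ IsExchange T T' u₁ v₁ u₂ v₂

theorem IsSquare.ne {z : Vertex} {u₁ v₁ u₂ v₂ : Face} (h : IsSquare z u₁ v₁ u₂ v₂) :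
    u₁ ≠ u₂ ∧ v₁ ≠ v₂ := by
  obtain ⟨x, y⟩ := z
  rcases h with ⟨-, rfl, rfl, rfl, rfl⟩ | ⟨-, rfl, rfl, rfl, rfl⟩ <;>
    simp only [ne_eq, Prod.ext_iff, Prod.fst_sub, Prod.snd_sub] <;> omega

/-- Edges leaving `z` with black on the left cross the pairs present before the flip; by
`IsSquare.end_iff`, edges entering `z` with black on the left cross those present after it. -/
theorem IsSquare.start_iff {z a b : Vertex} {u₁ v₁ u₂ v₂ : Face} (hs : IsSquare z u₁ v₁ u₂ v₂)
    (hab : IsLatticeEdge a b) (hb : IsBlack (leftFace a b)) :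
    (leftFace a b = u₁ ∧ rightFace a b = v₁ ∨ leftFace a b = u₂ ∧ rightFace a b = v₂) ↔ a = z := by
  obtain ⟨z1, z2⟩ := z
  obtain ⟨a1, a2⟩ := a
  obtain ⟨b1, b2⟩ := b
  rcases hab.cases with ⟨h, h1, h2⟩ | ⟨h, h1, h2⟩ | ⟨h, h1, h2⟩ | ⟨h, h1, h2⟩ <;>
    rw [h1] at hb <;> rw [h1, h2] <;> clear h1 h2 hab <;>
    rcases hs with ⟨hz, rfl, rfl, rfl, rfl⟩ | ⟨hz, rfl, rfl, rfl, rfl⟩ <;>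
    simp only [IsBlack, Prod.mk_add_mk, Prod.mk_sub_mk, Prod.mk.injEq, Int.even_iff] at h hb hz ⊢ <;>
    omega

theorem IsSquare.end_iff {z a b : Vertex} {u₁ v₁ u₂ v₂ : Face} (hs : IsSquare z u₁ v₁ u₂ v₂)
    (hab : IsLatticeEdge a b) (hb : IsBlack (leftFace a b)) :
    (leftFace a b = u₁ ∧ rightFace a b = v₂ ∨ leftFace a b = u₂ ∧ rightFace a b = v₁) ↔ b = z := by
  obtain ⟨z1, z2⟩ := z
  obtain ⟨a1, a2⟩ := a
  obtain ⟨b1, b2⟩ := b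
  rcases hab.cases with ⟨h, h1, h2⟩ | ⟨h, h1, h2⟩ | ⟨h, h1, h2⟩ | ⟨h, h1, h2⟩ <;>
    rw [h1] at hb <;> rw [h1, h2] <;> clear h1 h2 hab <;>
    rcases hs with ⟨hz, rfl, rfl, rfl, rfl⟩ | ⟨hz, rfl, rfl, rfl, rfl⟩ <;>
    simp only [IsBlack, Prod.mk_add_mk, Prod.mk_sub_mk, Prod.mk.injEq, Int.even_iff] at h hb hz ⊢ <;>
    omega

section Exchange

variable {D : Finset Face} {T T' : Finset (Face × Face)} {u₁ v₁ u₂ v₂ : Face}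

theorem IsPairing.exists_exchange (hT : IsPairing D T) (h1 : (u₁, v₁) ∈ T) (h2 : (u₂, v₂) ∈ T)
    (hu : u₁ ≠ u₂) : ∃ T', IsExchange T T' u₁ v₁ u₂ v₂ := by
  have hv : v₁ ≠ v₂ := fun h => hu (hT.black_unique h1 (h ▸ h2))
  refine ⟨_, hu, hv, (T.erase (u₁, v₁)).erase (u₂, v₂), by simp, by simp, ?_, ?_, ?_, rfl⟩
  · simp only [Finset.mem_erase, not_and]
    exact fun _ _ h => hv (hT.white_unique h1 h)
  · simp only [Finset.mem_erase, not_and]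
    exact fun _ _ h => hv (hT.white_unique h h2)
  · rw [Finset.insert_erase, Finset.insert_erase h1]
    exact Finset.mem_erase.2 ⟨fun h => hu (congrArg Prod.fst h).symm, h2⟩

theorem IsExchange.mem_iff (h : IsExchange T T' u₁ v₁ u₂ v₂) (hT : IsPairing D T) {a b : Face} :
    (a, b) ∈ T' ↔ (a = u₁ ∧ b = v₂) ∨ (a = u₂ ∧ b = v₁) ∨
      ((a, b) ∈ T ∧ a ≠ u₁ ∧ a ≠ u₂ ∧ b ≠ v₁ ∧ b ≠ v₂) := by
  obtain ⟨hu, hv, R, h1, h2, h3, h4, hTR, rfl⟩ := h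
  have m1 : (u₁, v₁) ∈ T := by rw [hTR]; simp
  have m2 : (u₂, v₂) ∈ T := by rw [hTR]; simp
  have mR : ∀ p ∈ R, p ∈ T := fun p hp => by rw [hTR]; simp [hp]
  simp only [Finset.mem_insert, Prod.mk.injEq]
  refine or_congr_right (or_congr_right ⟨fun hab => ⟨mR _ hab, ?_, ?_, ?_, ?_⟩, ?_⟩)
  · rintro rfl
    exact h1 (hT.white_unique (mR _ hab) m1 ▸ hab)
  · rintro rfl
    exact h2 (hT.white_unique (mR _ hab) m2 ▸ hab)
  · rintro rfl
    exact h1 (hT.black_unique (mR _ hab) m1 ▸ hab)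
  · rintro rfl
    exact h2 (hT.black_unique (mR _ hab) m2 ▸ hab)
  · rintro ⟨hab, ha, ha', -, -⟩
    rw [hTR] at hab
    simpa [ha, ha'] using hab

theorem IsExchange.left_mem (h : IsExchange T T' u₁ v₁ u₂ v₂) : (u₁, v₁) ∈ T ∧ (u₂, v₂) ∈ T := by
  obtain ⟨hu, hv, R, h1, h2, h3, h4, rfl, rfl⟩ := h
  simp

theorem IsExchange.isPairing (h : IsExchange T T' u₁ v₁ u₂ v₂) (hT : IsPairing D T) :
    IsPairing D T' := by
  obtain ⟨m1, m2⟩ := h.left_mem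
  have hu := h.1
  have hv := h.2.1
  refine isPairing_of ?_ ?_ ?_ ?_ ?_
  · rintro ⟨a, b⟩ hab
    rcases (h.mem_iff hT).1 hab with ⟨rfl, rfl⟩ | ⟨rfl, rfl⟩ | hab
    · exact ⟨(hT.1 _ m1).1, (hT.1 _ m2).2.1, (hT.1 _ m1).2.2.1, (hT.1 _ m2).2.2.2⟩
    · exact ⟨(hT.1 _ m2).1, (hT.1 _ m1).2.1, (hT.1 _ m2).2.2.1, (hT.1 _ m1).2.2.2⟩
    · exact hT.1 _ hab.1
  · intro u huD hub
    obtain ⟨v, hv⟩ := hT.exists_white huD hub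
    by_cases h1 : u = u₁
    · exact ⟨v₂, (h.mem_iff hT).2 (Or.inl ⟨h1, rfl⟩)⟩
    by_cases h2 : u = u₂
    · exact ⟨v₁, (h.mem_iff hT).2 (Or.inr (Or.inl ⟨h2, rfl⟩))⟩
    exact ⟨v, (h.mem_iff hT).2 (Or.inr (Or.inr ⟨hv, h1, h2,
      fun e => h1 (hT.black_unique hv (e ▸ m1)), fun e => h2 (hT.black_unique hv (e ▸ m2))⟩))⟩
  · intro v hvD hvw
    obtain ⟨u, hu⟩ := hT.exists_black hvD hvw
    by_cases h1 : v = v₁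
    · exact ⟨u₂, (h.mem_iff hT).2 (Or.inr (Or.inl ⟨rfl, h1⟩))⟩
    by_cases h2 : v = v₂
    · exact ⟨u₁, (h.mem_iff hT).2 (Or.inl ⟨rfl, h2⟩)⟩
    exact ⟨u, (h.mem_iff hT).2 (Or.inr (Or.inr ⟨hu, fun e => h1 (hT.white_unique hu (e ▸ m1)),
      fun e => h2 (hT.white_unique hu (e ▸ m2)), h1, h2⟩))⟩
  · intro u v v' h1 h2
    rw [h.mem_iff hT] at h1 h2
    rcases h1 with h1 | h1 | h1 <;> rcases h2 with h2 | h2 | h2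
    on_goal 9 => exact hT.white_unique h1.1 h2.1
    all_goals grind
  · intro u u' v h1 h2
    rw [h.mem_iff hT] at h1 h2
    rcases h1 with h1 | h1 | h1 <;> rcases h2 with h2 | h2 | h2
    on_goal 9 => exact hT.black_unique h1.1 h2.1
    all_goals grind

end Exchange

theorem IsFlipAt.isTiling {D : Finset Face} {z : Vertex} {T T' : Finset (Face × Face)}
    (h : IsFlipAt z T T') (hT : IsTiling D T) : IsTiling D T' := by
  obtain ⟨u₁, v₁, u₂, v₂, hs, he⟩ := h
  refine isTiling_iff.2 ⟨he.isPairing hT.isPairing, ?_⟩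
  rintro ⟨a, b⟩ hab
  rcases (he.mem_iff hT.isPairing).1 hab with ⟨rfl, rfl⟩ | ⟨rfl, rfl⟩ | hab
  · rcases hs with ⟨-, rfl, rfl, rfl, rfl⟩ | ⟨-, rfl, rfl, rfl, rfl⟩ <;> simp [mem_nbrs, Prod.ext_iff]
  · rcases hs with ⟨-, rfl, rfl, rfl, rfl⟩ | ⟨-, rfl, rfl, rfl, rfl⟩ <;> simp [mem_nbrs, Prod.ext_iff]
  · exact (hT.1 _ hab.1).2.2.2.2

/-- The flip frees the edges leaving `z` with black on the left and blocks those entering it, so it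
acts as subtracting the indicator of `z` from the height. -/
theorem IsFlipAt.heightStep {D : Finset Face} {z : Vertex} {T T' : Finset (Face × Face)}
    (h : IsFlipAt z T T') (hT : IsTiling D T) {a b : Vertex} (hab : IsLatticeEdge a b) :
    heightStep T' a b - heightStep T a b = (if a = z then 1 else 0) - (if b = z then 1 else 0) := by
  have main : ∀ {a b : Vertex}, IsLatticeEdge a b → IsBlack (leftFace a b) →
      DoubleDimer.heightStep T' a b - DoubleDimer.heightStep T a b =
        (if a = z then 1 else 0) - (if b = z then 1 else 0) := by
    intro a b hab hb
    obtain ⟨u₁, v₁, u₂, v₂, hs, he⟩ := h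
    rw [heightStep_of_isBlack hb, heightStep_of_isBlack hb]
    obtain ⟨m1, m2⟩ := he.left_mem
    have hst := hs.start_iff hab hb
    have hen := hs.end_iff hab hb
    have hm := he.mem_iff hT.isPairing (a := leftFace a b) (b := rightFace a b)
    have n1 := he.1
    have n2 := he.2.1
    have hne := hab.ne
    have w1 := fun h => hT.isPairing.white_unique (u := u₁) (v := rightFace a b) h m1
    have w2 := fun h => hT.isPairing.white_unique (u := u₂) (v := rightFace a b) h m2
    have b1 := fun h => hT.isPairing.black_unique (u := leftFace a b) (v := v₁) h m1
    have b2 := fun h => hT.isPairing.black_unique (u := leftFace a b) (v := v₂) h m2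
    clear hab hb hs he hT
    generalize leftFace a b = l at *
    generalize rightFace a b = r at *
    by_cases ha : a = z
    · have hbz : b ≠ z := fun h => hne (ha.trans h.symm)
      have h1 : (l, r) ∈ T := by rcases hst.2 ha with ⟨rfl, rfl⟩ | ⟨rfl, rfl⟩ <;> assumption
      have h2 : (l, r) ∉ T' := by
        rw [hm]
        rcases hst.2 ha with ⟨rfl, rfl⟩ | ⟨rfl, rfl⟩ <;> simp [n1, n2, n1.symm, n2.symm]
      simp [h1, h2, ha, hbz]
    by_cases hbz : b = z
    · have h1 : (l, r) ∉ T := by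
        rcases hen.2 hbz with ⟨rfl, rfl⟩ | ⟨rfl, rfl⟩
        · exact fun h => n2 (w1 h).symm
        · exact fun h => n2 (w2 h)
      have h2 : (l, r) ∈ T' := by
        rw [hm]
        rcases hen.2 hbz with ⟨rfl, rfl⟩ | ⟨rfl, rfl⟩ <;> simp
      simp [h1, h2, ha, hbz]
    · have : (l, r) ∈ T ↔ (l, r) ∈ T' := by
        rw [hm]
        constructor
        · refine fun h => Or.inr (Or.inr ⟨h, ?_, ?_, ?_, ?_⟩)
          · rintro rfl
            exact ha (hst.1 (Or.inl ⟨rfl, w1 h⟩))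
          · rintro rfl
            exact ha (hst.1 (Or.inr ⟨rfl, w2 h⟩))
          · rintro rfl
            exact ha (hst.1 (Or.inl ⟨b1 h, rfl⟩))
          · rintro rfl
            exact ha (hst.1 (Or.inr ⟨b2 h, rfl⟩))
        · rintro (h | h | h)
          · exact absurd (hen.1 (Or.inl h)) hbz
          · exact absurd (hen.1 (Or.inr h)) hbz
          · exact h.1
      simp [this, ha, hbz]
  by_cases hb : IsBlack (leftFace a b)
  · exact main hab hb
  · have := main hab.symm (by rwa [leftFace_swap, hab.isBlack_right])
    rw [heightStep_swap T hab, heightStep_swap T' hab] at this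
    linarith


/-! ### Connectedness of the set of tilings under flips -/

theorem heightStep_eq_of_outside {D : Finset Face} {T T' : Finset (Face × Face)}
    (hT : IsTiling D T) (hT' : IsTiling D T') {a b : Vertex}
    (h : leftFace a b ∉ D ∨ rightFace a b ∉ D) : heightStep T a b = heightStep T' a b := by
  have h1 : ∀ {T}, IsTiling D T → (leftFace a b, rightFace a b) ∉ T ∧
      (rightFace a b, leftFace a b) ∉ T := fun hT =>
    ⟨fun hm => by have := hT.1 _ hm; simp only at this; tauto,
      fun hm => by have := hT.1 _ hm; simp only at this; tauto⟩
  by_cases hb : IsBlack (leftFace a b)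
  · rw [heightStep_of_isBlack hb, heightStep_of_isBlack hb, if_neg (h1 hT).1, if_neg (h1 hT').1]
  · rw [heightStep_of_not_isBlack hb, heightStep_of_not_isBlack hb, if_neg (h1 hT).2,
      if_neg (h1 hT').2]

/-- The integer valued function `g` on the vertices is the difference of the height functions of
two tilings of `D`, extended by zero. -/
structure IsHeightDiff (D : Finset Face) (T T' : Finset (Face × Face)) (g : Vertex → ℤ) :
    Prop where
  step : ∀ a b, IsLatticeEdge a b → ((g b - g a : ℤ) : ℝ) = heightStep T a b - heightStep T' a b
  zero : ∀ z s, IsAround z s → s ∉ D → g z = 0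

theorem const_of_const_far {f : ℤ × ℤ → ℤ} {M : ℤ} (h1 : ∀ x y, M ≤ x → f (x + 1, y) = f (x, y))
    (h2 : ∀ x y, M ≤ x → f (x, y + 1) = f (x, y)) (s : ℤ × ℤ) (hs : M ≤ s.1) : f s = f (M, 0) := by
  obtain ⟨x, y⟩ := s
  have hx : f (x, y) = f (M, y) := by
    induction x, hs using Int.leInduction with
    | base => rfl
    | succ x hx ih => rw [h1 x y hx, ih]
  rw [hx]
  clear hx hs
  induction y using Int.induction_on with
  | zero => rfl
  | succ y ih => rw [h2 _ _ le_rfl, ih]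
  | pred y ih =>
    have := h2 M (-(y : ℤ) - 1) le_rfl
    rw [sub_add_cancel] at this
    rw [← this, ih]

/-- The two step forms agree on every edge that touches the outside of D, so their difference is
closed on the whole lattice and has an integer primitive there. Connectedness of the complement
makes one normalization valid at every outside face. -/
theorem exists_heightDiff {D : Finset Face} (hD : ComplementConnected D)
    {T T' : Finset (Face × Face)} (hT : IsTiling D T) (hT' : IsTiling D T') :
    ∃ g, IsHeightDiff D T T' g := by
  have hint : ∀ a b, ∃ k : ℤ, (k : ℝ) = heightStep T a b - heightStep T' a b := by
    intro a b
    by_cases hb : IsBlack (leftFace a b)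
    · refine ⟨(if (leftFace a b, rightFace a b) ∈ T' then 1 else 0) -
        (if (leftFace a b, rightFace a b) ∈ T then 1 else 0), ?_⟩
      rw [heightStep_of_isBlack hb, heightStep_of_isBlack hb]
      push_cast
      ring
    · refine ⟨(if (rightFace a b, leftFace a b) ∈ T then 1 else 0) -
        (if (rightFace a b, leftFace a b) ∈ T' then 1 else 0), ?_⟩
      rw [heightStep_of_not_isBlack hb, heightStep_of_not_isBlack hb]
      push_cast
      ring
  choose δ hδ using hint
  let Γ : SimpleGraph Vertex :=
    { Adj := IsLatticeEdge
      symm := ⟨fun _ _ h => h.symm⟩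
      loopless := ⟨fun _ h => h.ne rfl⟩ }
  set α : Vertex → Vertex → ℝ := fun a b => heightStep T a b - heightStep T' a b with hα
  have hanti : ∀ a b, IsLatticeEdge a b → α b a = -α a b := fun a b h => by
    simp only [hα, heightStep_swap _ h]
    ring
  have hout : ∀ a b, leftFace a b ∉ D ∨ rightFace a b ∉ D → α a b = 0 := fun a b h => by
    simp only [hα, heightStep_eq_of_outside hT hT' h, sub_self]
  have hcirc : ∀ s, circ α s = 0 := by
    intro s
    have e : circ α s = circ (heightStep T) s - circ (heightStep T') s := by
      simp only [circ, hα]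
      ring
    by_cases hs : s ∈ D
    · rw [e, hT.circ_eq_zero hs, hT'.circ_eq_zero hs, sub_self]
    · obtain ⟨⟨h1, -⟩, ⟨h2, -⟩, ⟨h3, -⟩, h4, -⟩ := sides s
      rw [circ, hout _ _ (Or.inl (by rwa [h1])), hout _ _ (Or.inl (by rwa [h2])),
        hout _ _ (Or.inl (by rwa [h3])), hout _ _ (Or.inl (by rwa [h4]))]
      simp
  obtain ⟨f, hf⟩ := exists_potential (Γ := Γ) δ (fun a b h => by
    have := hanti a b h
    simp only [hα, ← hδ] at this
    exact_mod_cast this) (fun z γ => by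
    have h1 := stokes (Γ := Γ) (fun _ _ h => h) α hanti γ (fun s => Or.inr (hcirc s))
    have h2 : ∀ {p q : Vertex} (γ : Γ.Walk p q), walkSum α γ = (walkSum δ γ : ℤ) := by
      intro p q γ
      induction γ with
      | nil => simp
      | cons h γ ih => rw [walkSum_cons, walkSum_cons, ih, Int.cast_add, hδ]
    rw [h2] at h1
    exact_mod_cast h1)
  have hf0 : ∀ a b, IsLatticeEdge a b → leftFace a b ∉ D ∨ rightFace a b ∉ D → f b = f a := by
    intro a b h h'
    have h1 := hf a b h
    have h2 := hout a b h'
    simp only [hα, ← hδ] at h2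
    have h3 : δ a b = 0 := by exact_mod_cast h2
    omega
  have corner : ∀ z s, IsAround z s → s ∉ D → f z = f s := by
    intro z s hzs hs
    obtain ⟨⟨h1, -⟩, ⟨h2, -⟩, ⟨h3, -⟩, h4, -⟩ := sides s
    have e1 := hf0 s (s + (1, 0)) (by simp [IsLatticeEdge]) (Or.inl (by rwa [h1]))
    have e2 := hf0 (s + (1, 0)) (s + (1, 1)) (by simp [IsLatticeEdge, Prod.ext_iff])
      (Or.inl (by rwa [h2]))
    have e4 := hf0 (s + (0, 1)) s (by simp [IsLatticeEdge]) (Or.inl (by rwa [h4]))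
    rcases hzs with rfl | rfl | rfl | rfl
    · rfl
    · rw [sub_add_cancel] at e1; exact e1
    · rw [sub_add_cancel] at e2; rw [e2, e1]
    · rw [sub_add_cancel] at e4; exact e4.symm
  obtain ⟨M, hM⟩ : ∃ M : ℤ, ∀ s ∈ D, s.1 < M := by
    obtain ⟨M, hM⟩ := (D.image Prod.fst).exists_le
    exact ⟨M + 1, fun s hs => Int.lt_add_one_iff.2 (hM _ (Finset.mem_image_of_mem _ hs))⟩
  have far : ∀ s : Face, M ≤ s.1 → f s = f (M, 0) := by
    refine const_of_const_far (fun x y h => ?_) (fun x y h => ?_)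
    · have h1 := leftFace_east (x, y)
      simp only [Prod.mk_add_mk, add_zero] at h1
      exact hf0 _ _ (by simp [IsLatticeEdge])
        (Or.inl (by rw [h1]; exact fun hd => absurd (hM _ hd) (by simpa using h)))
    · have h1 := leftFace_south (x, y)
      simp only [Prod.mk_add_mk, add_zero] at h1
      exact hf0 _ _ (by simp [IsLatticeEdge])
        (Or.inr (by rw [← leftFace_swap, h1]; exact fun hd => absurd (hM _ hd) (by simpa using h)))
  -- The primitive is the same at all corners of an outside face, so it descends to a function on
  -- outside faces, to which connectedness applies after subtracting the value far to the right.
  have hzero := hD (fun s => if s ∈ D then 0 else f s - f (M, 0)) ⟨M, fun s hs => by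
    simp only [far s hs, sub_self, ite_self]⟩ (fun z z' h h1 h2 => by
    have ha := h.isAround
    simp only [h1, h2, if_false, ← corner _ _ ha.1 h2, ← corner _ _ ha.2.2.1 h1])
  refine ⟨fun z => f z - f (M, 0), fun a b h => ?_, fun z s hzs hs => ?_⟩
  · rw [← hδ, ← hf a b h]
    push_cast
    ring
  · have := hzero s hs
    simp only [hs, if_false] at this
    rw [corner z s hzs hs, this]

theorem IsHeightDiff.symm {D : Finset Face} {T T' : Finset (Face × Face)} {g : Vertex → ℤ}
    (h : IsHeightDiff D T T' g) : IsHeightDiff D T' T (-g) := by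
  refine ⟨fun a b hab => ?_, fun z s hz hs => by simp [h.zero z s hz hs]⟩
  have := h.step a b hab
  simp only [Pi.neg_apply]
  push_cast at this ⊢
  linarith

theorem IsHeightDiff.mem {D : Finset Face} {T T' : Finset (Face × Face)} {g : Vertex → ℤ}
    (h : IsHeightDiff D T T' g) {z : Vertex} (hz : g z ≠ 0) {s : Face} (hs : IsAround z s) :
    s ∈ D := by
  by_contra hsD
  exact hz (h.zero z s hs hsD)

/-- If the difference of the height functions is positive somewhere, the first tiling admits a flip
that decreases it at such a vertex. -/
theorem IsHeightDiff.exists_flip {D : Finset Face} (hD : ComplementConnected D)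
    {T T' : Finset (Face × Face)} (hT : IsTiling D T) {g : Vertex → ℤ}
    (hg : IsHeightDiff D T T' g) {z₀ : Vertex} (hz₀ : 0 < g z₀) :
    ∃ z T₁, 0 < g z ∧ IsFlipAt z T T₁ ∧ IsTiling D T₁ ∧
      IsHeightDiff D T₁ T' (fun w => g w - if w = z then 1 else 0) := by
  classical
  have hwd := heightWellDefined hD
  have hmem : ∀ z, 0 < g z → ∀ s, IsAround z s → s ∈ D := fun z hz s => hg.mem hz.ne'
  -- A highest vertex for `T` among those with positive difference. Staying in the component of `z₀`
  -- makes the heights comparable.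
  obtain ⟨z, hz, hmax⟩ := Finset.exists_max_image
    (D.filter fun z => 0 < g z ∧ (edgeGraph D).Reachable z₀ z) (height D T z₀)
    ⟨z₀, by simp [hz₀, hmem z₀ hz₀ z₀ (Or.inl rfl)]⟩
  simp only [Finset.mem_filter, and_imp] at hz hmax
  obtain ⟨hzD, hgz, hr⟩ := hz
  -- If such an edge were uncrossed, the height of `T` would rise by 1/4, the largest step possible
  -- for `T'` as well. Then `g b ≥ g z > 0` with `b` higher, against maximality.
  have cross : ∀ b, IsLatticeEdge z b → IsBlack (leftFace z b) →
      (leftFace z b, rightFace z b) ∈ T := by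
    intro b hb hbl
    by_contra hn
    have hadj : (edgeGraph D).Adj z b := ⟨hb, Or.inl (hmem z hgz _ hb.isAround.2.2.1)⟩
    have h1 : heightStep T z b = 1 / 4 := by rw [heightStep_of_isBlack hbl, if_neg hn, sub_zero]
    have h2 : heightStep T' z b ≤ 1 / 4 := by
      rw [heightStep_of_isBlack hbl]
      split_ifs <;> norm_num
    have h3 := hg.step z b hb
    have h4 : g z ≤ g b := by
      have : (0 : ℝ) ≤ ((g b - g z : ℤ) : ℝ) := by rw [h3, h1]; linarith
      have : 0 ≤ g b - g z := by exact_mod_cast this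
      omega
    have hgb : 0 < g b := by omega
    have h5 := hmax b (hmem b hgb b (Or.inl rfl)) hgb (hr.trans hadj.reachable)
    rw [hwd.height_eq hT hr.some,
      hwd.height_eq hT (hr.some.append (SimpleGraph.Walk.cons hadj SimpleGraph.Walk.nil)),
      walkSum_append, walkSum_cons, walkSum_nil, h1] at h5
    norm_num at h5
  obtain ⟨u₁, v₁, u₂, v₂, hs, m1, m2⟩ : ∃ u₁ v₁ u₂ v₂, IsSquare z u₁ v₁ u₂ v₂ ∧ (u₁, v₁) ∈ T ∧
      (u₂, v₂) ∈ T := by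
    have c1 := cross (z + (1, 0)) (by simp [IsLatticeEdge])
    have c2 := cross (z + (0, 1)) (by simp [IsLatticeEdge])
    have c3 := cross (z - (1, 0)) (by simp [IsLatticeEdge])
    have c4 := cross (z - (0, 1)) (by simp [IsLatticeEdge])
    have l3 := leftFace_west (z - (1, 0))
    have r3 := leftFace_east (z - (1, 0))
    have l4 := leftFace_south (z - (0, 1))
    have r4 := leftFace_north (z - (0, 1))
    have e1 : z - (1, 0) - (0, 1) = z - (1, 1) := by simp [sub_sub]
    have e2 : z - (0, 1) - (1, 0) = z - (1, 1) := by simp [sub_sub]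
    rw [sub_add_cancel] at l3 r3 l4 r4
    rw [e1] at l3
    rw [e2] at r4
    rw [leftFace_east, ← leftFace_swap, leftFace_west] at c1
    rw [leftFace_north, ← leftFace_swap, leftFace_south] at c2
    rw [l3, ← leftFace_swap, r3] at c3
    rw [l4, ← leftFace_swap, r4] at c4
    -- Of the four edges at `z`, the two with black on the left are either the horizontal or the
    -- vertical ones; both are crossed, giving two parallel dominoes.
    by_cases hb : IsBlack z
    · refine ⟨_, _, _, _, Or.inl ⟨hb, rfl, rfl, rfl, rfl⟩, c1 hb, c3 ?_⟩
      simp only [IsBlack, Prod.fst_sub, Prod.snd_sub, Int.even_iff] at hb ⊢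
      omega
    · refine ⟨_, _, _, _, Or.inr ⟨hb, rfl, rfl, rfl, rfl⟩, c2 ?_, c4 ?_⟩ <;>
      · simp only [IsBlack, Prod.fst_sub, Prod.snd_sub, Int.even_iff] at hb ⊢
        omega
  obtain ⟨T₁, hT₁⟩ := hT.isPairing.exists_exchange m1 m2 hs.ne.1
  have hf : IsFlipAt z T T₁ := ⟨u₁, v₁, u₂, v₂, hs, hT₁⟩
  refine ⟨z, T₁, hgz, hf, hf.isTiling hT, fun a b hab => ?_, fun w s hw hsD => ?_⟩
  · have h1 := hg.step a b hab
    have h2 := hf.heightStep hT hab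
    push_cast at h1 ⊢
    linarith
  · have h0 := hg.zero w s hw hsD
    rw [h0, if_neg (fun h => by rw [h] at h0; omega), sub_zero]

/-- A function on the tilings which is invariant under flips is constant. -/
theorem eq_of_flip_invariant {D : Finset Face} (hD : ComplementConnected D) {β : Type*}
    (f : Finset (Face × Face) → β)
    (hf : ∀ z T T', IsTiling D T → IsFlipAt z T T' → f T = f T') {T T' : Finset (Face × Face)}
    (hT : IsTiling D T) (hT' : IsTiling D T') : f T = f T' := by
  -- Each vertex is indexed by the face of which it is the lower left corner. A vertex with nonzero
  -- difference is surrounded by D, so summing over D sees it.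
  have decr : ∀ (g : Vertex → ℤ) (z : Vertex), z ∈ D → 0 < g z →
      ∑ s ∈ D, (g s - if s = z then 1 else 0).natAbs < ∑ s ∈ D, (g s).natAbs := by
    intro g z hz hgz
    refine Finset.sum_lt_sum (fun s _ => ?_) ⟨z, hz, ?_⟩
    · split_ifs with h
      · subst h; omega
      · simp
    · rw [if_pos rfl]; omega
  have main : ∀ (n : ℕ) (T T' : Finset (Face × Face)) (g : Vertex → ℤ), IsTiling D T →
      IsTiling D T' → IsHeightDiff D T T' g → ∑ s ∈ D, (g s).natAbs = n → f T = f T' := by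
    intro n
    induction n using Nat.strong_induction_on with
    | _ n ih =>
      intro T T' g hT hT' hg hn
      by_cases h1 : ∃ z, 0 < g z
      · obtain ⟨z₀, hz₀⟩ := h1
        obtain ⟨z, T₁, hz, hfl, hT₁, hg₁⟩ := hg.exists_flip hD hT hz₀
        rw [hf z T T₁ hT hfl]
        exact ih _ (hn ▸ decr g z (hg.mem hz.ne' (Or.inl rfl)) hz) T₁ T' _ hT₁ hT' hg₁ rfl
      by_cases h2 : ∃ z, 0 < (-g) z
      · obtain ⟨z₀, hz₀⟩ := h2
        obtain ⟨z, T₁, hz, hfl, hT₁, hg₁⟩ := hg.symm.exists_flip hD hT' hz₀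
        rw [hf z T' T₁ hT' hfl]
        have := decr (-g) z (hg.symm.mem hz.ne' (Or.inl rfl)) hz
        simp only [Pi.neg_apply, Int.natAbs_neg] at this
        exact (ih _ (hn ▸ this) T₁ T _ hT₁ hT hg₁ (by simp)).symm
      · have hg0 : ∀ z, g z = 0 := fun z => by
          push Not at h1 h2
          have a := h1 z
          have b := h2 z
          simp only [Pi.neg_apply] at b
          omega
        have sub : ∀ {T T'}, IsTiling D T → (∀ a b, IsLatticeEdge a b →
            heightStep T a b = heightStep T' a b) → T ⊆ T' := by
          rintro T T' hT hs ⟨u, v⟩ huv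
          obtain ⟨a, b, hab, rfl, rfl⟩ : ∃ a b, IsLatticeEdge a b ∧ leftFace a b = u ∧
              rightFace a b = v := by
            obtain ⟨⟨s1, s1'⟩, ⟨s2, s2'⟩, ⟨s3, s3'⟩, s4, s4'⟩ := sides u
            rcases mem_nbrs.1 (hT.1 _ huv).2.2.2.2 with h | h | h | h <;> simp only at h <;> subst h
            · exact ⟨_, _, by simp [IsLatticeEdge, Prod.ext_iff], s2, s2'⟩
            · exact ⟨_, _, by simp [IsLatticeEdge, Prod.ext_iff], s4, s4'⟩
            · exact ⟨_, _, by simp [IsLatticeEdge, Prod.ext_iff], s3, s3'⟩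
            · exact ⟨_, _, by simp [IsLatticeEdge, Prod.ext_iff], s1, s1'⟩
          have hbl := (hT.1 _ huv).2.2.1
          have := hs a b hab
          rw [heightStep_of_isBlack hbl, heightStep_of_isBlack hbl, if_pos huv] at this
          by_contra hn
          rw [if_neg hn] at this
          norm_num at this
        have heq : ∀ a b, IsLatticeEdge a b → heightStep T a b = heightStep T' a b := by
          intro a b hab
          have := hg.step a b hab
          rw [hg0, hg0] at this
          push_cast at this
          linarith
        rw [(sub hT heq).antisymm (sub hT' fun a b hab => (heq a b hab).symm)]
  obtain ⟨g, hg⟩ := exists_heightDiff hD hT hT'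
  exact main _ T T' g hT hT' hg rfl


/-! ### Determinants as sums over pairings -/

open Classical in
/-- All pairings of `Ω`. -/
noncomputable def pairings (Ω : Finset Face) : Finset (Finset (Face × Face)) :=
  (Ω ×ˢ Ω).powerset.filter (IsPairing Ω)

theorem mem_pairings {Ω : Finset Face} {T : Finset (Face × Face)} :
    T ∈ pairings Ω ↔ IsPairing Ω T := by
  simp only [pairings, Finset.mem_filter, Finset.mem_powerset, and_iff_right_iff_imp]
  exact fun h p hp => Finset.mem_product.2 ⟨(h.1 p hp).1, (h.1 p hp).2.1⟩

open Classical in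
/-- The matrix with the entries `d` in the rows of the white faces; the row of a black face
indicates its partner in the pairing `T₀`. -/
noncomputable def pairMatrix (Ω : Finset Face) (T₀ : Finset (Face × Face)) (d : Face → Face → ℂ) :
    Matrix Ω Ω ℂ :=
  fun s t => if IsBlack s then (if ((s : Face), (t : Face)) ∈ T₀ then 1 else 0) else d s t

/-- The permutation that maps white faces to their partners in `T` and black faces to their
partners in `T₀`. -/
def Fits {Ω : Finset Face} (T₀ T : Finset (Face × Face)) (σ : Equiv.Perm Ω) : Prop :=
  ∀ s : Ω, (¬ IsBlack s → ((σ s : Face), (s : Face)) ∈ T) ∧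
    (IsBlack s → ((s : Face), (σ s : Face)) ∈ T₀)

section Fits

variable {Ω : Finset Face} {T₀ T T' : Finset (Face × Face)}

theorem Fits.unique (h0 : IsPairing Ω T₀) (hT : IsPairing Ω T) {σ τ : Equiv.Perm Ω}
    (hσ : Fits T₀ T σ) (hτ : Fits T₀ T τ) : σ = τ := by
  ext s : 2
  by_cases hs : IsBlack s
  · exact h0.white_unique ((hσ s).2 hs) ((hτ s).2 hs)
  · exact hT.black_unique ((hσ s).1 hs) ((hτ s).1 hs)

theorem IsPairing.exists_fits (h0 : IsPairing Ω T₀) (hT : IsPairing Ω T) :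
    ∃ σ : Equiv.Perm Ω, Fits T₀ T σ := by
  have h : ∀ s : Ω, ∃ t : Ω, (¬ IsBlack s → ((t : Face), (s : Face)) ∈ T) ∧
      (IsBlack s → ((s : Face), (t : Face)) ∈ T₀) := by
    rintro ⟨s, hs⟩
    by_cases hb : IsBlack s
    · obtain ⟨v, hv⟩ := h0.exists_white hs hb
      exact ⟨⟨v, (h0.1 _ hv).2.1⟩, fun h => absurd hb h, fun _ => hv⟩
    · obtain ⟨u, hu⟩ := hT.exists_black hs ((isWhite_iff_not_isBlack _).2 hb)
      exact ⟨⟨u, (hT.1 _ hu).1⟩, fun _ => hu, fun h => absurd h hb⟩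
  choose f hf using h
  have hcol : ∀ s : Ω, IsBlack (f s) ↔ ¬ IsBlack s := by
    intro s
    by_cases hb : IsBlack s
    · have := (h0.1 _ ((hf s).2 hb)).2.2.2
      rw [isWhite_iff_not_isBlack] at this
      exact iff_of_false this (not_not.2 hb)
    · exact iff_of_true (hT.1 _ ((hf s).1 hb)).2.2.1 hb
  have hinj : Function.Injective f := by
    intro s t hst
    have hc : IsBlack s ↔ IsBlack t := by
      have h1 := hcol s
      have h2 := hcol t
      rw [hst] at h1
      tauto
    by_cases hb : IsBlack s
    · have h1 := (hf s).2 hb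
      have h2 := (hf t).2 (hc.1 hb)
      rw [hst] at h1
      exact Subtype.ext (h0.black_unique h1 h2)
    · have h1 := (hf s).1 hb
      have h2 := (hf t).1 (fun h => hb (hc.2 h))
      rw [hst] at h1
      exact Subtype.ext (hT.white_unique h1 h2)
  exact ⟨Equiv.ofBijective f (Finite.injective_iff_bijective.1 hinj), hf⟩

/-- Converse of `IsPairing.exists_fits`: the permutations that contribute to the determinant are
exactly those which come from pairings. -/
theorem exists_pairing_of_perm (h0 : IsPairing Ω T₀) (σ : Equiv.Perm Ω)
    (hσ : ∀ s : Ω, IsBlack s → ((s : Face), (σ s : Face)) ∈ T₀) :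
    ∃ T, IsPairing Ω T ∧ Fits T₀ T σ := by
  classical
  have hw : ∀ s : Ω, IsBlack s → ¬ IsBlack (σ s) := fun s hs =>
    (isWhite_iff_not_isBlack _).1 (h0.1 _ (hσ s hs)).2.2.2
  -- The white faces are already used up as images of the black ones under `T₀`, so injectivity
  -- leaves only black images for white faces.
  have hb : ∀ s : Ω, ¬ IsBlack s → IsBlack (σ s) := by
    intro s hs
    by_contra hn
    obtain ⟨u, hu⟩ := h0.exists_black (σ s).2 ((isWhite_iff_not_isBlack _).2 hn)
    have huΩ := h0.1 _ hu
    have h1 := hσ ⟨u, huΩ.1⟩ huΩ.2.2.1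
    have h2 : σ ⟨u, huΩ.1⟩ = σ s := Subtype.ext (h0.white_unique h1 hu)
    rw [← σ.injective h2] at hs
    exact hs huΩ.2.2.1
  set T : Finset (Face × Face) := (Finset.univ.filter fun s : Ω => ¬ IsBlack s).image
    fun s => ((σ s : Face), (s : Face)) with hT
  have mem : ∀ a b, (a, b) ∈ T ↔ ∃ s : Ω, ¬ IsBlack s ∧ (σ s : Face) = a ∧ (s : Face) = b := by
    intro a b
    simp only [hT, Finset.mem_image, Finset.mem_filter, Finset.mem_univ, true_and, Prod.mk.injEq]
  refine ⟨T, isPairing_of ?_ ?_ ?_ ?_ ?_, fun s => ⟨fun hs => (mem _ _).2 ⟨s, hs, rfl, rfl⟩, hσ s⟩⟩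
  · rintro ⟨a, b⟩ hab
    obtain ⟨s, hs, rfl, rfl⟩ := (mem a b).1 hab
    exact ⟨(σ s).2, s.2, hb s hs, (isWhite_iff_not_isBlack _).2 hs⟩
  · intro u hu hub
    refine ⟨σ.symm ⟨u, hu⟩, (mem _ _).2 ⟨σ.symm ⟨u, hu⟩, fun h => ?_, by simp, rfl⟩⟩
    have := hw _ h
    simp only [Equiv.apply_symm_apply] at this
    exact this hub
  · intro v hv hvw
    exact ⟨σ ⟨v, hv⟩, (mem _ _).2 ⟨⟨v, hv⟩, (isWhite_iff_not_isBlack _).1 hvw, rfl, rfl⟩⟩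
  · intro u v v' h1 h2
    obtain ⟨s, hs, rfl, rfl⟩ := (mem _ _).1 h1
    obtain ⟨t, ht, e, rfl⟩ := (mem _ _).1 h2
    rw [σ.injective (Subtype.ext e)]
  · intro u u' v h1 h2
    obtain ⟨s, hs, rfl, rfl⟩ := (mem _ _).1 h1
    obtain ⟨t, ht, rfl, e⟩ := (mem _ _).1 h2
    rw [Subtype.ext e]

theorem Fits.eq_of_fits (hT : IsPairing Ω T) (hT' : IsPairing Ω T') {σ : Equiv.Perm Ω}
    (h : Fits T₀ T σ) (h' : Fits T₀ T' σ) : T = T' := by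
  have sub : ∀ {T T'}, IsPairing Ω T → Fits T₀ T σ → Fits T₀ T' σ → T ⊆ T' := by
    rintro T T' hT h h' ⟨u, v⟩ huv
    have hv := hT.1 _ huv
    have hvb := (isWhite_iff_not_isBlack _).1 hv.2.2.2
    have h1 := (h ⟨v, hv.2.1⟩).1 hvb
    have h2 := (h' ⟨v, hv.2.1⟩).1 hvb
    rwa [hT.black_unique h1 huv] at h2
  exact (sub hT h h').antisymm (sub hT' h' h)

end Fits

open Classical in
/-- The permutation of the faces given by a pairing. -/
noncomputable def pairPerm (Ω : Finset Face) (T₀ T : Finset (Face × Face)) : Equiv.Perm Ω :=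
  if h : ∃ σ : Equiv.Perm Ω, Fits T₀ T σ then h.choose else 1

theorem IsPairing.fits_pairPerm {Ω : Finset Face} {T₀ T : Finset (Face × Face)}
    (h0 : IsPairing Ω T₀) (hT : IsPairing Ω T) : Fits T₀ T (pairPerm Ω T₀ T) := by
  rw [pairPerm, dif_pos (h0.exists_fits hT)]
  exact (h0.exists_fits hT).choose_spec

/-- The signed weight of a pairing. -/
noncomputable def pairWeight (Ω : Finset Face) (T₀ : Finset (Face × Face)) (d : Face → Face → ℂ)
    (T : Finset (Face × Face)) : ℂ :=
  ((Equiv.Perm.sign (pairPerm Ω T₀ T) : ℤ) : ℂ) * ∏ p ∈ T, d p.2 p.1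

/-- In the Leibniz formula the rows of black faces force the partner in `T₀`, and what remains is a
bijection from white to black faces. The auxiliary rows make the matrix square without numbering the
two colours. -/
theorem det_pairMatrix {Ω : Finset Face} {T₀ : Finset (Face × Face)} (h0 : IsPairing Ω T₀)
    (d : Face → Face → ℂ) :
    (pairMatrix Ω T₀ d).det = ∑ T ∈ pairings Ω, pairWeight Ω T₀ d T := by
  classical
  rw [← Matrix.det_transpose, Matrix.det_apply']
  symm
  refine Finset.sum_of_injOn (pairPerm Ω T₀) ?_ (fun _ _ => Finset.mem_coe.2 (Finset.mem_univ _))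
    ?_ ?_
  · intro T hT T' hT' h
    have hT := mem_pairings.1 hT
    have hT' := mem_pairings.1 hT'
    refine Fits.eq_of_fits hT hT' (h0.fits_pairPerm hT) ?_
    rw [h]
    exact h0.fits_pairPerm hT'
  · intro σ _ hσ
    by_contra hne
    refine hσ ?_
    have hb : ∀ s : Ω, IsBlack s → ((s : Face), (σ s : Face)) ∈ T₀ := by
      intro s hs
      by_contra hn
      refine hne (mul_eq_zero_of_right _ (Finset.prod_eq_zero (Finset.mem_univ s) ?_))
      simp [pairMatrix, hs, hn]
    obtain ⟨T, hT, hf⟩ := exists_pairing_of_perm h0 σ hb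
    exact ⟨T, mem_pairings.2 hT, (h0.fits_pairPerm hT).unique h0 hT hf⟩
  · intro T hT
    have hT := mem_pairings.1 hT
    have hf := h0.fits_pairPerm hT
    rw [pairWeight]
    congr 1
    have h1 : ∀ s : Ω, (pairMatrix Ω T₀ d).transpose (pairPerm Ω T₀ T s) s =
        if ¬ IsBlack s then d s (pairPerm Ω T₀ T s) else 1 := by
      intro s
      by_cases hs : IsBlack s
      · simp [pairMatrix, hs, (hf s).2 hs]
      · simp [pairMatrix, hs]
    rw [Finset.prod_congr rfl fun s _ => h1 s, ← Finset.prod_filter]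
    symm
    refine Finset.prod_bij (fun s _ => ((pairPerm Ω T₀ T s : Face), (s : Face))) ?_ ?_ ?_ ?_
    · intro s hs
      exact (hf s).1 (Finset.mem_filter.1 hs).2
    · intro s _ t _ h
      exact Subtype.ext (Prod.mk.inj h).2
    · rintro ⟨u, v⟩ huv
      have hv := hT.1 _ huv
      have hvb := (isWhite_iff_not_isBlack _).1 hv.2.2.2
      exact ⟨⟨v, hv.2.1⟩, by simpa using hvb, by
        rw [hT.black_unique ((hf ⟨v, hv.2.1⟩).1 hvb) huv]⟩
    · intro s _
      rfl

/-- An exchange composes the permutation with a transposition, and `hd` supplies the second sign. -/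
theorem pairWeight_exchange {Ω : Finset Face} {T₀ T T' : Finset (Face × Face)}
    (h0 : IsPairing Ω T₀) (hT : IsPairing Ω T) {u₁ v₁ u₂ v₂ : Face}
    (h : IsExchange T T' u₁ v₁ u₂ v₂) {d : Face → Face → ℂ}
    (hd : d v₁ u₁ * d v₂ u₂ = -(d v₂ u₁ * d v₁ u₂)) :
    pairWeight Ω T₀ d T = pairWeight Ω T₀ d T' := by
  classical
  have hT' := h.isPairing hT
  obtain ⟨m1, m2⟩ := h.left_mem
  have hv1 := hT.1 _ m1
  have hv2 := hT.1 _ m2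
  have hb1 := (isWhite_iff_not_isBlack _).1 hv1.2.2.2
  have hb2 := (isWhite_iff_not_isBlack _).1 hv2.2.2.2
  have hf := h0.fits_pairPerm hT
  set σ := pairPerm Ω T₀ T with hσ
  set w₁ : Ω := ⟨v₁, hv1.2.1⟩ with hw1
  set w₂ : Ω := ⟨v₂, hv2.2.1⟩ with hw2
  have hw : w₁ ≠ w₂ := fun e => h.2.1 (congrArg Subtype.val e)
  have e1 : (σ w₁ : Face) = u₁ := hT.black_unique ((hf w₁).1 hb1) m1
  have e2 : (σ w₂ : Face) = u₂ := hT.black_unique ((hf w₂).1 hb2) m2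
  have hfit : Fits T₀ T' (σ * Equiv.swap w₁ w₂) := by
    intro s
    by_cases h1 : s = w₁
    · subst h1
      refine ⟨fun _ => ?_, fun hs => absurd hs hb1⟩
      rw [Equiv.Perm.mul_apply, Equiv.swap_apply_left, e2, h.mem_iff hT]
      exact Or.inr (Or.inl ⟨rfl, rfl⟩)
    by_cases h2 : s = w₂
    · subst h2
      refine ⟨fun _ => ?_, fun hs => absurd hs hb2⟩
      rw [Equiv.Perm.mul_apply, Equiv.swap_apply_right, e1, h.mem_iff hT]
      exact Or.inl ⟨rfl, rfl⟩
    rw [Equiv.Perm.mul_apply, Equiv.swap_apply_of_ne_of_ne h1 h2]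
    refine ⟨fun hs => (h.mem_iff hT).2 (Or.inr (Or.inr ⟨(hf s).1 hs, ?_, ?_, ?_, ?_⟩)), (hf s).2⟩
    · exact fun e => h1 (σ.injective (Subtype.ext (e.trans e1.symm)))
    · exact fun e => h2 (σ.injective (Subtype.ext (e.trans e2.symm)))
    · exact fun e => h1 (Subtype.ext e)
    · exact fun e => h2 (Subtype.ext e)
  have hperm : pairPerm Ω T₀ T' = σ * Equiv.swap w₁ w₂ :=
    (h0.fits_pairPerm hT').unique h0 hT' hfit
  rw [pairWeight, pairWeight, hperm, ← hσ, Equiv.Perm.sign_mul, Equiv.Perm.sign_swap hw]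
  obtain ⟨hu, hv, R, n1, n2, n3, n4, rfl, rfl⟩ := h
  rw [Finset.prod_insert, Finset.prod_insert n2, Finset.prod_insert, Finset.prod_insert n4]
  · simp only [mul_neg, mul_one, Units.val_neg, Int.cast_neg]
    linear_combination ((Equiv.Perm.sign σ : ℤ) : ℂ) * (∏ p ∈ R, d p.2 p.1) * hd
  · simp [hu, n3]
  · simp [hu, n1]

open Classical in
-- Turning the row of `v` into a multiple of a unit vector selects the pairings that contain `(u,
-- v)`; this is how an adjugate entry counts dominoes.
theorem prod_pair_row {Ω : Finset Face} {T : Finset (Face × Face)} (hT : IsPairing Ω T)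
    (d : Face → Face → ℂ) (u : Face) {v : Face} (hv : v ∈ Ω) (hvw : IsWhite v) :
    ∏ p ∈ T, (if p.2 = v then (if p.1 = u then d v u else 0) else d p.2 p.1) =
      if (u, v) ∈ T then ∏ p ∈ T, d p.2 p.1 else 0 := by
  split_ifs with h
  · refine Finset.prod_congr rfl ?_
    rintro ⟨a, b⟩ hab
    by_cases hb : b = v
    · subst hb
      simp [hT.black_unique hab h]
    · simp [hb]
  · obtain ⟨a, ha⟩ := hT.exists_black hv hvw
    refine Finset.prod_eq_zero ha ?_
    have : a ≠ u := by rintro rfl; exact h ha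
    simp [this]

open Classical in
theorem pairMatrix_updateRow {Ω : Finset Face} {T₀ : Finset (Face × Face)} (d : Face → Face → ℂ)
    (u v : Ω) (hv : ¬ IsBlack v) (x : ℂ) : (pairMatrix Ω T₀ d).updateRow v (Pi.single u x) =
      pairMatrix Ω T₀ fun s t =>
        if s = (v : Face) then (if t = (u : Face) then x else 0) else d s t := by
  ext s t
  rw [Matrix.updateRow_apply]
  by_cases hs : s = v
  · subst hs
    by_cases ht : t = u
    · subst ht
      simp [pairMatrix, hv]
    · have : (t : Face) ≠ u := fun e => ht (Subtype.ext e)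
      simp [pairMatrix, hv, this, ht]
  · have : (s : Face) ≠ v := fun e => hs (Subtype.ext e)
    simp [pairMatrix, hs, this]


/-! ### The coefficients of the discrete operator and Kasteleyn's theorem -/

theorem lam_mul_lamBar : lam * lamBar = 1 := by
  rw [lam, lamBar, ← Complex.exp_add, add_neg_cancel, Complex.exp_zero]

theorem lamBar_eq_conj : lamBar = (starRingEnd ℂ) lam := by
  rw [lam, lamBar, ← Complex.exp_conj, map_mul, Complex.conj_I, Complex.conj_ofReal, neg_mul]

theorem conj_lamBar : (starRingEnd ℂ) lamBar = lam := by
  rw [lamBar_eq_conj, Complex.conj_conj]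

theorem lam_sq : lam ^ 2 = Complex.I := by
  rw [lam, ← Complex.exp_nat_mul]
  refine Eq.trans (congrArg Complex.exp ?_) Complex.exp_pi_div_two_mul_I
  push_cast
  ring

theorem lam_ne_zero : lam ≠ 0 := Complex.exp_ne_zero _

theorem lamBar_ne_zero : lamBar ≠ 0 := Complex.exp_ne_zero _

theorem lamBar_eq : lamBar = -Complex.I * lam := by
  have h : lam * lamBar = lam * (-Complex.I * lam) := by
    rw [lam_mul_lamBar]
    linear_combination Complex.I * lam_sq + Complex.I_mul_I
  exact mul_left_cancel₀ lam_ne_zero h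

/-- The coefficient of `f t` in `dbar f s`. -/
noncomputable def dbarCoeff (s t : Face) : ℂ :=
  if t = s + (0, 1) then lam / 4 else if t = s - (0, 1) then -(lam / 4)
  else if t = s + (1, 0) then lamBar / 4 else if t = s - (1, 0) then -(lamBar / 4) else 0

theorem dbarCoeff_add_snd (s : Face) : dbarCoeff s (s + (0, 1)) = lam / 4 := by
  simp [dbarCoeff]

theorem dbarCoeff_sub_snd (s : Face) : dbarCoeff s (s - (0, 1)) = -(lam / 4) := by
  rw [dbarCoeff, if_neg, if_pos rfl]
  simp only [Prod.ext_iff, Prod.fst_add, Prod.snd_add, Prod.fst_sub, Prod.snd_sub]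
  omega

theorem dbarCoeff_add_fst (s : Face) : dbarCoeff s (s + (1, 0)) = lamBar / 4 := by
  rw [dbarCoeff, if_neg, if_neg, if_pos rfl] <;>
    simp only [Prod.ext_iff, Prod.fst_add, Prod.snd_add, Prod.fst_sub, Prod.snd_sub] <;> omega

theorem dbarCoeff_sub_fst (s : Face) : dbarCoeff s (s - (1, 0)) = -(lamBar / 4) := by
  rw [dbarCoeff, if_neg, if_neg, if_neg, if_pos rfl] <;>
    simp only [Prod.ext_iff, Prod.fst_add, Prod.snd_add, Prod.fst_sub, Prod.snd_sub] <;> omega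

theorem dbarCoeff_ne_zero_iff {s t : Face} : dbarCoeff s t ≠ 0 ↔ t ∈ nbrs s := by
  rw [mem_nbrs]
  constructor
  · contrapose!
    rintro ⟨h1, h2, h3, h4⟩
    simp [dbarCoeff, h1, h2, h3, h4]
  · have h1 := lam_ne_zero
    have h2 := lamBar_ne_zero
    rintro (rfl | rfl | rfl | rfl)
    · simpa [dbarCoeff_add_fst]
    · simpa [dbarCoeff_sub_fst]
    · simpa [dbarCoeff_add_snd]
    · simpa [dbarCoeff_sub_snd]

theorem dbarCoeff_swap (s t : Face) : dbarCoeff t s = -dbarCoeff s t := by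
  by_cases h : t ∈ nbrs s
  · have e : ∀ s p : Face, s = s + p - p ∧ s = s - p + p := fun s p => ⟨by simp, by simp⟩
    rcases mem_nbrs.1 h with rfl | rfl | rfl | rfl
    · rw [dbarCoeff_add_fst]
      conv_lhs => rw [(e s (1, 0)).1, sub_add_cancel]
      rw [dbarCoeff_sub_fst]
    · rw [dbarCoeff_sub_fst]
      conv_lhs => rw [(e s (1, 0)).2, add_sub_cancel_right]
      rw [dbarCoeff_add_fst, neg_neg]
    · rw [dbarCoeff_add_snd]
      conv_lhs => rw [(e s (0, 1)).1, sub_add_cancel]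
      rw [dbarCoeff_sub_snd]
    · rw [dbarCoeff_sub_snd]
      conv_lhs => rw [(e s (0, 1)).2, add_sub_cancel_right]
      rw [dbarCoeff_add_snd, neg_neg]
  · have h' : s ∉ nbrs t := fun h' => h (mem_nbrs_comm.1 h')
    rw [← dbarCoeff_ne_zero_iff, not_not] at h h'
    rw [h, h', neg_zero]

/-- The Kasteleyn sign condition; it amounts to λ² + λ̄² = 0. -/
theorem IsSquare.dbarCoeff {z : Vertex} {u₁ v₁ u₂ v₂ : Face} (h : IsSquare z u₁ v₁ u₂ v₂) :
    dbarCoeff v₁ u₁ * dbarCoeff v₂ u₂ = -(dbarCoeff v₂ u₁ * dbarCoeff v₁ u₂) := by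
  have e1 : lam * lam = Complex.I := by rw [← lam_sq]; ring
  have e2 : lamBar * lamBar = -Complex.I := by
    rw [lamBar_eq]
    linear_combination Complex.I * Complex.I * e1 + Complex.I * Complex.I_mul_I
  rcases h with ⟨-, rfl, rfl, rfl, rfl⟩ | ⟨-, rfl, rfl, rfl, rfl⟩
  · have a1 := dbarCoeff_add_snd (u₁ - (0, 1))
    have a2 := dbarCoeff_sub_snd (u₁ - (1, 0))
    have a3 := dbarCoeff_add_fst (u₁ - (1, 0))
    have a4 := dbarCoeff_sub_fst (u₁ - (0, 1))
    have b1 : u₁ - (1, 0) - (0, 1) = u₁ - (1, 1) := by simp [sub_sub]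
    have b2 : u₁ - (0, 1) - (1, 0) = u₁ - (1, 1) := by simp [sub_sub]
    rw [sub_add_cancel] at a1 a3
    rw [b1] at a2
    rw [b2] at a4
    rw [a1, a2, a3, a4]
    linear_combination (-1 / 16 : ℂ) * e1 - (1 / 16 : ℂ) * e2
  · have a1 := dbarCoeff_sub_fst v₁
    have a2 := dbarCoeff_add_fst (v₁ - (1, 1))
    have a3 := dbarCoeff_add_snd (v₁ - (1, 1))
    have a4 := dbarCoeff_sub_snd v₁
    have b1 : v₁ - (1, 1) + (1, 0) = v₁ - (0, 1) := by simp [Prod.ext_iff]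
    have b2 : v₁ - (1, 1) + (0, 1) = v₁ - (1, 0) := by simp [Prod.ext_iff]
    rw [b1] at a2
    rw [b2] at a3
    rw [a1, a2, a3, a4]
    linear_combination (-1 / 16 : ℂ) * e1 - (1 / 16 : ℂ) * e2

open Classical in
/-- The number of tilings of `D` that contain the domino `(u, v)`. -/
noncomputable def dominoCount (D : Finset Face) (u v : Face) : ℕ :=
  ((tilings D).filter fun T => (u, v) ∈ T).card

/-- Kasteleyn's theorem: if the pairings of `Ω` with nonzero weight are the tilings of `D`, completed
by a fixed set `P` of pairs, then the inverse matrix gives the domino probabilities. -/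
theorem kasteleyn {Ω D : Finset Face} {T₀ P : Finset (Face × Face)} {d : Face → Face → ℂ}
    (h0 : IsPairing Ω T₀) (hD : ComplementConnected D) (hne : (tilings D).Nonempty)
    (hP : ∀ T, IsTiling D T → IsPairing Ω (T ∪ P) ∧ Disjoint T P)
    (hPd : ∀ T, IsPairing Ω T → ∏ p ∈ T, d p.2 p.1 ≠ 0 → P ⊆ T ∧ IsTiling D (T \ P))
    (hd : ∀ s t, s ∈ D → t ∈ D → d s t = dbarCoeff s t) (hd1 : ∀ p ∈ P, d p.2 p.1 = 1) :
    (pairMatrix Ω T₀ d).det ≠ 0 ∧ ∀ u v : Ω, (v : Face) ∈ D → ¬ IsBlack v →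
      (dominoCount D u v : ℂ) / (tilings D).card = d v u * (pairMatrix Ω T₀ d)⁻¹ u v := by
  classical
  obtain ⟨S, hS⟩ := hne
  have hS := mem_tilings.1 hS
  -- The added pairs `P` are not moved by flips of D, so this weight is flip invariant and hence the
  -- same for all tilings of D.
  set f : Finset (Face × Face) → ℂ := fun T => pairWeight Ω T₀ d (T ∪ P) with hf
  have hflip : ∀ z T T', IsTiling D T → IsFlipAt z T T' → f T = f T' := by
    intro z T T' hT hzT
    have hT' := hzT.isTiling hT
    obtain ⟨u₁, v₁, u₂, v₂, hs, he⟩ := hzT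
    obtain ⟨m1, m2⟩ := he.left_mem
    have a1 := hT.1 _ m1
    have a2 := hT.1 _ m2
    refine pairWeight_exchange h0 (hP T hT).1 (u₁ := u₁) (v₁ := v₁) (u₂ := u₂) (v₂ := v₂) ?_ ?_
    · obtain ⟨hu, hv, R, n1, n2, n3, n4, rfl, rfl⟩ := he
      have d1 := Finset.disjoint_left.1 (hP _ hT).2
      have d2 := Finset.disjoint_left.1 (hP _ hT').2
      refine ⟨hu, hv, R ∪ P, ?_, ?_, ?_, ?_, by simp only [Finset.insert_union],
        by simp only [Finset.insert_union]⟩ <;> rw [Finset.mem_union, not_or]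
      · exact ⟨n1, d1 (by simp)⟩
      · exact ⟨n2, d1 (by simp)⟩
      · exact ⟨n3, d2 (by simp)⟩
      · exact ⟨n4, d2 (by simp)⟩
    · rw [hd _ _ a1.2.1 a1.1, hd _ _ a2.2.1 a2.1, hd _ _ a2.2.1 a1.1, hd _ _ a1.2.1 a2.1]
      exact hs.dbarCoeff
  have hconst : ∀ T, IsTiling D T → f T = f S := fun T hT =>
    eq_of_flip_invariant hD f hflip hT hS
  have hfS : f S ≠ 0 := by
    refine mul_ne_zero ?_ (Finset.prod_ne_zero_iff.2 fun p hp => ?_)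
    · exact_mod_cast (Equiv.Perm.sign _).ne_zero
    · rcases Finset.mem_union.1 hp with hp | hp
      · have := hS.1 p hp
        rw [hd _ _ this.2.1 this.1, dbarCoeff_ne_zero_iff]
        exact mem_nbrs_comm.1 this.2.2.2.2
      · rw [hd1 p hp]
        exact one_ne_zero
  -- Stated for a general matrix `e`, since it is needed both for `d` and for `d` with one row
  -- replaced.
  have hsum : ∀ e : Face → Face → ℂ, (∀ T, IsPairing Ω T → ∏ p ∈ T, e p.2 p.1 ≠ 0 →
      ∏ p ∈ T, d p.2 p.1 ≠ 0) →
      (pairMatrix Ω T₀ e).det = ∑ T ∈ tilings D, pairWeight Ω T₀ e (T ∪ P) := by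
    intro e he
    rw [det_pairMatrix h0]
    symm
    refine Finset.sum_of_injOn (fun T => T ∪ P) ?_ ?_ ?_ (fun _ _ => rfl)
    · intro T hT T' hT' h
      have h1 := (hP T (mem_tilings.1 hT)).2
      have h2 := (hP T' (mem_tilings.1 hT')).2
      rw [← Finset.union_sdiff_cancel_right h1, ← Finset.union_sdiff_cancel_right h2]
      exact congrArg (· \ P) h
    · intro T hT
      exact mem_pairings.2 (hP T (mem_tilings.1 hT)).1
    · intro T hT hn
      by_contra hne
      have hT := mem_pairings.1 hT
      obtain ⟨h1, h2⟩ := hPd T hT (he T hT (right_ne_zero_of_mul hne))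
      exact hn ⟨T \ P, mem_tilings.2 h2, Finset.sdiff_union_of_subset h1⟩
  have hdet : (pairMatrix Ω T₀ d).det = (tilings D).card * f S := by
    rw [hsum d fun _ _ h => h, Finset.sum_congr rfl fun T hT => hconst T (mem_tilings.1 hT),
      Finset.sum_const, nsmul_eq_mul]
  have hcard : ((tilings D).card : ℂ) ≠ 0 :=
    Nat.cast_ne_zero.2 (Finset.card_ne_zero.2 ⟨S, mem_tilings.2 hS⟩)
  refine ⟨by rw [hdet]; exact mul_ne_zero hcard hfS, fun u v hvD hv => ?_⟩
  -- The adjugate entry times `d v u` is the determinant with row `v` replaced by `d v u` times a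
  -- unit vector; its surviving terms are the tilings with the domino `(u, v)`, all of weight `f S`.
  have hrow : (pairMatrix Ω T₀ d).adjugate u v * d v u = dominoCount D u v * f S := by
    rw [Matrix.adjugate_apply, mul_comm, ← Matrix.det_updateRow_smul,
      ← Pi.single_smul, smul_eq_mul, mul_one, pairMatrix_updateRow d u v hv]
    have hprod : ∀ T, IsPairing Ω T → ∏ p ∈ T, (if p.2 = (v : Face) then
        (if p.1 = (u : Face) then d v u else 0) else d p.2 p.1) =
        if ((u : Face), (v : Face)) ∈ T then ∏ p ∈ T, d p.2 p.1 else 0 := fun T hT =>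
      prod_pair_row hT d u v.2 ((isWhite_iff_not_isBlack _).2 hv)
    rw [hsum]
    · have : ∀ T ∈ tilings D, pairWeight Ω T₀ (fun s t => if s = (v : Face) then
          (if t = (u : Face) then d v u else 0) else d s t) (T ∪ P) =
          if ((u : Face), (v : Face)) ∈ T then f S else 0 := by
        intro T hT
        have hT := mem_tilings.1 hT
        have hmem : ((u : Face), (v : Face)) ∈ T ∪ P ↔ ((u : Face), (v : Face)) ∈ T := by
          refine ⟨fun h => ?_, fun h => Finset.mem_union_left _ h⟩
          obtain ⟨a, ha⟩ := hT.isPairing.exists_black hvD ((isWhite_iff_not_isBlack _).2 hv)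
          rwa [← (hP T hT).1.black_unique (Finset.mem_union_left _ ha) h]
        rw [pairWeight, hprod _ (hP T hT).1]
        simp only [hmem]
        split_ifs
        · exact hconst T hT
        · simp
      rw [Finset.sum_congr rfl this, ← Finset.sum_filter, Finset.sum_const, nsmul_eq_mul]
      rfl
    · intro T hT h
      rw [hprod T hT] at h
      split_ifs at h with hm
      · exact h
      · exact absurd rfl h
  rw [Matrix.inv_def, Matrix.smul_apply, Ring.inverse_eq_inv', hdet, smul_eq_mul]
  field_simp
  linear_combination -hrow


/-! ### The discrete holomorphic functions -/

theorem dbar_eq (f : Face → ℂ) (s : Face) : dbar f s = lam / 4 * f (s + (0, 1)) -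
    lam / 4 * f (s - (0, 1)) + (lamBar / 4 * f (s + (1, 0)) - lamBar / 4 * f (s - (1, 0))) := by
  have h1 : lamBar⁻¹ = lam := inv_eq_of_mul_eq_one_left lam_mul_lamBar
  have h2 : lam⁻¹ = lamBar := by rw [← h1, inv_inv]
  rw [dbar, div_eq_mul_inv _ (2 * lamBar), div_eq_mul_inv _ (2 * lam), mul_inv, mul_inv, h1, h2]
  ring

theorem dbar_eq_sum {Ω : Finset Face} {f : Face → ℂ} (hf : ∀ t, t ∉ Ω → f t = 0) (s : Face) :
    dbar f s = ∑ t : Ω, dbarCoeff s t * f t := by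
  have h1 : dbar f s = ∑ t ∈ nbrs s, dbarCoeff s t * f t := by
    rw [nbrs, Finset.sum_insert, Finset.sum_insert, Finset.sum_insert, Finset.sum_singleton,
      dbar_eq, dbarCoeff_add_fst, dbarCoeff_sub_fst, dbarCoeff_add_snd, dbarCoeff_sub_snd]
    · ring
    all_goals simp [Prod.ext_iff] <;> omega
  rw [h1, Finset.sum_coe_sort Ω fun t => dbarCoeff s t * f t]
  rw [Finset.sum_subset (Finset.subset_union_left (s₁ := nbrs s) (s₂ := Ω)),
    ← Finset.sum_subset (Finset.subset_union_right (s₁ := nbrs s) (s₂ := Ω))]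
  · intro t _ ht
    rw [hf t ht, mul_zero]
  · intro t _ ht
    rw [← dbarCoeff_ne_zero_iff, not_not] at ht
    rw [ht, zero_mul]

theorem dbarCoeff_eq_zero_of_color {s t : Face} (h : IsBlack s ↔ IsBlack t) :
    dbarCoeff s t = 0 := by
  by_contra hn
  have := isBlack_iff_of_mem_nbrs (dbarCoeff_ne_zero_iff.1 hn)
  tauto

/-! ### Columns and rows of an inverse matrix, and a rank-one update. -/

section Inverse

variable {ι : Type*} [Fintype ι] [DecidableEq ι]

theorem inv_apply_of_mulVec {M : Matrix ι ι ℂ} (hM : M.det ≠ 0) {x : ι → ℂ} {j : ι} {a : ℂ}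
    (h : M.mulVec x = Pi.single j a) (i : ι) : x i = a * M⁻¹ i j := by
  have h1 : M⁻¹.mulVec (M.mulVec x) = x := by
    rw [Matrix.mulVec_mulVec, Matrix.nonsing_inv_mul _ (isUnit_iff_ne_zero.2 hM),
      Matrix.one_mulVec]
  rw [← h1, h, Matrix.mulVec_single]
  simp [mul_comm]

theorem mulVec_inv_col {M : Matrix ι ι ℂ} (hM : M.det ≠ 0) (j : ι) :
    M.mulVec (fun i => M⁻¹ i j) = Pi.single j 1 := by
  have h1 := congrFun (congrArg Matrix.transpose
    (Matrix.mul_nonsing_inv M (isUnit_iff_ne_zero.2 hM))) j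
  ext i
  have h2 := congrFun h1 i
  simp only [Matrix.transpose_apply, Matrix.mul_apply, Matrix.one_apply] at h2
  rw [Matrix.mulVec, dotProduct, h2, Pi.single_apply]

theorem inv_apply_of_vecMul {M : Matrix ι ι ℂ} (hM : M.det ≠ 0) {x : ι → ℂ} {j : ι} {a : ℂ}
    (h : Matrix.vecMul x M = Pi.single j a) (i : ι) : x i = a * M⁻¹ j i := by
  have h1 : Matrix.vecMul (Matrix.vecMul x M) M⁻¹ = x := by
    rw [Matrix.vecMul_vecMul, Matrix.mul_nonsing_inv _ (isUnit_iff_ne_zero.2 hM),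
      Matrix.vecMul_one]
  rw [← h1, h, Matrix.single_vecMul]
  simp

theorem vecMul_inv_row {M : Matrix ι ι ℂ} (hM : M.det ≠ 0) (j : ι) :
    Matrix.vecMul (M⁻¹ j) M = Pi.single j 1 := by
  have h1 := congrFun (Matrix.nonsing_inv_mul M (isUnit_iff_ne_zero.2 hM)) j
  ext i
  have h2 := congrFun h1 i
  simp only [Matrix.mul_apply, Matrix.one_apply] at h2
  rw [Matrix.vecMul, dotProduct, h2, Pi.single_apply]
  simp only [eq_comm]

/-- Subtract from column `j` of the inverse the multiple of column `j₀` that makes entry `i₀`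
vanish. The new row `j₀` then gives 0, and in the other rows column `j₀` contributes nothing. -/
theorem inv_updateRow_single {M : Matrix ι ι ℂ} (hM : M.det ≠ 0) {i₀ j₀ : ι}
    (hX : M⁻¹ i₀ j₀ ≠ 0) (hM' : (M.updateRow j₀ (Pi.single i₀ 1)).det ≠ 0) {j : ι} (hj : j ≠ j₀)
    (i : ι) : (M.updateRow j₀ (Pi.single i₀ 1))⁻¹ i j =
      M⁻¹ i j - M⁻¹ i j₀ * M⁻¹ i₀ j / M⁻¹ i₀ j₀ := by
  have h : (M.updateRow j₀ (Pi.single i₀ 1)).mulVec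
      (fun i => M⁻¹ i j - M⁻¹ i j₀ * M⁻¹ i₀ j / M⁻¹ i₀ j₀) = Pi.single j 1 := by
    ext s
    by_cases hs : s = j₀
    · subst hs
      rw [Matrix.mulVec, Matrix.updateRow_self, single_dotProduct]
      rw [Pi.single_apply, if_neg hj.symm]
      field_simp
      ring
    · rw [Matrix.mulVec, Matrix.updateRow_ne hs]
      have e1 := congrFun (mulVec_inv_col hM j) s
      have e2 := congrFun (mulVec_inv_col hM j₀) s
      rw [Matrix.mulVec, dotProduct] at e1 e2
      rw [Pi.single_apply, if_neg hs] at e2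
      rw [← e1, dotProduct]
      have e3 : ∀ t, M s t * (M⁻¹ t j - M⁻¹ t j₀ * M⁻¹ i₀ j / M⁻¹ i₀ j₀) =
          M s t * M⁻¹ t j - M s t * M⁻¹ t j₀ * (M⁻¹ i₀ j / M⁻¹ i₀ j₀) := fun t => by ring
      simp only [e3]
      rw [Finset.sum_sub_distrib, ← Finset.sum_mul, e2, zero_mul, sub_zero]
  rw [inv_apply_of_mulVec hM' h i, one_mul]

end Inverse

/-! ### The equations for F and G over the complex numbers, solved by the inverse matrix. -/

section Solutions

variable {Ω : Finset Face} {T₀ : Finset (Face × Face)}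

open Classical in
/-- The extension by zero of a function on `Ω`. -/
noncomputable def extendZero (y : Ω → ℂ) (s : Face) : ℂ :=
  if h : s ∈ Ω then y ⟨s, h⟩ else 0

theorem extendZero_coe (y : Ω → ℂ) (s : Ω) : extendZero y s = y s :=
  dif_pos s.2

theorem extendZero_of_notMem (y : Ω → ℂ) {s : Face} (hs : s ∉ Ω) : extendZero y s = 0 :=
  dif_neg hs

/-- The equations for `F` without the reality conditions. -/
def IsComplexF (Ω : Finset Face) (v₀ : Face) (F : Face → ℂ) : Prop :=
  (∀ s, ¬ (s ∈ Ω ∧ IsBlack s) → F s = 0) ∧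
    ∀ v ∈ Ω, ¬ IsBlack v → dbar F v = if v = v₀ then lam else 0

/-- The equations for `G` without the reality conditions. -/
def IsComplexG (Ω : Finset Face) (u₀ : Face) (G : Face → ℂ) : Prop :=
  (∀ s, ¬ (s ∈ Ω ∧ ¬ IsBlack s) → G s = 0) ∧
    ∀ u ∈ Ω, IsBlack u → dbar G u = if u = u₀ then Complex.I else 0

/-- The white rows of the matrix express `dbar F`, while the black rows pick out values of F at
white faces, which are 0. -/
theorem IsComplexF.eq_inv (h0 : IsPairing Ω T₀) (hM : (pairMatrix Ω T₀ dbarCoeff).det ≠ 0)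
    {v₀ : Ω} (hv₀ : ¬ IsBlack v₀) {F : Face → ℂ} (hF : IsComplexF Ω v₀ F) (s : Ω) :
    F s = lam * (pairMatrix Ω T₀ dbarCoeff)⁻¹ s v₀ := by
  refine inv_apply_of_mulVec hM (x := fun s : Ω => F s) ?_ s
  ext s
  rw [Matrix.mulVec, dotProduct]
  by_cases hs : IsBlack s
  · have : s ≠ v₀ := by rintro rfl; exact hv₀ hs
    rw [Pi.single_apply, if_neg this]
    refine Finset.sum_eq_zero fun t _ => ?_
    by_cases ht : ((s : Face), (t : Face)) ∈ T₀
    · rw [hF.1 t fun h => (isWhite_iff_not_isBlack _).1 (h0.1 _ ht).2.2.2 h.2, mul_zero]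
    · simp [pairMatrix, hs, ht]
  · simp only [pairMatrix, hs, if_false]
    rw [← dbar_eq_sum (fun t ht => hF.1 t fun h => ht h.1), hF.2 s s.2 hs, Pi.single_apply]
    simp only [Subtype.ext_iff]

theorem exists_isComplexF (h0 : IsPairing Ω T₀) (hM : (pairMatrix Ω T₀ dbarCoeff).det ≠ 0)
    {v₀ : Ω} (hv₀ : ¬ IsBlack v₀) : ∃ F, IsComplexF Ω v₀ F := by
  classical
  set M := pairMatrix Ω T₀ dbarCoeff with hMdef
  obtain ⟨y, hy⟩ : ∃ y : Ω → ℂ, M.mulVec y = Pi.single v₀ 1 := ⟨_, mulVec_inv_col hM v₀⟩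
  have hcol := fun s => congrFun hy s
  simp only [Matrix.mulVec, dotProduct, Pi.single_apply] at hcol
  refine ⟨fun s => lam * extendZero y s, fun s hs => ?_, fun v hv hvb => ?_⟩
  · beta_reduce
    by_cases hsΩ : s ∈ Ω
    · have hsb : ¬ IsBlack s := fun h => hs ⟨hsΩ, h⟩
      obtain ⟨u, hu⟩ := h0.exists_black hsΩ ((isWhite_iff_not_isBlack _).2 hsb)
      have hu' := h0.1 _ hu
      have h1 := hcol ⟨u, hu'.1⟩
      have h2 : (⟨u, hu'.1⟩ : Ω) ≠ v₀ := by rintro rfl; exact hv₀ hu'.2.2.1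
      rw [if_neg h2, Finset.sum_eq_single ⟨s, hsΩ⟩] at h1
      · simp only [hMdef, pairMatrix, hu'.2.2.1, hu, if_true, one_mul] at h1
        rw [extendZero_coe y ⟨s, hsΩ⟩, h1, mul_zero]
      · intro t _ ht
        have : (u, (t : Face)) ∉ T₀ := fun h => ht (Subtype.ext (h0.white_unique h hu))
        simp [hMdef, pairMatrix, hu'.2.2.1, this]
      · simp
    · rw [extendZero_of_notMem y hsΩ, mul_zero]
  · rw [dbar_eq_sum fun t ht => by rw [extendZero_of_notMem y ht, mul_zero]]
    have h1 := hcol ⟨v, hv⟩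
    simp only [hMdef, pairMatrix, hvb, if_false, Subtype.ext_iff] at h1
    have h2 : ∀ t : Ω, dbarCoeff v t * (lam * extendZero y t) = lam * (dbarCoeff v t * y t) := by
      intro t
      rw [extendZero_coe]
      ring
    rw [Finset.sum_congr rfl fun t _ => h2 t, ← Finset.mul_sum, h1, mul_ite, mul_one, mul_zero]

/-- G solves the transposed system. The minus sign comes from the antisymmetry of the coefficients.
-/
theorem IsComplexG.eq_inv (hM : (pairMatrix Ω T₀ dbarCoeff).det ≠ 0)
    {u₀ : Ω} (hu₀ : IsBlack u₀) {G : Face → ℂ} (hG : IsComplexG Ω u₀ G) (s : Ω) :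
    G s = -Complex.I * (pairMatrix Ω T₀ dbarCoeff)⁻¹ u₀ s := by
  refine inv_apply_of_vecMul hM (x := fun s : Ω => G s) ?_ s
  ext t
  rw [Matrix.vecMul, dotProduct]
  have h1 : ∀ s : Ω, G s * pairMatrix Ω T₀ dbarCoeff s t = -(dbarCoeff t s * G s) := by
    intro s
    by_cases hs : IsBlack s
    · rw [hG.1 s fun h => h.2 hs]
      ring
    · simp only [pairMatrix, hs, if_false]
      rw [dbarCoeff_swap]
      ring
  simp only [h1]
  rw [Finset.sum_neg_distrib, Pi.single_apply]
  by_cases ht : IsBlack t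
  · rw [← dbar_eq_sum (fun t ht => hG.1 t fun h => ht h.1), hG.2 t t.2 ht]
    simp only [Subtype.ext_iff]
    split_ifs <;> simp
  · have : t ≠ u₀ := by rintro rfl; exact ht hu₀
    rw [if_neg this, neg_eq_zero]
    refine Finset.sum_eq_zero fun s _ => ?_
    by_cases hs : IsBlack s
    · rw [hG.1 s fun h => h.2 hs, mul_zero]
    · rw [dbarCoeff_eq_zero_of_color (iff_of_false ht hs), zero_mul]

theorem exists_isComplexG (h0 : IsPairing Ω T₀) (hM : (pairMatrix Ω T₀ dbarCoeff).det ≠ 0)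
    {u₀ : Ω} (hu₀ : IsBlack u₀) : ∃ G, IsComplexG Ω u₀ G := by
  classical
  set M := pairMatrix Ω T₀ dbarCoeff with hMdef
  obtain ⟨y, hy⟩ : ∃ y : Ω → ℂ, Matrix.vecMul y M = Pi.single u₀ 1 := ⟨_, vecMul_inv_row hM u₀⟩
  have hrow := fun t => congrFun hy t
  simp only [Matrix.vecMul, dotProduct, Pi.single_apply] at hrow
  -- The column of the white partner `w` of `s` has only one entry that counts, the 1 in row `s`:
  -- all coefficients between two white faces vanish.
  have hblack : ∀ s : Ω, IsBlack s → y s = 0 := by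
    intro s hs
    obtain ⟨w, hw⟩ := h0.exists_white s.2 hs
    have hw' := h0.1 _ hw
    have hwb := (isWhite_iff_not_isBlack _).1 hw'.2.2.2
    have h1 := hrow ⟨w, hw'.2.1⟩
    have h2 : (⟨w, hw'.2.1⟩ : Ω) ≠ u₀ := by rintro rfl; exact hwb hu₀
    rw [if_neg h2, Finset.sum_eq_single s] at h1
    · simpa only [hMdef, pairMatrix, hs, hw, if_true, mul_one] using h1
    · intro t _ ht
      by_cases htb : IsBlack t
      · have : ((t : Face), w) ∉ T₀ := fun h => ht (Subtype.ext (h0.black_unique h hw))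
        simp [hMdef, pairMatrix, htb, this]
      · simp only [hMdef, pairMatrix, htb, if_false]
        rw [dbarCoeff_eq_zero_of_color (iff_of_false htb hwb), mul_zero]
    · simp
  refine ⟨fun s => -Complex.I * extendZero y s, fun s hs => ?_, fun u hu hub => ?_⟩
  · beta_reduce
    by_cases hsΩ : s ∈ Ω
    · have hsb : IsBlack s := by by_contra h; exact hs ⟨hsΩ, h⟩
      rw [extendZero_coe y ⟨s, hsΩ⟩, hblack ⟨s, hsΩ⟩ hsb, mul_zero]
    · rw [extendZero_of_notMem y hsΩ, mul_zero]
  · rw [dbar_eq_sum fun t ht => by rw [extendZero_of_notMem y ht, mul_zero]]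
    have h1 := hrow ⟨u, hu⟩
    have h2 : ∀ t : Ω, dbarCoeff u t * (-Complex.I * extendZero y t) =
        Complex.I * (y t * M t ⟨u, hu⟩) := by
      intro t
      rw [extendZero_coe]
      by_cases ht : IsBlack t
      · rw [hblack t ht]
        ring
      · simp only [hMdef, pairMatrix, ht, if_false]
        rw [dbarCoeff_swap]
        ring
    rw [Finset.sum_congr rfl fun t _ => h2 t, ← Finset.mul_sum, h1, mul_ite, mul_one, mul_zero]
    simp only [Subtype.ext_iff]

end Solutions

end DoubleDimer

namespace DoubleDimer

open scoped ComplexConjugate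

/-! ### Reality conditions -/

theorem conj_lam : conj lam = lamBar := lamBar_eq_conj.symm

theorem I_mul_lam : Complex.I * lam = -lamBar := by
  rw [lamBar_eq]
  ring

theorem I_mul_lamBar : Complex.I * lamBar = lam := by
  rw [lamBar_eq]
  linear_combination -lam * Complex.I_mul_I

theorem face_types (s : Face) :
    (IsBlack s ↔ IsBlack0 s ∨ IsBlack1 s) ∧ ¬ (IsBlack0 s ∧ IsBlack1 s) ∧
      (¬ IsBlack s ↔ IsWhite0 s ∨ IsWhite1 s) ∧ ¬ (IsWhite0 s ∧ IsWhite1 s) := by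
  simp only [IsBlack, IsBlack0, IsBlack1, IsWhite0, IsWhite1, Int.even_iff, Int.odd_iff]
  omega

theorem neighbour_types (s : Face) :
    (IsWhite0 s → IsBlack0 (s + (0, 1)) ∧ IsBlack0 (s - (0, 1)) ∧ IsBlack1 (s + (1, 0)) ∧
      IsBlack1 (s - (1, 0))) ∧
    (IsWhite1 s → IsBlack1 (s + (0, 1)) ∧ IsBlack1 (s - (0, 1)) ∧ IsBlack0 (s + (1, 0)) ∧
      IsBlack0 (s - (1, 0))) ∧
    (IsBlack0 s → IsWhite0 (s + (0, 1)) ∧ IsWhite0 (s - (0, 1)) ∧ IsWhite1 (s + (1, 0)) ∧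
      IsWhite1 (s - (1, 0))) ∧
    (IsBlack1 s → IsWhite1 (s + (0, 1)) ∧ IsWhite1 (s - (0, 1)) ∧ IsWhite0 (s + (1, 0)) ∧
      IsWhite0 (s - (1, 0))) := by
  simp only [IsBlack0, IsBlack1, IsWhite0, IsWhite1, Int.even_iff, Int.odd_iff, Prod.fst_add,
    Prod.snd_add, Prod.fst_sub, Prod.snd_sub]
  omega

open Classical in
/-- The reflection of a function in the lines prescribed for the values of `F`. -/
noncomputable def reflectF (F : Face → ℂ) (s : Face) : ℂ :=
  if IsBlack1 s then -conj (F s) else conj (F s)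

open Classical in
/-- The reflection of a function in the lines prescribed for the values of `G`. -/
noncomputable def reflectG (G : Face → ℂ) (s : Face) : ℂ :=
  if IsWhite1 s then -Complex.I * conj (G s) else Complex.I * conj (G s)

theorem reflectF_black0 (F : Face → ℂ) {s : Face} (h : IsBlack0 s) :
    reflectF F s = conj (F s) :=
  if_neg fun h' => (face_types s).2.1 ⟨h, h'⟩

theorem reflectF_black1 (F : Face → ℂ) {s : Face} (h : IsBlack1 s) :
    reflectF F s = -conj (F s) := if_pos h

theorem reflectG_white0 (G : Face → ℂ) {s : Face} (h : IsWhite0 s) :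
    reflectG G s = Complex.I * conj (G s) :=
  if_neg fun h' => (face_types s).2.2.2 ⟨h, h'⟩

theorem reflectG_white1 (G : Face → ℂ) {s : Face} (h : IsWhite1 s) :
    reflectG G s = -Complex.I * conj (G s) := if_pos h

theorem conj_dbar (f : Face → ℂ) (s : Face) : conj (dbar f s) =
    lamBar / 4 * conj (f (s + (0, 1))) - lamBar / 4 * conj (f (s - (0, 1))) +
      (lam / 4 * conj (f (s + (1, 0))) - lam / 4 * conj (f (s - (1, 0)))) := by
  rw [dbar_eq]
  simp [conj_lam, conj_lamBar, map_ofNat]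

/-- Reflecting the values of F in their prescribed lines reflects the values of `dbar F` in the
lines λℝ at white faces of type 0 and λ̄ℝ at type 1. -/
theorem dbar_reflectF (F : Face → ℂ) (s : Face) :
    (IsWhite0 s → dbar (reflectF F) s = Complex.I * conj (dbar F s)) ∧
    (IsWhite1 s → dbar (reflectF F) s = -Complex.I * conj (dbar F s)) := by
  constructor <;> intro h <;> rw [conj_dbar, dbar_eq]
  · obtain ⟨h1, h2, h3, h4⟩ := (neighbour_types s).1 h
    rw [reflectF_black0 F h1, reflectF_black0 F h2, reflectF_black1 F h3, reflectF_black1 F h4]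
    linear_combination (-conj (F (s + (0, 1))) + conj (F (s - (0, 1)))) / 4 * I_mul_lamBar -
      (conj (F (s + (1, 0))) - conj (F (s - (1, 0)))) / 4 * I_mul_lam
  · obtain ⟨h1, h2, h3, h4⟩ := (neighbour_types s).2.1 h
    rw [reflectF_black1 F h1, reflectF_black1 F h2, reflectF_black0 F h3, reflectF_black0 F h4]
    linear_combination (conj (F (s + (0, 1))) - conj (F (s - (0, 1)))) / 4 * I_mul_lamBar +
      (conj (F (s + (1, 0))) - conj (F (s - (1, 0)))) / 4 * I_mul_lam

theorem dbar_reflectG (G : Face → ℂ) (s : Face) :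
    (IsBlack0 s → dbar (reflectG G) s = -conj (dbar G s)) ∧
    (IsBlack1 s → dbar (reflectG G) s = conj (dbar G s)) := by
  constructor <;> intro h <;> rw [conj_dbar, dbar_eq]
  · obtain ⟨h1, h2, h3, h4⟩ := (neighbour_types s).2.2.1 h
    rw [reflectG_white0 G h1, reflectG_white0 G h2, reflectG_white1 G h3, reflectG_white1 G h4]
    linear_combination (conj (G (s + (0, 1))) - conj (G (s - (0, 1)))) / 4 * I_mul_lam -
      (conj (G (s + (1, 0))) - conj (G (s - (1, 0)))) / 4 * I_mul_lamBar
  · obtain ⟨h1, h2, h3, h4⟩ := (neighbour_types s).2.2.2 h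
    rw [reflectG_white1 G h1, reflectG_white1 G h2, reflectG_white0 G h3, reflectG_white0 G h4]
    linear_combination -(conj (G (s + (0, 1))) - conj (G (s - (0, 1)))) / 4 * I_mul_lam +
      (conj (G (s + (1, 0))) - conj (G (s - (1, 0)))) / 4 * I_mul_lamBar

/-- The prescribed value λ is fixed by the reflection at a white face of type 0. Uniqueness of the
complex solution then forces it to equal its reflection, which is the reality condition. -/
theorem IsComplexF.reflect {Ω : Finset Face} {v₀ : Face} (hv₀ : IsWhite0 v₀) {F : Face → ℂ}
    (hF : IsComplexF Ω v₀ F) : IsComplexF Ω v₀ (reflectF F) := by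
  refine ⟨fun s hs => by simp [reflectF, hF.1 s hs], fun v hv hvb => ?_⟩
  have h := hF.2 v hv hvb
  by_cases hvv : v = v₀
  · subst hvv
    rw [if_pos rfl] at h ⊢
    rw [(dbar_reflectF F v).1 hv₀, h, conj_lam, I_mul_lamBar]
  · rw [if_neg hvv] at h ⊢
    rcases (face_types v).2.2.1.1 hvb with h' | h'
    · rw [(dbar_reflectF F v).1 h', h, map_zero, mul_zero]
    · rw [(dbar_reflectF F v).2 h', h, map_zero, mul_zero]

theorem IsComplexG.reflect {Ω : Finset Face} {u₀ : Face} (hu₀ : IsBlack0 u₀) {G : Face → ℂ}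
    (hG : IsComplexG Ω u₀ G) : IsComplexG Ω u₀ (reflectG G) := by
  refine ⟨fun s hs => by simp [reflectG, hG.1 s hs], fun u hu hub => ?_⟩
  have h := hG.2 u hu hub
  by_cases huu : u = u₀
  · subst huu
    rw [if_pos rfl] at h ⊢
    rw [(dbar_reflectG G u).1 hu₀, h, Complex.conj_I, neg_neg]
  · rw [if_neg huu] at h ⊢
    rcases (face_types u).1.1 hub with h' | h'
    · rw [(dbar_reflectG G u).1 h', h, map_zero, neg_zero]
    · rw [(dbar_reflectG G u).2 h', h, map_zero]

theorem IsComplexF.isF {Ω : Finset Face} {v₀ : Face} (hv₀ : IsWhite0 v₀) (hv₀Ω : v₀ ∈ Ω)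
    {F : Face → ℂ} (hF : IsComplexF Ω v₀ F) (hr : reflectF F = F) : IsF Ω v₀ F := by
  have hb : ¬ IsBlack v₀ := (face_types v₀).2.2.1.2 (Or.inl hv₀)
  refine ⟨hF.1, fun s hs => ?_, fun s hs => ?_, fun v hv hvw hne => ?_, ?_⟩
  · have := congrFun hr s
    rw [reflectF_black0 F hs] at this
    exact Complex.conj_eq_iff_im.1 this
  · have := congrArg Complex.re (congrFun hr s)
    rw [reflectF_black1 F hs, Complex.neg_re, Complex.conj_re] at this
    linarith
  · rw [hF.2 v hv ((isWhite_iff_not_isBlack v).1 hvw), if_neg hne]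
  · rw [hF.2 v₀ hv₀Ω hb, if_pos rfl]

theorem IsF.isComplexF {Ω : Finset Face} {v₀ : Face} {F : Face → ℂ} (hF : IsF Ω v₀ F) :
    IsComplexF Ω v₀ F := by
  refine ⟨hF.zero, fun v hv hvb => ?_⟩
  split_ifs with h
  · rw [h, hF.pole]
  · exact hF.holo v hv ((isWhite_iff_not_isBlack v).2 hvb) h

theorem IsComplexG.isG {Ω : Finset Face} {u₀ : Face} (hu₀ : IsBlack0 u₀) (hu₀Ω : u₀ ∈ Ω)
    {G : Face → ℂ} (hG : IsComplexG Ω u₀ G) (hr : reflectG G = G) : IsG Ω u₀ G := by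
  have hb : IsBlack u₀ := (face_types u₀).1.2 (Or.inl hu₀)
  refine ⟨fun s hs => hG.1 s (by rwa [← isWhite_iff_not_isBlack]), fun s hs => ?_, fun s hs => ?_,
    fun u hu hub hne => ?_, ?_⟩
  · have h1 := congrFun hr s
    rw [reflectG_white0 G hs] at h1
    have h2 : conj (lamBar * G s) = lamBar * G s := by
      rw [map_mul, conj_lamBar]
      linear_combination lamBar * h1 - conj (G s) * I_mul_lamBar
    obtain ⟨r, hr⟩ := Complex.conj_eq_iff_real.1 h2
    exact ⟨r, by rw [← hr, ← mul_assoc, lam_mul_lamBar, one_mul]⟩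
  · have h1 := congrFun hr s
    rw [reflectG_white1 G hs] at h1
    have h2 : conj (lam * G s) = lam * G s := by
      rw [map_mul, conj_lam]
      linear_combination lam * h1 + conj (G s) * I_mul_lam
    obtain ⟨r, hr⟩ := Complex.conj_eq_iff_real.1 h2
    exact ⟨r, by rw [← hr, ← mul_assoc, mul_comm lamBar, lam_mul_lamBar, one_mul]⟩
  · rw [hG.2 u hu hub, if_neg hne]
  · rw [hG.2 u₀ hu₀Ω hb, if_pos rfl]

theorem IsG.isComplexG {Ω : Finset Face} {u₀ : Face} {G : Face → ℂ} (hG : IsG Ω u₀ G) :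
    IsComplexG Ω u₀ G := by
  refine ⟨fun s hs => hG.zero s (by rwa [isWhite_iff_not_isBlack]), fun u hu hub => ?_⟩
  split_ifs with h
  · rw [h, hG.pole]
  · exact hG.holo u hu hub h

/-! ### Existence, uniqueness and domino probabilities -/

section Green

variable {Ω : Finset Face} {u₀ v₀ : Face}

/-- `kasteleyn` with nothing removed: a pairing has nonzero weight only if all its pairs are
adjacent. -/
theorem det_ne_zero (hΩ : ComplementConnected Ω) {T₀ : Finset (Face × Face)}
    (hT₀ : IsTiling Ω T₀) : (pairMatrix Ω T₀ dbarCoeff).det ≠ 0 ∧ ∀ u v : Ω, ¬ IsBlack v →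
      (dominoCount Ω u v : ℂ) / (tilings Ω).card =
        dbarCoeff v u * (pairMatrix Ω T₀ dbarCoeff)⁻¹ u v := by
  have := kasteleyn (P := ∅) (d := dbarCoeff) hT₀.isPairing hΩ ⟨T₀, mem_tilings.2 hT₀⟩
    (fun T hT => ⟨by simpa using hT.isPairing, by simp⟩)
    (fun T hT h => ⟨by simp, by
      rw [Finset.sdiff_empty]
      refine isTiling_iff.2 ⟨hT, fun p hp => mem_nbrs_comm.1 ?_⟩
      exact dbarCoeff_ne_zero_iff.1 (Finset.prod_ne_zero_iff.1 h p hp)⟩)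
    (fun _ _ _ _ => rfl) (by simp)
  exact ⟨this.1, fun u v hv => this.2 u v v.2 hv⟩

theorem existsUnique_isF (hΩ : ComplementConnected Ω) (hT : (tilings Ω).Nonempty)
    (hv₀ : IsWhite0 v₀) (hv₀Ω : v₀ ∈ Ω) : ∃! F, IsF Ω v₀ F := by
  obtain ⟨T₀, hT₀⟩ := hT
  have hT₀ := mem_tilings.1 hT₀
  have hM := (det_ne_zero hΩ hT₀).1
  have hb : ¬ IsBlack v₀ := (face_types v₀).2.2.1.2 (Or.inl hv₀)
  have uniq : ∀ F F', IsComplexF Ω v₀ F → IsComplexF Ω v₀ F' → F = F' := by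
    intro F F' hF hF'
    ext1 s
    by_cases hs : s ∈ Ω
    · rw [hF.eq_inv hT₀.isPairing hM (v₀ := ⟨v₀, hv₀Ω⟩) hb ⟨s, hs⟩,
        hF'.eq_inv hT₀.isPairing hM (v₀ := ⟨v₀, hv₀Ω⟩) hb ⟨s, hs⟩]
    · rw [hF.1 s fun h => hs h.1, hF'.1 s fun h => hs h.1]
  obtain ⟨F, hF⟩ := exists_isComplexF hT₀.isPairing hM (v₀ := ⟨v₀, hv₀Ω⟩) hb
  exact ⟨F, hF.isF hv₀ hv₀Ω (uniq _ _ (hF.reflect hv₀) hF), fun F' hF' =>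
    uniq _ _ hF'.isComplexF hF⟩

theorem existsUnique_isG (hΩ : ComplementConnected Ω) (hT : (tilings Ω).Nonempty)
    (hu₀ : IsBlack0 u₀) (hu₀Ω : u₀ ∈ Ω) : ∃! G, IsG Ω u₀ G := by
  obtain ⟨T₀, hT₀⟩ := hT
  have hT₀ := mem_tilings.1 hT₀
  have hM := (det_ne_zero hΩ hT₀).1
  have hb : IsBlack u₀ := (face_types u₀).1.2 (Or.inl hu₀)
  have uniq : ∀ G G', IsComplexG Ω u₀ G → IsComplexG Ω u₀ G' → G = G' := by
    intro G G' hG hG'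
    ext1 s
    by_cases hs : s ∈ Ω
    · rw [hG.eq_inv hM (u₀ := ⟨u₀, hu₀Ω⟩) hb ⟨s, hs⟩,
        hG'.eq_inv hM (u₀ := ⟨u₀, hu₀Ω⟩) hb ⟨s, hs⟩]
    · rw [hG.1 s fun h => hs h.1, hG'.1 s fun h => hs h.1]
  obtain ⟨G, hG⟩ := exists_isComplexG hT₀.isPairing hM (u₀ := ⟨u₀, hu₀Ω⟩) hb
  exact ⟨G, hG.isG hu₀ hu₀Ω (uniq _ _ (hG.reflect hu₀) hG), fun G' hG' =>
    uniq _ _ hG'.isComplexG hG⟩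

open Classical in
-- Replacing row `v₀` by the unit vector at `u₀` forces the pair `(u₀, v₀)`, so the surviving
-- pairings are the tilings of Ω' together with this pair. Both domains thus live in one index set,
-- and their inverses can be compared.
theorem kasteleyn_sdiff (hΩ' : ComplementConnected (Ω \ {u₀, v₀}))
    (hT' : (tilings (Ω \ {u₀, v₀})).Nonempty) {T₀ : Finset (Face × Face)}
    (h0 : IsPairing Ω T₀) (hu₀ : IsBlack u₀) (hv₀ : ¬ IsBlack v₀) (hu₀Ω : u₀ ∈ Ω) (hv₀Ω : v₀ ∈ Ω) :
    ((pairMatrix Ω T₀ dbarCoeff).updateRow ⟨v₀, hv₀Ω⟩ (Pi.single ⟨u₀, hu₀Ω⟩ 1)).det ≠ 0 ∧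
    ∀ u v : Ω, (v : Face) ≠ v₀ → ¬ IsBlack v →
      (dominoCount (Ω \ {u₀, v₀}) u v : ℂ) / (tilings (Ω \ {u₀, v₀})).card = dbarCoeff v u *
        ((pairMatrix Ω T₀ dbarCoeff).updateRow ⟨v₀, hv₀Ω⟩ (Pi.single ⟨u₀, hu₀Ω⟩ 1))⁻¹ u v := by
  rw [pairMatrix_updateRow dbarCoeff ⟨u₀, hu₀Ω⟩ ⟨v₀, hv₀Ω⟩ hv₀ 1]
  have key := kasteleyn (P := {(u₀, v₀)})
    (d := fun s t => if s = v₀ then (if t = u₀ then 1 else 0) else dbarCoeff s t) h0 hΩ' hT'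
    (fun T hT => by
      have hTp := hT.isPairing
      have hmem : ∀ p ∈ T, p.1 ≠ u₀ ∧ p.1 ≠ v₀ ∧ p.2 ≠ u₀ ∧ p.2 ≠ v₀ ∧ p.1 ∈ Ω ∧ p.2 ∈ Ω := by
        intro p hp
        have := hT.1 p hp
        simp only [Finset.mem_sdiff, Finset.mem_insert, Finset.mem_singleton] at this
        tauto
      refine ⟨isPairing_of ?_ ?_ ?_ ?_ ?_, ?_⟩
      · intro p hp
        rcases Finset.mem_union.1 hp with hp | hp
        · exact ⟨(hmem p hp).2.2.2.2.1, (hmem p hp).2.2.2.2.2, (hTp.1 p hp).2.2⟩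
        · rw [Finset.mem_singleton.1 hp]
          exact ⟨hu₀Ω, hv₀Ω, hu₀, (isWhite_iff_not_isBlack _).2 hv₀⟩
      · intro u hu hub
        by_cases h : u = u₀
        · exact ⟨v₀, by simp [h]⟩
        · obtain ⟨v, hv⟩ := hTp.exists_white (u := u) (by
            simp only [Finset.mem_sdiff, Finset.mem_insert, Finset.mem_singleton]
            exact ⟨hu, by rintro (rfl | rfl); exacts [h rfl, hv₀ hub]⟩) hub
          exact ⟨v, Finset.mem_union_left _ hv⟩
      · intro v hv hvw
        by_cases h : v = v₀
        · exact ⟨u₀, by simp [h]⟩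
        · obtain ⟨u, hu⟩ := hTp.exists_black (v := v) (by
            simp only [Finset.mem_sdiff, Finset.mem_insert, Finset.mem_singleton]
            refine ⟨hv, ?_⟩
            rintro (rfl | rfl)
            exacts [(isWhite_iff_not_isBlack _).1 hvw hu₀, h rfl]) hvw
          exact ⟨u, Finset.mem_union_left _ hu⟩
      · intro u v v' h1 h2
        simp only [Finset.mem_union, Finset.mem_singleton, Prod.mk.injEq] at h1 h2
        rcases h1 with h1 | h1 <;> rcases h2 with h2 | h2
        · exact hTp.white_unique h1 h2
        · exact absurd h2.1 (hmem _ h1).1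
        · exact absurd h1.1 (hmem _ h2).1
        · rw [h1.2, h2.2]
      · intro u u' v h1 h2
        simp only [Finset.mem_union, Finset.mem_singleton, Prod.mk.injEq] at h1 h2
        rcases h1 with h1 | h1 <;> rcases h2 with h2 | h2
        · exact hTp.black_unique h1 h2
        · exact absurd h2.2 (hmem _ h1).2.2.2.1
        · exact absurd h1.2 (hmem _ h2).2.2.2.1
        · rw [h1.1, h2.1]
      · rw [Finset.disjoint_singleton_right]
        exact fun h => (hmem _ h).1 rfl)
    (fun T hT hprod => by
      rw [Finset.prod_ne_zero_iff] at hprod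
      obtain ⟨u, hu⟩ := hT.exists_black hv₀Ω ((isWhite_iff_not_isBlack _).2 hv₀)
      have h1 := hprod _ hu
      simp only [if_true, ne_eq, ite_eq_right_iff, one_ne_zero, imp_false, not_not] at h1
      subst h1
      refine ⟨by simpa using hu, isTiling_iff.2 ⟨isPairing_of ?_ ?_ ?_ ?_ ?_, ?_⟩⟩
      · rintro ⟨a, b⟩ hp
        simp only [Finset.mem_sdiff, Finset.mem_singleton, Prod.mk.injEq] at hp
        have h2 := hT.1 _ hp.1
        have h3 := (isWhite_iff_not_isBlack _).1 h2.2.2.2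
        have h4 : a ≠ u := by
          rintro rfl
          exact hp.2 ⟨rfl, hT.white_unique hp.1 hu⟩
        have h5 : b ≠ v₀ := by
          rintro rfl
          exact hp.2 ⟨hT.black_unique hp.1 hu, rfl⟩
        have h6 : a ≠ v₀ := by
          rintro rfl
          exact hv₀ h2.2.2.1
        have h7 : b ≠ u := by
          rintro rfl
          exact h3 hu₀
        simp only [Finset.mem_sdiff, Finset.mem_insert, Finset.mem_singleton]
        exact ⟨⟨h2.1, by tauto⟩, ⟨h2.2.1, by tauto⟩, h2.2.2⟩
      · intro a ha hab
        simp only [Finset.mem_sdiff, Finset.mem_insert, Finset.mem_singleton, not_or] at ha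
        obtain ⟨b, hb⟩ := hT.exists_white ha.1 hab
        refine ⟨b, Finset.mem_sdiff.2 ⟨hb, ?_⟩⟩
        simp [ha.2.1]
      · intro b hb hbw
        simp only [Finset.mem_sdiff, Finset.mem_insert, Finset.mem_singleton, not_or] at hb
        obtain ⟨a, ha⟩ := hT.exists_black hb.1 hbw
        refine ⟨a, Finset.mem_sdiff.2 ⟨ha, ?_⟩⟩
        simp [hb.2.2]
      · intro a b b' h1 h2
        exact hT.white_unique (Finset.mem_sdiff.1 h1).1 (Finset.mem_sdiff.1 h2).1
      · intro a a' b h1 h2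
        exact hT.black_unique (Finset.mem_sdiff.1 h1).1 (Finset.mem_sdiff.1 h2).1
      · rintro ⟨a, b⟩ hp
        simp only [Finset.mem_sdiff, Finset.mem_singleton, Prod.mk.injEq] at hp
        have h5 : b ≠ v₀ := by
          rintro rfl
          exact hp.2 ⟨hT.black_unique hp.1 hu, rfl⟩
        have h6 := hprod _ hp.1
        simp only [h5, if_false] at h6
        exact mem_nbrs_comm.1 (dbarCoeff_ne_zero_iff.1 h6))
    (fun s t hs _ => if_neg fun h => by simp [h] at hs)
    (by simp)
  refine ⟨key.1, fun u v hv hvb => ?_⟩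
  rw [key.2 u v ?_ hvb, if_neg hv]
  simp only [Finset.mem_sdiff, Finset.mem_insert, Finset.mem_singleton, not_or]
  exact ⟨v.2, fun h => hvb (h ▸ hu₀), hv⟩

theorem IsPairing.dominoCount_eq_zero {D : Finset Face} {u v : Face} (h : u ∉ D ∨ v ∉ D) :
    dominoCount D u v = 0 := by
  classical
  rw [dominoCount, Finset.card_eq_zero, Finset.filter_eq_empty_iff]
  intro T hT hm
  have := (mem_tilings.1 hT).1 _ hm
  simp only at this
  tauto

/-- The values of `F` and `G` at the poles, and the difference of the domino probabilities. -/
theorem green (hΩ : ComplementConnected Ω) (hΩ' : ComplementConnected (Ω \ {u₀, v₀}))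
    (hT : (tilings Ω).Nonempty) (hT' : (tilings (Ω \ {u₀, v₀})).Nonempty)
    (hu₀ : IsBlack0 u₀) (hv₀ : IsWhite0 v₀) (hu₀Ω : u₀ ∈ Ω) (hv₀Ω : v₀ ∈ Ω) {F G : Face → ℂ}
    (hF : IsF Ω v₀ F) (hG : IsG Ω u₀ G) :
    4 * Complex.I * G v₀ * dbar F v₀ ≠ 0 ∧
    4 * Complex.I * G v₀ * dbar F v₀ = -4 * Complex.I * F u₀ * dbar G u₀ ∧
    ∀ u v, IsBlack u → ¬ IsBlack v → 4 * Complex.I * dbarCoeff v u * F u * G v =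
      (4 * Complex.I * G v₀ * dbar F v₀) * ((dominoCount Ω u v : ℂ) / (tilings Ω).card -
        (dominoCount (Ω \ {u₀, v₀}) u v : ℂ) / (tilings (Ω \ {u₀, v₀})).card) := by
  obtain ⟨T₀, hT₀⟩ := hT
  have hT₀ := mem_tilings.1 hT₀
  have h0 := hT₀.isPairing
  have hub : IsBlack u₀ := (face_types u₀).1.2 (Or.inl hu₀)
  have hvb : ¬ IsBlack v₀ := (face_types v₀).2.2.1.2 (Or.inl hv₀)
  obtain ⟨hM, hprob⟩ := det_ne_zero hΩ hT₀
  obtain ⟨hM', hprob'⟩ := kasteleyn_sdiff hΩ' hT' h0 hub hvb hu₀Ω hv₀Ω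
  have eF := hF.isComplexF.eq_inv h0 hM (v₀ := ⟨v₀, hv₀Ω⟩) hvb
  have eG := hG.isComplexG.eq_inv hM (u₀ := ⟨u₀, hu₀Ω⟩) hub
  set M := pairMatrix Ω T₀ dbarCoeff with hMdef
  -- By Cramer's rule this entry is the determinant of the updated matrix divided by that of `M`;
  -- the former is nonzero because Ω' has a tiling.
  have hX : M⁻¹ ⟨u₀, hu₀Ω⟩ ⟨v₀, hv₀Ω⟩ ≠ 0 := by
    rw [Matrix.inv_def, Matrix.smul_apply, Ring.inverse_eq_inv', Matrix.adjugate_apply, smul_eq_mul]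
    exact mul_ne_zero (inv_ne_zero hM) (by convert hM')
  have eF0 := eF ⟨u₀, hu₀Ω⟩
  have eG0 := eG ⟨v₀, hv₀Ω⟩
  simp only at eF0 eG0
  set X := M⁻¹ ⟨u₀, hu₀Ω⟩ ⟨v₀, hv₀Ω⟩ with hXdef
  have hJ : 4 * Complex.I * G v₀ * dbar F v₀ = 4 * lam * X := by
    rw [hF.pole, eG0]
    linear_combination -4 * lam * X * Complex.I_mul_I
  refine ⟨?_, ?_, fun u v hu hv => ?_⟩
  · rw [hJ]
    exact mul_ne_zero (mul_ne_zero (by norm_num) lam_ne_zero) hX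
  · rw [hJ, hG.pole, eF0]
    linear_combination 4 * lam * X * Complex.I_mul_I
  by_cases huΩ : u ∈ Ω
  swap
  · rw [hF.zero u fun h => huΩ h.1, IsPairing.dominoCount_eq_zero (Or.inl huΩ),
      IsPairing.dominoCount_eq_zero (Or.inl fun h => huΩ (Finset.mem_sdiff.1 h).1)]
    simp
  by_cases hvΩ : v ∈ Ω
  swap
  · rw [hG.zero v fun h => hvΩ h.1, IsPairing.dominoCount_eq_zero (Or.inr hvΩ),
      IsPairing.dominoCount_eq_zero (Or.inr fun h => hvΩ (Finset.mem_sdiff.1 h).1)]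
    simp
  have eFu := eF ⟨u, huΩ⟩
  have eGv := eG ⟨v, hvΩ⟩
  have p1 := hprob ⟨u, huΩ⟩ ⟨v, hvΩ⟩ hv
  simp only at eFu eGv p1
  rw [hJ, p1, eFu, eGv]
  -- The update formula does not cover column `v₀`; there the probability in Ω' is 0, because `v₀`
  -- was removed.
  by_cases hvv : v = v₀
  · subst hvv
    rw [IsPairing.dominoCount_eq_zero (Or.inr (by simp)), ← hXdef]
    simp only [Nat.cast_zero, zero_div, sub_zero]
    linear_combination -4 * lam * X * M⁻¹ ⟨u, huΩ⟩ ⟨v, hvΩ⟩ * dbarCoeff v u * Complex.I_mul_I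
  · have p2 := hprob' ⟨u, huΩ⟩ ⟨v, hvΩ⟩ hvv hv
    simp only at p2
    have p3 := inv_updateRow_single hM hX hM' (j := ⟨v, hvΩ⟩)
      (fun h => hvv (congrArg Subtype.val h)) ⟨u, huΩ⟩
    rw [p2, p3, ← hXdef]
    field_simp
    linear_combination -(dbarCoeff v u * lam * M⁻¹ ⟨u, huΩ⟩ ⟨v₀, hv₀Ω⟩ *
      M⁻¹ ⟨u₀, hu₀Ω⟩ ⟨v, hvΩ⟩) * Complex.I_mul_I

end Green


/-! ### Expected increments of the height functions -/

/-- The expected increment of the height function of a uniform tiling along a directed edge. -/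
noncomputable def expStep (D : Finset Face) (z w : Vertex) : ℝ :=
  (∑ T ∈ tilings D, heightStep T z w) / (tilings D).card

section expStep

variable {D : Finset Face}

theorem expStep_of_isBlack (hD : (tilings D).Nonempty) {z w : Vertex}
    (h : IsBlack (leftFace z w)) : expStep D z w =
      1 / 4 - (dominoCount D (leftFace z w) (rightFace z w) : ℝ) / (tilings D).card := by
  have hc : ((tilings D).card : ℝ) ≠ 0 := Nat.cast_ne_zero.2 (Finset.card_ne_zero.2 hD)
  rw [expStep, Finset.sum_congr rfl fun T _ => heightStep_of_isBlack h, Finset.sum_sub_distrib,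
    Finset.sum_const, nsmul_eq_mul, Finset.sum_boole, dominoCount]
  field_simp

theorem expStep_of_not_isBlack (hD : (tilings D).Nonempty) {z w : Vertex}
    (h : ¬ IsBlack (leftFace z w)) : expStep D z w =
      (dominoCount D (rightFace z w) (leftFace z w) : ℝ) / (tilings D).card - 1 / 4 := by
  have hc : ((tilings D).card : ℝ) ≠ 0 := Nat.cast_ne_zero.2 (Finset.card_ne_zero.2 hD)
  rw [expStep, Finset.sum_congr rfl fun T _ => heightStep_of_not_isBlack h, Finset.sum_sub_distrib,
    Finset.sum_const, nsmul_eq_mul, Finset.sum_boole, dominoCount]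
  field_simp

theorem expStep_swap (D : Finset Face) {z w : Vertex} (h : IsLatticeEdge z w) :
    expStep D w z = -expStep D z w := by
  rw [expStep, expStep, Finset.sum_congr rfl fun T _ => heightStep_swap T h,
    Finset.sum_neg_distrib, neg_div]

theorem circ_expStep {s : Face} (hs : s ∈ D) : circ (expStep D) s = 0 := by
  have h : ∑ T ∈ tilings D, circ (heightStep T) s = 0 :=
    Finset.sum_eq_zero fun T hT => (mem_tilings.1 hT).circ_eq_zero hs
  simp only [circ, Finset.sum_add_distrib] at h
  simp only [circ, expStep]
  rw [← add_div, ← add_div, ← add_div, h, zero_div]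

/-- No domino covers the face, so all four sides contribute a quarter with the same sign. This is
the source of the jump at the poles. -/
theorem circ_expStep_of_notMem (hD : (tilings D).Nonempty) {s : Face} (hs : s ∉ D) :
    (IsBlack s → circ (expStep D) s = 1) ∧ (¬ IsBlack s → circ (expStep D) s = -1) := by
  obtain ⟨⟨h1, -⟩, ⟨h2, -⟩, ⟨h3, -⟩, h4, -⟩ := sides s
  constructor <;> intro hb
  · have h : ∀ z w, leftFace z w = s → expStep D z w = 1 / 4 := by
      intro z w h
      rw [expStep_of_isBlack hD (h ▸ hb), IsPairing.dominoCount_eq_zero (Or.inl (h ▸ hs))]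
      simp
    rw [circ, h _ _ h1, h _ _ h2, h _ _ h3, h _ _ h4]
    norm_num
  · have h : ∀ z w, leftFace z w = s → expStep D z w = -(1 / 4) := by
      intro z w h
      rw [expStep_of_not_isBlack hD (h ▸ hb), IsPairing.dominoCount_eq_zero (Or.inr (h ▸ hs))]
      simp
    rw [circ, h _ _ h1, h _ _ h2, h _ _ h3, h _ _ h4]
    norm_num

/-- A domino of neither set can cross an edge that borders the outside of the larger one. -/
theorem expStep_eq_of_outside {D' : Finset Face} (hD : (tilings D).Nonempty)
    (hD' : (tilings D').Nonempty) (hsub : D' ⊆ D) {z w : Vertex} (h : rightFace z w ∉ D) :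
    expStep D z w = expStep D' z w := by
  have h' : rightFace z w ∉ D' := fun h1 => h (hsub h1)
  by_cases hb : IsBlack (leftFace z w)
  · rw [expStep_of_isBlack hD hb, expStep_of_isBlack hD' hb,
      IsPairing.dominoCount_eq_zero (Or.inr h), IsPairing.dominoCount_eq_zero (Or.inr h')]
    simp
  · rw [expStep_of_not_isBlack hD hb, expStep_of_not_isBlack hD' hb,
      IsPairing.dominoCount_eq_zero (Or.inl h), IsPairing.dominoCount_eq_zero (Or.inl h')]
    simp

end expStep

theorem walkSum_sum {ι : Type*} {Γ : SimpleGraph Vertex} (S : Finset ι)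
    (f : ι → Vertex → Vertex → ℝ) {z w : Vertex} (γ : Γ.Walk z w) :
    walkSum (fun a b => ∑ i ∈ S, f i a b) γ = ∑ i ∈ S, walkSum (f i) γ := by
  induction γ with
  | nil => simp
  | cons h γ ih => simp [ih, Finset.sum_add_distrib]

theorem walkSum_sub_div {Γ : SimpleGraph Vertex} (f g : Vertex → Vertex → ℝ) (x y : ℝ)
    {z w : Vertex} (γ : Γ.Walk z w) :
    walkSum (fun a b => f a b / x - g a b / y) γ = walkSum f γ / x - walkSum g γ / y := by
  induction γ with
  | nil => simp
  | cons h γ ih =>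
    simp only [walkSum_cons, ih]
    ring

theorem walkSum_mapLe {Γ Γ' : SimpleGraph Vertex} (h : Γ ≤ Γ') (f : Vertex → Vertex → ℝ)
    {z w : Vertex} (γ : Γ.Walk z w) : walkSum f (γ.mapLe h) = walkSum f γ := by
  induction γ with
  | nil => simp [SimpleGraph.Walk.mapLe]
  | cons h γ ih => simpa [SimpleGraph.Walk.mapLe] using ih

/-- A walk in the smaller set is also a walk in the larger one, so both heights can be computed
along it and averaged term by term. -/
theorem expectedHeight_eq_walkSum {D D' : Finset Face} (hsub : D' ⊆ D)
    (hD : (tilings D).Nonempty) (hD' : (tilings D').Nonempty) (hw : HeightWellDefined D)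
    (hw' : HeightWellDefined D') {z₀ z : Vertex} (γ : (edgeGraph D').Walk z₀ z) :
    expectedHeight D D' z₀ z = walkSum (fun a b => expStep D a b - expStep D' a b) γ := by
  have hle : edgeGraph D' ≤ edgeGraph D := fun a b h => ⟨h.1, h.2.imp (@hsub _) (@hsub _)⟩
  have hc : ((tilings D).card : ℝ) ≠ 0 := Nat.cast_ne_zero.2 (Finset.card_ne_zero.2 hD)
  have hc' : ((tilings D').card : ℝ) ≠ 0 := Nat.cast_ne_zero.2 (Finset.card_ne_zero.2 hD')
  simp only [expStep]
  rw [walkSum_sub_div, walkSum_sum, walkSum_sum, expectedHeight]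
  have h1 : ∀ T ∈ tilings D, height D T z₀ z = walkSum (heightStep T) γ := fun T hT => by
    rw [hw.height_eq (mem_tilings.1 hT) (γ.mapLe hle), walkSum_mapLe]
  have h2 : ∀ T ∈ tilings D', height D' T z₀ z = walkSum (heightStep T) γ := fun T hT =>
    hw'.height_eq (mem_tilings.1 hT) γ
  have h3 : ∑ T₁ ∈ tilings D, ∑ T₂ ∈ tilings D', (height D T₁ z₀ z - height D' T₂ z₀ z) =
      (tilings D').card * ∑ T ∈ tilings D, walkSum (heightStep T) γ -
        (tilings D).card * ∑ T ∈ tilings D', walkSum (heightStep T) γ := by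
    simp only [Finset.sum_sub_distrib, Finset.sum_const, nsmul_eq_mul]
    rw [Finset.sum_congr rfl h2, ← Finset.mul_sum, Finset.sum_congr rfl h1]
  rw [h3]
  field_simp

/-- The coefficient is a quarter of the vector from the centre of the right face to that of the left
one, which is the edge vector turned by a right angle. -/
theorem pos_sub_pos {z w : Vertex} (h : IsLatticeEdge z w) :
    pos w - pos z = -4 * Complex.I * dbarCoeff (rightFace z w) (leftFace z w) := by
  have k1 : ∀ z : Vertex, pos (z + (1, 0)) - pos z = lamBar := fun z => by
    simp only [pos, Prod.fst_add, Prod.snd_add]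
    push_cast
    ring
  have k2 : ∀ z : Vertex, pos (z + (0, 1)) - pos z = lam := fun z => by
    simp only [pos, Prod.fst_add, Prod.snd_add]
    push_cast
    ring
  rcases h.cases with ⟨rfl, h1, h2⟩ | ⟨rfl, h1, h2⟩ | ⟨rfl, h1, h2⟩ | ⟨rfl, h1, h2⟩ <;> rw [h1, h2]
  · have := dbarCoeff_add_snd (z - (0, 1))
    rw [sub_add_cancel] at this
    rw [this, k1]
    linear_combination I_mul_lam
  · rw [dbarCoeff_sub_fst, k2]
    linear_combination -I_mul_lamBar
  · rw [dbarCoeff_sub_snd]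
    linear_combination -k1 w - I_mul_lam
  · have := dbarCoeff_add_fst (w - (1, 0))
    rw [sub_add_cancel] at this
    rw [this]
    linear_combination -k2 w + I_mul_lamBar

/-! ### Unit flows, boundary arcs and the mean double-dimer height on Ω. -/

section Loop

variable {Ω : Finset Face} {n : ℕ} {c : ZMod n → Vertex}

/-- The unit flow through one directed edge. -/
def edgeFlow (p q z w : Vertex) : ℝ :=
  (if z = p ∧ w = q then 1 else 0) - (if z = q ∧ w = p then 1 else 0)

theorem edgeFlow_swap (p q z w : Vertex) : edgeFlow p q w z = -edgeFlow p q z w := by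
  simp only [edgeFlow, and_comm, neg_sub]

theorem circ_indicator {p q : Vertex} (h : IsLatticeEdge p q) (s : Face) :
    circ (fun z w => if z = p ∧ w = q then (1 : ℝ) else 0) s =
      if leftFace p q = s then 1 else 0 := by
  obtain ⟨p1, p2⟩ := p
  obtain ⟨q1, q2⟩ := q
  obtain ⟨x, y⟩ := s
  rcases h.cases with ⟨h, h1, h2⟩ | ⟨h, h1, h2⟩ | ⟨h, h1, h2⟩ | ⟨h, h1, h2⟩ <;> rw [h1] <;>
    clear h1 h2 <;>
    simp only [Prod.mk_add_mk, Prod.mk.injEq] at h <;> obtain ⟨rfl, rfl⟩ := h <;>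
    simp only [circ, Prod.mk_add_mk, Prod.mk_sub_mk, Prod.mk.injEq, add_zero, sub_zero] <;>
    split_ifs <;> first | omega | norm_num

theorem circ_edgeFlow {p q : Vertex} (h : IsLatticeEdge p q) (s : Face) :
    circ (edgeFlow p q) s =
      (if leftFace p q = s then 1 else 0) - (if rightFace p q = s then 1 else 0) := by
  rw [← leftFace_swap, ← circ_indicator h, ← circ_indicator h.symm]
  simp only [circ, edgeFlow]
  ring

theorem IsBoundaryLoop.edgeFlow_eq_zero (hc : IsBoundaryLoop Ω c) {i j : ZMod n} (hij : i ≠ j) :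
    edgeFlow (c j) (c (j + 1)) (c i) (c (i + 1)) = 0 := by
  rw [edgeFlow, if_neg fun h => hij (hc.injective h.1), if_neg, sub_zero]
  rintro ⟨h1, h2⟩
  have h3 := (hc.edge i).2.1
  rw [h1, h2, leftFace_swap] at h3
  exact (hc.edge j).2.2 h3

/-- The vertices with an index in the arc that starts after the edge number `b` and ends before the
edge number `a`. -/
def InArc (a b i : ZMod n) : Prop := ∃ k : ℕ, 1 ≤ k ∧ k ≤ (a - b).val ∧ i = b + k

theorem mem_boundaryArc {a b : ZMod n} {z : Vertex} :
    z ∈ boundaryArc c b a ↔ ∃ i, InArc a b i ∧ z = c i := by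
  constructor
  · rintro ⟨k, h1, h2, rfl⟩
    exact ⟨_, ⟨k, h1, h2, rfl⟩, rfl⟩
  · rintro ⟨_, ⟨k, h1, h2, rfl⟩, rfl⟩
    exact ⟨k, h1, h2, rfl⟩

section InArc

variable {a b i : ZMod n}

theorem inArc_start (hab : a ≠ b) : InArc a b (b + 1) :=
  ⟨1, le_rfl, Nat.one_le_iff_ne_zero.2 fun h => hab (sub_eq_zero.1 ((ZMod.val_eq_zero _).1 h)),
    by simp⟩

theorem inArc_end [NeZero n] (hab : a ≠ b) : InArc a b a :=
  ⟨(a - b).val, Nat.one_le_iff_ne_zero.2 fun h => hab (sub_eq_zero.1 ((ZMod.val_eq_zero _).1 h)),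
    le_rfl, by simp⟩

theorem InArc.succ [NeZero n] (h : InArc a b i) (hi : i ≠ a) : InArc a b (i + 1) := by
  obtain ⟨k, h1, h2, rfl⟩ := h
  refine ⟨k + 1, by omega, Nat.lt_of_le_of_ne h2 ?_, by push_cast; ring⟩
  rintro rfl
  simp at hi

theorem InArc.pred (h : InArc a b (i + 1)) (hi : i ≠ b) : InArc a b i := by
  obtain ⟨k, h1, h2, h3⟩ := h
  obtain ⟨k, rfl⟩ : ∃ m, k = m + 1 := ⟨k - 1, by omega⟩
  have h4 : i = b + k := by
    push_cast at h3
    rw [← add_assoc] at h3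
    exact add_right_cancel h3
  refine ⟨k, Nat.one_le_iff_ne_zero.2 ?_, by omega, h4⟩
  rintro rfl
  simp at h4
  exact hi h4

theorem InArc.ne [NeZero n] (h : InArc a b i) : i ≠ b := by
  obtain ⟨k, h1, h2, rfl⟩ := h
  intro h
  have h3 : (k : ZMod n) = 0 := by simpa using h
  rw [ZMod.natCast_eq_zero_iff] at h3
  have := Nat.le_of_dvd h1 h3
  have := ZMod.val_lt (a - b)
  omega

/-- A function that does not change along the boundary edges other than `a` and `b` is constant on
each of the two arcs. -/
theorem eq_of_inArc [NeZero n] {β : Type*} {f : ZMod n → β} (hf : ∀ i, i ≠ a → i ≠ b → f (i + 1) = f i)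
    (h : InArc a b i) : f i = f (b + 1) := by
  obtain ⟨k, h1, h2, rfl⟩ := h
  induction k, h1 using Nat.le_induction with
  | base => simp
  | succ k h1 ih =>
    have h3 : InArc a b (b + k) := ⟨k, h1, by omega, rfl⟩
    rw [← ih (by omega), Nat.cast_succ, ← add_assoc]
    refine hf _ ?_ h3.ne
    intro h
    have h4 : (k : ZMod n) = a - b := by rw [← h]; ring
    have h5 := congrArg ZMod.val h4
    rw [ZMod.val_natCast, Nat.mod_eq_of_lt] at h5
    · omega
    · have := ZMod.val_lt (a - b)
      omega

end InArc

/-- The primitive of the expected increments of the double-dimer height function, with the jump of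
the height of `Ω'` at the poles concentrated on the boundary edges `a` and `b`. -/
theorem exists_meanHeight [NeZero n] (hc : IsBoundaryLoop Ω c) {u₀ v₀ : Face} {a b : ZMod n}
    (hu₀ : IsBlack u₀) (hv₀ : ¬ IsBlack v₀) (ha : leftFace (c a) (c (a + 1)) = u₀)
    (hb : leftFace (c b) (c (b + 1)) = v₀) (hΩ : ComplementConnected Ω)
    (hT : (tilings Ω).Nonempty) (hT' : (tilings (Ω \ {u₀, v₀})).Nonempty) :
    ∃ f : Vertex → ℝ,
      (∀ z w, (edgeGraph Ω).Adj z w → f w - f z = expStep Ω z w - expStep (Ω \ {u₀, v₀}) z w +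
        edgeFlow (c a) (c (a + 1)) z w - edgeFlow (c b) (c (b + 1)) z w) ∧
      (∀ z ∈ boundaryArc c b a, f z = 0) ∧ ∀ z ∈ boundaryArc c a b, f z = 1 := by
  have huv : u₀ ≠ v₀ := by rintro rfl; exact hv₀ hu₀
  have hab : a ≠ b := by rintro rfl; exact huv (ha.symm.trans hb)
  have hsub : Ω \ {u₀, v₀} ⊆ Ω := Finset.sdiff_subset
  set α : Vertex → Vertex → ℝ := fun z w => expStep Ω z w - expStep (Ω \ {u₀, v₀}) z w +
    edgeFlow (c a) (c (a + 1)) z w - edgeFlow (c b) (c (b + 1)) z w with hα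
  have hanti : ∀ z w, IsLatticeEdge z w → α w z = -α z w := fun z w h => by
    simp only [hα, expStep_swap _ h, edgeFlow_swap _ _ z w]
    ring
  -- At `u₀` the circulations are 0 - 1 + 1 and at `v₀` they are 0 + 1 - 1. The right faces of the
  -- two chosen edges lie outside Ω and do not matter.
  have hcirc : ∀ s ∈ Ω, circ α s = 0 := by
    intro s hs
    have e : circ α s = circ (expStep Ω) s - circ (expStep (Ω \ {u₀, v₀})) s +
        circ (edgeFlow (c a) (c (a + 1))) s - circ (edgeFlow (c b) (c (b + 1))) s := by
      simp only [circ, hα]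
      ring
    have hra : rightFace (c a) (c (a + 1)) ≠ s := by rintro rfl; exact (hc.edge a).2.2 hs
    have hrb : rightFace (c b) (c (b + 1)) ≠ s := by rintro rfl; exact (hc.edge b).2.2 hs
    rw [e, circ_expStep hs, circ_edgeFlow (hc.edge a).1, circ_edgeFlow (hc.edge b).1, ha, hb,
      if_neg hra, if_neg hrb]
    by_cases h1 : u₀ = s
    · subst h1
      rw [(circ_expStep_of_notMem hT' (by simp)).1 hu₀, if_pos rfl, if_neg huv.symm]
      norm_num
    by_cases h2 : v₀ = s
    · subst h2
      rw [(circ_expStep_of_notMem hT' (by simp)).2 hv₀, if_pos rfl, if_neg huv]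
      norm_num
    rw [circ_expStep (by simp [hs, Ne.symm h1, Ne.symm h2]), if_neg h1, if_neg h2]
    norm_num
  obtain ⟨f, hf⟩ := exists_potential (Γ := edgeGraph Ω) α (fun z w h => hanti z w h.1)
    fun z γ => walkSum_eq_zero_of_complementConnected hΩ (Γ := edgeGraph Ω) (fun _ _ h => h.1)
      (fun _ _ h => h.2) α hanti hcirc γ
  -- Along the boundary loop the mean steps of Ω and Ω' cancel, and only the two unit flows remain.
  have hstep : ∀ i, f (c (i + 1)) - f (c i) = edgeFlow (c a) (c (a + 1)) (c i) (c (i + 1)) -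
      edgeFlow (c b) (c (b + 1)) (c i) (c (i + 1)) := by
    intro i
    obtain ⟨h1, h2, h3⟩ := hc.edge i
    rw [hf _ _ ⟨h1, Or.inl h2⟩, hα]
    simp only [expStep_eq_of_outside hT hT' hsub h3]
    ring
  have hconst : ∀ i, i ≠ a → i ≠ b → f (c (i + 1)) = f (c i) := by
    intro i hia hib
    have := hstep i
    rw [hc.edgeFlow_eq_zero hia, hc.edgeFlow_eq_zero hib] at this
    linarith
  have hjump : f (c (a + 1)) - f (c a) = 1 := by
    rw [hstep a, hc.edgeFlow_eq_zero hab, edgeFlow, if_pos ⟨rfl, rfl⟩, if_neg]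
    · norm_num
    · exact fun h => (hc.edge a).1.ne h.1
  -- The arc from `b` ends at vertex `a`, just before the jump, so the value after the jump exceeds
  -- the value on this arc by 1.
  have hend := eq_of_inArc (f := fun i => f (c i)) hconst (inArc_end hab)
  refine ⟨fun z => f z - f (c (b + 1)), fun z w h => ?_, fun z hz => ?_,
    fun z hz => ?_⟩
  · have := hf z w h
    simp only [hα] at this
    rw [← this]
    ring
  · obtain ⟨i, hi, rfl⟩ := mem_boundaryArc.1 hz
    have := eq_of_inArc (f := fun i => f (c i)) hconst hi
    linarith
  · obtain ⟨i, hi, rfl⟩ := mem_boundaryArc.1 hz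
    have := eq_of_inArc (f := fun i => f (c i)) (fun i h1 h2 => hconst i h2 h1) hi
    linarith

end Loop


/-! ### Connectedness of the slit graph -/

section Slit

variable {Ω : Finset Face} {n : ℕ} {c : ZMod n → Vertex} {u₀ v₀ : Face}

theorem slitGraph_adj_of_interior {z w : Vertex} (h : IsLatticeEdge z w) (hl : leftFace z w ∈ Ω)
    (hr : rightFace z w ∈ Ω) : (slitGraph Ω u₀ v₀).Adj z w :=
  ⟨⟨h, Or.inl hl⟩, by rintro (h' | h') <;> tauto, by rintro (h' | h') <;> tauto⟩

theorem slitGraph_adj_of_left_ne {z w : Vertex} (h : IsLatticeEdge z w) (hl : leftFace z w ∈ Ω)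
    (h1 : leftFace z w ≠ u₀) (h2 : leftFace z w ≠ v₀) : (slitGraph Ω u₀ v₀).Adj z w :=
  ⟨⟨h, Or.inl hl⟩, by rintro (h' | h') <;> tauto, by rintro (h' | h') <;> tauto⟩

theorem exists_isAround_of_mem_vertexSet {z : Vertex} (hz : z ∈ vertexSet Ω) :
    ∃ s ∈ Ω, IsAround z s := by
  obtain ⟨s, hs, h⟩ := hz
  refine ⟨s, hs, ?_⟩
  rcases h with rfl | rfl | rfl | rfl <;> simp [IsAround]

theorem mem_vertexSet_of_isAround {z : Vertex} {s : Face} (hs : s ∈ Ω) (h : IsAround z s) :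
    z ∈ vertexSet Ω := by
  refine ⟨s, hs, ?_⟩
  rcases h with rfl | rfl | rfl | rfl <;> simp

/-- A vertex of `Ω` which is not on the boundary loop is surrounded by faces of `Ω`. -/
theorem IsBoundaryLoop.interior (hc : IsBoundaryLoop Ω c) {z : Vertex} (hz : z ∈ vertexSet Ω)
    (hn : ∀ i, c i ≠ z) : ∀ s, IsAround z s → s ∈ Ω := by
  have key : ∀ w, IsLatticeEdge z w → (leftFace z w ∈ Ω ↔ rightFace z w ∈ Ω) := by
    intro w hw
    constructor
    · intro h1
      by_contra h2
      obtain ⟨i, hi, -⟩ := hc.exhaust z w hw h1 h2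
      exact hn i hi
    · intro h1
      by_contra h2
      obtain ⟨i, -, hi⟩ := hc.exhaust w z hw.symm h1 h2
      exact hn _ hi
  have k1 := key (z + (1, 0)) (by simp [IsLatticeEdge])
  have k2 := key (z + (0, 1)) (by simp [IsLatticeEdge])
  have k3 := key (z - (1, 0)) (by simp [IsLatticeEdge])
  have l3 := leftFace_west (z - (1, 0))
  have r3 := leftFace_east (z - (1, 0))
  have e1 : z - (1, 0) - (0, 1) = z - (1, 1) := by simp [sub_sub]
  rw [sub_add_cancel] at l3 r3
  rw [e1] at l3
  rw [leftFace_east, ← leftFace_swap, leftFace_west] at k1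
  rw [leftFace_north, ← leftFace_swap, leftFace_south] at k2
  rw [l3, ← leftFace_swap, r3] at k3
  obtain ⟨s, hs, hzs⟩ := exists_isAround_of_mem_vertexSet hz
  intro t ht
  rcases hzs with rfl | rfl | rfl | rfl <;> rcases ht with rfl | rfl | rfl | rfl <;> tauto

/-- A function that is constant along the edges of the slit graph vanishes if it vanishes on the
boundary loop. -/
theorem eq_zero_of_boundary (hc : IsBoundaryLoop Ω c) {f : Vertex → ℝ}
    (hf : ∀ z w, (slitGraph Ω u₀ v₀).Adj z w → f z = f w) (h0 : ∀ i, f (c i) = 0) :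
    ∀ z ∈ vertexSet Ω, f z = 0 := by
  obtain ⟨M, hM⟩ : ∃ M : ℤ, ∀ s ∈ Ω, s.1 < M := by
    obtain ⟨M, hM⟩ := (Ω.image Prod.fst).exists_le
    exact ⟨M + 1, fun s hs => Int.lt_add_one_iff.2 (hM _ (Finset.mem_image_of_mem _ hs))⟩
  -- From an interior vertex one walks to the right until the loop is met. All edges at an interior
  -- vertex have both faces in Ω, so they belong to the slit graph.
  have main : ∀ k : ℕ, ∀ z : Vertex, M - k ≤ z.1 → z ∈ vertexSet Ω → f z = 0 := by
    intro k
    induction k with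
    | zero =>
      intro z hz hzΩ
      by_cases h : ∃ i, c i = z
      · obtain ⟨i, rfl⟩ := h
        exact h0 i
      · push Not at h
        have := hM z (hc.interior hzΩ h z (Or.inl rfl))
        simp at hz
        omega
    | succ k ih =>
      intro z hz hzΩ
      by_cases h : ∃ i, c i = z
      · obtain ⟨i, rfl⟩ := h
        exact h0 i
      · push Not at h
        have hin := hc.interior hzΩ h
        have hE : IsLatticeEdge z (z + (1, 0)) := by simp [IsLatticeEdge]
        have ha := hE.isAround
        rw [hf _ _ (slitGraph_adj_of_interior hE (hin _ ha.2.2.1) (hin _ ha.1))]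
        refine ih _ ?_ (mem_vertexSet_of_isAround (hin _ ha.2.2.1) ha.2.2.2)
        simp only [Prod.fst_add]
        push_cast at hz
        omega
  exact fun z hz => main (M - z.1).toNat z (by omega) hz

/-- Propagation of zero around the corners of a face: `bₖ` says that the side from the corner number
`k` to the next one is on the boundary, `Zₖ` that the corner number `k` is on a given arc. -/
theorem corners_eq_zero {b0 b1 b2 b3 Z0 Z1 Z2 Z3 : Prop} {f0 f1 f2 f3 : ℝ}
    (e0 : ¬ b0 → f0 = f1) (e1 : ¬ b1 → f1 = f2) (e2 : ¬ b2 → f2 = f3) (e3 : ¬ b3 → f3 = f0)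
    (c0 : b3 → b0 → f0 = 0) (c1 : b0 → b1 → f1 = 0) (c2 : b1 → b2 → f2 = 0)
    (c3 : b2 → b3 → f3 = 0) (hall : ¬ (b0 ∧ b1 ∧ b2 ∧ b3)) (hs1 : ¬ (b0 ∧ ¬ b1 ∧ b2 ∧ ¬ b3))
    (hs2 : ¬ (¬ b0 ∧ b1 ∧ ¬ b2 ∧ b3)) (z0 : Z0 → f0 = 0) (z1 : Z1 → f1 = 0) (z2 : Z2 → f2 = 0)
    (z3 : Z3 → f3 = 0) (p0 : b0 → Z1 → Z0) (p1 : b1 → Z2 → Z1) (p2 : b2 → Z3 → Z2)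
    (p3 : b3 → Z0 → Z3) (hZ : Z0 ∨ Z1 ∨ Z2 ∨ Z3) : f0 = 0 ∧ f1 = 0 ∧ f2 = 0 ∧ f3 = 0 := by
  by_cases b0 <;> by_cases b1 <;> by_cases b2 <;> by_cases b3 <;> grind

/-- The corners of the face `s` vanish under `f`. -/
theorem corners_face_eq_zero (hc : IsBoundaryLoop Ω c) {s : Face} (hs : s ∈ Ω)
    (hstrait : ¬ IsStrait Ω s) (hnb : ∃ t ∈ nbrs s, t ∈ Ω) {f : Vertex → ℝ}
    (hf : ∀ z w, (slitGraph Ω u₀ v₀).Adj z w → f z = f w)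
    (hcorner : ∀ z, IsAround z s → (∀ t, IsAround z t → t ≠ s → t ∉ Ω) → f z = 0)
    {Z : Vertex → Prop} (hZ : ∀ z, Z z → f z = 0) (hex : ∃ z, IsAround z s ∧ Z z)
    (hprop : (∀ i, leftFace (c i) (c (i + 1)) = s → Z (c (i + 1)) → Z (c i)) ∨
      (∀ i, leftFace (c i) (c (i + 1)) = s → Z (c i) → Z (c (i + 1)))) :
    ∀ z, IsAround z s → f z = 0 := by
  obtain ⟨⟨l0, r0⟩, ⟨l1, r1⟩, ⟨l2, r2⟩, l3, r3⟩ := sides s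
  have g0 : IsLatticeEdge s (s + (1, 0)) := by simp [IsLatticeEdge]
  have g1 : IsLatticeEdge (s + (1, 0)) (s + (1, 1)) := by simp [IsLatticeEdge, Prod.ext_iff]
  have g2 : IsLatticeEdge (s + (1, 1)) (s + (0, 1)) := by simp [IsLatticeEdge, Prod.ext_iff]
  have g3 : IsLatticeEdge (s + (0, 1)) s := by simp [IsLatticeEdge]
  have hside : ∀ z w, IsLatticeEdge z w → leftFace z w = s → ¬ rightFace z w ∉ Ω → f z = f w :=
    fun z w h hl hr => hf z w (slitGraph_adj_of_interior h (hl ▸ hs) (not_not.1 hr))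
  have e0 := hside _ _ g0 l0
  have e1 := hside _ _ g1 l1
  have e2 := hside _ _ g2 l2
  have e3 := hside _ _ g3 l3
  rw [r0] at e0
  rw [r1] at e1
  rw [r2] at e2
  rw [r3] at e3
  -- A corner between two consecutive boundary sides belongs to no other face of Ω, since the
  -- diagonal face would pinch the domain; such corners are treated by `hcorner`.
  have c0 : s - (1, 0) ∉ Ω → s - (0, 1) ∉ Ω → f s = 0 := by
    intro h1 h2
    refine hcorner s (Or.inl rfl) fun t ht hts => ?_
    rcases ht with rfl | rfl | rfl | rfl
    · exact absurd rfl hts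
    · exact h1
    · exact fun h => (hc.not_pinched s).1 ⟨hs, h, h1, h2⟩
    · exact h2
  have c1 : s - (0, 1) ∉ Ω → s + (1, 0) ∉ Ω → f (s + (1, 0)) = 0 := by
    intro h1 h2
    have a1 : s + (1, 0) - (1, 1) = s - (0, 1) := by simp [Prod.ext_iff]
    refine hcorner _ (Or.inr (Or.inl (by simp))) fun t ht hts => ?_
    have hp := (hc.not_pinched (s + (1, 0))).2
    rw [a1, add_sub_cancel_right] at hp
    rcases ht with rfl | rfl | rfl | rfl
    · exact h2
    · exact absurd (by simp) hts
    · rwa [a1]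
    · exact fun h => hp ⟨h2, h1, hs, h⟩
  have c2 : s + (1, 0) ∉ Ω → s + (0, 1) ∉ Ω → f (s + (1, 1)) = 0 := by
    intro h1 h2
    have a1 : s + (1, 1) - (1, 0) = s + (0, 1) := by simp [Prod.ext_iff]
    have a2 : s + (1, 1) - (0, 1) = s + (1, 0) := by simp [Prod.ext_iff]
    refine hcorner _ (Or.inr (Or.inr (Or.inl (by simp)))) fun t ht hts => ?_
    have hp := (hc.not_pinched (s + (1, 1))).1
    rw [a1, a2, add_sub_cancel_right] at hp
    rcases ht with rfl | rfl | rfl | rfl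
    · exact fun h => hp ⟨h, hs, h2, h1⟩
    · rwa [a1]
    · exact absurd (by simp) hts
    · rwa [a2]
  have c3 : s + (0, 1) ∉ Ω → s - (1, 0) ∉ Ω → f (s + (0, 1)) = 0 := by
    intro h1 h2
    have a1 : s + (0, 1) - (1, 1) = s - (1, 0) := by simp [Prod.ext_iff]
    refine hcorner _ (Or.inr (Or.inr (Or.inr (by simp)))) fun t ht hts => ?_
    have hp := (hc.not_pinched (s + (0, 1))).2
    rw [a1, add_sub_cancel_right] at hp
    rcases ht with rfl | rfl | rfl | rfl
    · exact h1
    · exact fun h => hp ⟨h1, h2, h, hs⟩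
    · rwa [a1]
    · exact absurd (by simp) hts
  have hall : ¬ (s - (0, 1) ∉ Ω ∧ s + (1, 0) ∉ Ω ∧ s + (0, 1) ∉ Ω ∧ s - (1, 0) ∉ Ω) := by
    rintro ⟨h1, h2, h3, h4⟩
    obtain ⟨t, ht, htΩ⟩ := hnb
    rcases mem_nbrs.1 ht with rfl | rfl | rfl | rfl
    exacts [h2 htΩ, h4 htΩ, h3 htΩ, h1 htΩ]
  have hst := hstrait
  rw [IsStrait, not_or] at hst
  have hs1 : ¬ (s - (0, 1) ∉ Ω ∧ ¬ s + (1, 0) ∉ Ω ∧ s + (0, 1) ∉ Ω ∧ ¬ s - (1, 0) ∉ Ω) :=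
    fun ⟨h1, h2, h3, h4⟩ => hst.1 ⟨not_not.1 h2, not_not.1 h4, h3, h1⟩
  have hs2 : ¬ (¬ s - (0, 1) ∉ Ω ∧ s + (1, 0) ∉ Ω ∧ ¬ s + (0, 1) ∉ Ω ∧ s - (1, 0) ∉ Ω) :=
    fun ⟨h1, h2, h3, h4⟩ => hst.2 ⟨h2, h4, not_not.1 h3, not_not.1 h1⟩
  have hex' : Z s ∨ Z (s + (1, 0)) ∨ Z (s + (1, 1)) ∨ Z (s + (0, 1)) := by
    obtain ⟨z, hz, hZz⟩ := hex
    rcases hz with rfl | rfl | rfl | rfl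
    · exact Or.inl hZz
    · exact Or.inr (Or.inl (by simpa using hZz))
    · exact Or.inr (Or.inr (Or.inl (by simpa using hZz)))
    · exact Or.inr (Or.inr (Or.inr (by simpa using hZz)))
  have hfour : f s = 0 ∧ f (s + (1, 0)) = 0 ∧ f (s + (1, 1)) = 0 ∧ f (s + (0, 1)) = 0 := by
    rcases hprop with hprop | hprop
    · have p : ∀ z w, IsLatticeEdge z w → leftFace z w = s → rightFace z w ∉ Ω → Z w → Z z := by
        intro z w h hl hr hw
        obtain ⟨i, rfl, rfl⟩ := hc.exhaust z w h (hl ▸ hs) hr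
        exact hprop i hl hw
      have p0 := p _ _ g0 l0
      have p1 := p _ _ g1 l1
      have p2 := p _ _ g2 l2
      have p3 := p _ _ g3 l3
      rw [r0] at p0
      rw [r1] at p1
      rw [r2] at p2
      rw [r3] at p3
      exact corners_eq_zero e0 e1 e2 e3 c0 c1 c2 c3 hall hs1 hs2 (hZ _) (hZ _) (hZ _) (hZ _)
        p0 p1 p2 p3 hex'
    -- The other direction of propagation is reduced to the first by listing the corners clockwise.
    · have p : ∀ z w, IsLatticeEdge z w → leftFace z w = s → rightFace z w ∉ Ω → Z z → Z w := by
        intro z w h hl hr hw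
        obtain ⟨i, rfl, rfl⟩ := hc.exhaust z w h (hl ▸ hs) hr
        exact hprop i hl hw
      have p0 := p _ _ g0 l0
      have p1 := p _ _ g1 l1
      have p2 := p _ _ g2 l2
      have p3 := p _ _ g3 l3
      rw [r0] at p0
      rw [r1] at p1
      rw [r2] at p2
      rw [r3] at p3
      have := corners_eq_zero (b0 := s - (1, 0) ∉ Ω) (b1 := s + (0, 1) ∉ Ω) (b2 := s + (1, 0) ∉ Ω)
        (b3 := s - (0, 1) ∉ Ω) (fun h => (e3 h).symm) (fun h => (e2 h).symm) (fun h => (e1 h).symm)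
        (fun h => (e0 h).symm) (fun h h' => c0 h' h) (fun h h' => c3 h' h) (fun h h' => c2 h' h)
        (fun h h' => c1 h' h) (fun ⟨h1, h2, h3, h4⟩ => hall ⟨h4, h3, h2, h1⟩)
        (fun ⟨h1, h2, h3, h4⟩ => hs2 ⟨h4, h3, h2, h1⟩)
        (fun ⟨h1, h2, h3, h4⟩ => hs1 ⟨h4, h3, h2, h1⟩) (hZ _) (hZ _) (hZ _) (hZ _)
        p3 p2 p1 p0 (by
          rcases hex' with h | h | h | h
          exacts [Or.inl h, Or.inr (Or.inr (Or.inr h)), Or.inr (Or.inr (Or.inl h)),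
            Or.inr (Or.inl h)])
      exact ⟨this.1, this.2.2.2, this.2.2.1, this.2.1⟩
  intro z hz
  rcases hz with rfl | rfl | rfl | rfl
  · exact hfour.1
  · simpa using hfour.2.1
  · simpa using hfour.2.2.1
  · simpa using hfour.2.2.2

/-- A function that is constant along the edges of the slit graph vanishes if it vanishes on one of
the arcs and at the corners of the poles outside the slit graph. -/
theorem eq_zero_of_arc [NeZero n] (hc : IsBoundaryLoop Ω c) {a b : ZMod n} (huv : u₀ ≠ v₀)
    (ha : leftFace (c a) (c (a + 1)) = u₀) (hb : leftFace (c b) (c (b + 1)) = v₀)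
    (hu₀s : ¬ IsStrait Ω u₀) (hv₀s : ¬ IsStrait Ω v₀) (hu₀n : ∃ t ∈ nbrs u₀, t ∈ Ω)
    (hv₀n : ∃ t ∈ nbrs v₀, t ∈ Ω) {f : Vertex → ℝ}
    (hf : ∀ z w, (slitGraph Ω u₀ v₀).Adj z w → f z = f w)
    (hA : ∀ z ∈ boundaryArc c b a, f z = 0)
    (hcorner : ∀ z s, s = u₀ ∨ s = v₀ → IsAround z s → (∀ t, IsAround z t → t ≠ s → t ∉ Ω) →
      f z = 0) : ∀ z ∈ vertexSet Ω, f z = 0 := by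
  have hab : a ≠ b := by rintro rfl; exact huv (ha.symm.trans hb)
  have hu₀Ω : u₀ ∈ Ω := ha ▸ (hc.edge a).2.1
  have hv₀Ω : v₀ ∈ Ω := hb ▸ (hc.edge b).2.1
  have hmem : ∀ i, c i ∈ boundaryArc c b a ↔ InArc a b i := fun i => by
    rw [mem_boundaryArc]
    exact ⟨fun ⟨j, hj, h⟩ => hc.injective h ▸ hj, fun h => ⟨i, h, rfl⟩⟩
  -- The arc ends at `u₀`, so membership passes backwards along the boundary sides of `u₀`; it
  -- starts at `v₀`, so there it passes forwards.
  have hu := corners_face_eq_zero hc hu₀Ω hu₀s hu₀n hf (fun z => hcorner z u₀ (Or.inl rfl))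
    (Z := fun z => z ∈ boundaryArc c b a) hA
    ⟨c a, ha ▸ (hc.edge a).1.isAround.2.2.1, (hmem a).2 (inArc_end hab)⟩
    (Or.inl fun i hi hZ => (hmem i).2 (((hmem _).1 hZ).pred fun h => huv (by rw [← hi, h, hb])))
  have hv := corners_face_eq_zero hc hv₀Ω hv₀s hv₀n hf (fun z => hcorner z v₀ (Or.inr rfl))
    (Z := fun z => z ∈ boundaryArc c b a) hA
    ⟨c (b + 1), hb ▸ (hc.edge b).1.isAround.2.2.2, (hmem _).2 (inArc_start hab)⟩
    (Or.inr fun i hi hZ => (hmem _).2 (((hmem _).1 hZ).succ fun h => huv (by rw [← hi, h, ha])))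
  refine eq_zero_of_boundary hc hf (zmod_induction a (hA _ ((hmem a).2 (inArc_end hab))) ?_)
  intro i hi
  obtain ⟨h1, h2, h3⟩ := hc.edge i
  by_cases hlu : leftFace (c i) (c (i + 1)) = u₀
  · exact hu _ (hlu ▸ h1.isAround.2.2.2)
  by_cases hlv : leftFace (c i) (c (i + 1)) = v₀
  · exact hv _ (hlv ▸ h1.isAround.2.2.2)
  rw [← hf _ _ (slitGraph_adj_of_left_ne h1 h2 hlu hlv), hi]

/-- If the pole is the only face of Ω at `z`, every edge of Ω at `z` is a boundary side of the pole.
-/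
theorem notMem_support_slitGraph {z : Vertex} {s : Face} (hsp : s = u₀ ∨ s = v₀)
    (h : ∀ t, IsAround z t → t ≠ s → t ∉ Ω) :
    z ∉ (slitGraph Ω u₀ v₀).support := by
  rintro ⟨w, ⟨hw, hm⟩, h1, h2⟩
  have ha := hw.isAround
  have hne : leftFace z w ≠ rightFace z w := fun e => by
    have := hw.isBlack_right
    rw [e] at this
    tauto
  have hside : IsBoundarySide Ω s z w := by
    rcases hm with hm | hm
    · have : leftFace z w = s := by
        by_contra hn
        exact h _ ha.2.2.1 hn hm
      exact Or.inl ⟨this, h _ ha.1 fun e => hne (this.trans e.symm)⟩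
    · have : rightFace z w = s := by
        by_contra hn
        exact h _ ha.1 hn hm
      exact Or.inr ⟨this, h _ ha.2.2.1 fun e => hne (e.trans this.symm)⟩
  rcases hsp with rfl | rfl
  · exact h1 hside
  · exact h2 hside

theorem edgeGraph_sdiff_le : edgeGraph (Ω \ {u₀, v₀}) ≤ slitGraph Ω u₀ v₀ := by
  rintro z w ⟨h, h'⟩
  have hm : ∀ s, s ∈ Ω \ {u₀, v₀} → s ∈ Ω ∧ s ≠ u₀ ∧ s ≠ v₀ := fun s hs => by
    simpa using hs
  refine ⟨⟨h, h'.imp (fun h => (hm _ h).1) fun h => (hm _ h).1⟩, ?_, ?_⟩ <;>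
  · rintro (⟨h1, h2⟩ | ⟨h1, h2⟩) <;> rcases h' with h' | h' <;> have := hm _ h' <;> tauto

/-- An edge lost with the poles would be a boundary side of one of them or separate the two; the
latter is excluded when they are not adjacent. -/
theorem slitGraph_le_edgeGraph (huv : v₀ ∉ nbrs u₀) :
    slitGraph Ω u₀ v₀ ≤ edgeGraph (Ω \ {u₀, v₀}) := by
  rintro z w ⟨⟨h, hm⟩, h1, h2⟩
  refine ⟨h, ?_⟩
  have hn := h.mem_nbrs
  have hn' := mem_nbrs_comm.1 hn
  have hne : leftFace z w ≠ rightFace z w := fun e => by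
    have := h.isBlack_right
    rw [e] at this
    tauto
  have hA : ¬ (leftFace z w = u₀ ∧ rightFace z w = v₀) := fun ⟨e, e'⟩ => huv (e ▸ e' ▸ hn)
  have hB : ¬ (leftFace z w = v₀ ∧ rightFace z w = u₀) := fun ⟨e, e'⟩ => huv (e ▸ e' ▸ hn')
  simp only [Finset.mem_sdiff, Finset.mem_insert, Finset.mem_singleton]
  simp only [IsBoundarySide] at h1 h2
  clear hn hn' huv h
  generalize leftFace z w = l at *
  generalize rightFace z w = r at *
  grind

theorem edge_unique {z w z' w' : Vertex} (h : IsLatticeEdge z w) (h' : IsLatticeEdge z' w')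
    (hl : leftFace z w = leftFace z' w') (hr : rightFace z w = rightFace z' w') :
    z = z' ∧ w = w' := by
  obtain ⟨a1, a2⟩ := z
  obtain ⟨b1, b2⟩ := w
  obtain ⟨p1, p2⟩ := z'
  obtain ⟨q1, q2⟩ := w'
  rcases h.cases with ⟨h, h1, h2⟩ | ⟨h, h1, h2⟩ | ⟨h, h1, h2⟩ | ⟨h, h1, h2⟩ <;>
    rcases h'.cases with ⟨h', h1', h2'⟩ | ⟨h', h1', h2'⟩ | ⟨h', h1', h2'⟩ | ⟨h', h1', h2'⟩ <;>
    rw [h1, h1'] at hl <;> rw [h2, h2'] at hr <;>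
    simp only [Prod.mk_add_mk, Prod.mk_sub_mk, Prod.mk.injEq] at h h' hl hr ⊢ <;> omega

/-- A corner with no other face of Ω would give `s` two neighbours outside Ω. -/
theorem HasOneBoundarySide.two_nbrs_false {s : Face} (h : HasOneBoundarySide Ω s) {z : Vertex}
    (hz : IsAround z s) (hout : ∀ t, IsAround z t → t ≠ s → t ∉ Ω) : False := by
  obtain ⟨x, y⟩ := z
  have key : ∀ t t', t ∈ nbrs s → t' ∈ nbrs s → IsAround (x, y) t → IsAround (x, y) t' → t ≠ s →
      t' ≠ s → t ≠ t' → False := fun t t' h1 h2 h3 h4 h5 h6 h7 =>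
    h7 (h.unique ⟨h1, hout t h3 h5⟩ ⟨h2, hout t' h4 h6⟩)
  rcases hz with rfl | rfl | rfl | rfl
  · refine key ((x, y) - (1, 0)) ((x, y) - (0, 1)) ?_ ?_ ?_ ?_ ?_ ?_ ?_ <;>
      simp [mem_nbrs, IsAround]
  · refine key (x, y) ((x, y) - (1, 1)) ?_ ?_ ?_ ?_ ?_ ?_ ?_ <;>
      simp [mem_nbrs, IsAround] <;> omega
  · refine key ((x, y) - (1, 0)) ((x, y) - (0, 1)) ?_ ?_ ?_ ?_ ?_ ?_ ?_ <;>
      simp [mem_nbrs, IsAround] <;> omega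
  · refine key (x, y) ((x, y) - (1, 1)) ?_ ?_ ?_ ?_ ?_ ?_ ?_ <;>
      simp [mem_nbrs, IsAround] <;> omega

end Slit


/-! ### The double-dimer height function and the primitive of `F G` -/

section Primitive

variable {Ω : Finset Face} {n : ℕ} [NeZero n] {c : ZMod n → Vertex} {u₀ v₀ : Face} {a b : ZMod n}
  {F G : Face → ℂ} {J : ℂ}

/-- The increment of the primitive is proportional to that of the mean double-dimer height. -/
theorem pos_sub_pos_mul {D : Finset Face} (hT : (tilings Ω).Nonempty) (hT' : (tilings D).Nonempty)
    (hJ : ∀ u v, IsBlack u → ¬ IsBlack v → 4 * Complex.I * dbarCoeff v u * F u * G v =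
      J * ((dominoCount Ω u v : ℂ) / (tilings Ω).card -
        (dominoCount D u v : ℂ) / (tilings D).card))
    {z w : Vertex} {u v : Face} (h : IsLatticeEdge z w) (hu : IsBlack u) (hv : ¬ IsBlack v)
    (huv : (leftFace z w = u ∧ rightFace z w = v) ∨ (leftFace z w = v ∧ rightFace z w = u)) :
    (pos w - pos z) * F u * G v = J * ((expStep Ω z w - expStep D z w : ℝ) : ℂ) := by
  have key := hJ u v hu hv
  rw [pos_sub_pos h]
  rcases huv with ⟨rfl, rfl⟩ | ⟨rfl, rfl⟩
  · rw [expStep_of_isBlack hT hu, expStep_of_isBlack hT' hu]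
    push_cast
    linear_combination -key
  · rw [expStep_of_not_isBlack hT hv, expStep_of_not_isBlack hT' hv,
      dbarCoeff_swap (leftFace z w) (rightFace z w)]
    push_cast
    rw [dbarCoeff_swap (rightFace z w) (leftFace z w)] at key ⊢
    linear_combination key

theorem IsTiling.exists_mem_nbrs {T : Finset (Face × Face)} (hT : IsTiling Ω T) {s : Face}
    (hs : s ∈ Ω) : ∃ t ∈ nbrs s, t ∈ Ω := by
  obtain ⟨p, ⟨hp, h⟩, -⟩ := hT.2 s hs
  obtain ⟨h1, h2, -, -, h3⟩ := hT.1 p hp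
  rcases h with rfl | rfl
  · exact ⟨_, h3, h2⟩
  · exact ⟨_, mem_nbrs_comm.1 h3, h1⟩

theorem support_slitGraph_subset {z : Vertex} (hz : z ∈ (slitGraph Ω u₀ v₀).support) :
    z ∈ vertexSet Ω := by
  obtain ⟨w, ⟨h, hm⟩, -⟩ := hz
  have ha := h.isAround
  rcases hm with hm | hm
  · exact mem_vertexSet_of_isAround hm ha.2.2.1
  · exact mem_vertexSet_of_isAround hm ha.1

theorem edgeFlow_eq_zero {s : Face} {p q z w : Vertex} (hl : leftFace p q = s)
    (hr : rightFace p q ∉ Ω) (h : ¬ IsBoundarySide Ω s z w) : edgeFlow p q z w = 0 := by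
  have h1 : ¬ (z = p ∧ w = q) := by
    rintro ⟨rfl, rfl⟩
    exact h (Or.inl ⟨hl, hr⟩)
  have h2 : ¬ (z = q ∧ w = p) := by
    rintro ⟨rfl, rfl⟩
    exact h (Or.inr ⟨hl, hr⟩)
  rw [edgeFlow, if_neg h1, if_neg h2, sub_zero]

open Classical in
-- Scaling the mean height by `j` gives H; it is cut off outside the support only to meet the
-- normalization of `IsPrimitive` there.
theorem exists_isPrimitive {f : Vertex → ℝ} {A : Set Vertex} {D : Finset Face} {j : ℝ}
    (hf : ∀ z w, (slitGraph Ω u₀ v₀).Adj z w → f w - f z = expStep Ω z w - expStep D z w)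
    (hA : ∀ z ∈ A, f z = 0)
    (hinc : ∀ {z w : Vertex} {u v : Face}, IsLatticeEdge z w → IsBlack u → ¬ IsBlack v →
      ((leftFace z w = u ∧ rightFace z w = v) ∨ (leftFace z w = v ∧ rightFace z w = u)) →
      (pos w - pos z) * F u * G v = (j : ℂ) * ((expStep Ω z w - expStep D z w : ℝ) : ℂ)) :
    IsPrimitive Ω u₀ v₀ A F G
      fun z => if z ∈ (slitGraph Ω u₀ v₀).support then j * f z else 0 where
  supp z hz := if_neg hz
  increment z w u v h hu hv huv := by
    have hz : z ∈ (slitGraph Ω u₀ v₀).support := ⟨w, h⟩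
    have hw : w ∈ (slitGraph Ω u₀ v₀).support := ⟨z, h.symm⟩
    rw [if_pos hz, if_pos hw, hinc h.1.1 hu ((isWhite_iff_not_isBlack v).1 hv) huv, ← hf z w h]
    push_cast
    ring
  normalized z hz := by
    simp only [hA z hz, mul_zero, ite_self]

theorem exists_isBlack_edge {z w : Vertex} (h : IsLatticeEdge z w) :
    ∃ u v, IsBlack u ∧ IsWhite v ∧
      ((leftFace z w = u ∧ rightFace z w = v) ∨ (leftFace z w = v ∧ rightFace z w = u)) := by
  have hb := h.isBlack_right
  by_cases hl : IsBlack (leftFace z w)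
  · exact ⟨_, _, hl, (isWhite_iff_not_isBlack _).2 (by tauto), Or.inl ⟨rfl, rfl⟩⟩
  · exact ⟨_, _, (by tauto), (isWhite_iff_not_isBlack _).2 hl, Or.inr ⟨rfl, rfl⟩⟩

/-- The difference of two primitives is constant along slit edges and vanishes on the arc and at the
isolated corners of the poles. -/
theorem IsPrimitive.eq {H H' : Vertex → ℝ} (hc : IsBoundaryLoop Ω c) (huv : u₀ ≠ v₀)
    (ha : leftFace (c a) (c (a + 1)) = u₀) (hb : leftFace (c b) (c (b + 1)) = v₀)
    (hu₀s : ¬ IsStrait Ω u₀) (hv₀s : ¬ IsStrait Ω v₀) (hu₀n : ∃ t ∈ nbrs u₀, t ∈ Ω)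
    (hv₀n : ∃ t ∈ nbrs v₀, t ∈ Ω)
    (hH : IsPrimitive Ω u₀ v₀ (boundaryArc c b a) F G H)
    (hH' : IsPrimitive Ω u₀ v₀ (boundaryArc c b a) F G H') : H = H' := by
  have key := eq_zero_of_arc (f := fun z => H z - H' z) hc huv ha hb hu₀s hv₀s hu₀n hv₀n
    (fun z w h => by
      obtain ⟨u, v, hu, hv, e⟩ := exists_isBlack_edge h.1.1
      have h1 := hH.increment z w u v h hu hv e
      have h2 := hH'.increment z w u v h hu hv e
      have h3 : ((H z - H' z : ℝ) : ℂ) = ((H w - H' w : ℝ) : ℂ) := by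
        push_cast
        linear_combination h2 - h1
      exact Complex.ofReal_injective h3)
    (fun z hz => by rw [hH.normalized z hz, hH'.normalized z hz, sub_zero])
    (fun z s hs _ hout => by
      have hz := notMem_support_slitGraph hs hout
      rw [hH.supp z hz, hH'.supp z hz, sub_zero])
  ext1 z
  by_cases hz : z ∈ (slitGraph Ω u₀ v₀).support
  · exact sub_eq_zero.1 (key z (support_slitGraph_subset hz))
  · rw [hH.supp z hz, hH'.supp z hz]

theorem IsPrimitive.expectedHeight_eq {H : Vertex → ℝ} {A : Set Vertex}
    (hT : (tilings Ω).Nonempty) (hT' : (tilings (Ω \ {u₀, v₀})).Nonempty)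
    (hw : HeightWellDefined Ω) (hw' : HeightWellDefined (Ω \ {u₀, v₀}))
    (hH : IsPrimitive Ω u₀ v₀ A F G H) {j : ℝ} (hj : j ≠ 0)
    (hinc : ∀ {z w : Vertex} {u v : Face}, IsLatticeEdge z w → IsBlack u → ¬ IsBlack v →
      ((leftFace z w = u ∧ rightFace z w = v) ∨ (leftFace z w = v ∧ rightFace z w = u)) →
      (pos w - pos z) * F u * G v =
        (j : ℂ) * ((expStep Ω z w - expStep (Ω \ {u₀, v₀}) z w : ℝ) : ℂ))
    {z₀ z : Vertex} (hz₀ : z₀ ∈ A) (hz : (edgeGraph (Ω \ {u₀, v₀})).Reachable z₀ z) :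
    expectedHeight Ω (Ω \ {u₀, v₀}) z₀ z = H z / j := by
  obtain ⟨γ⟩ := hz
  rw [expectedHeight_eq_walkSum Finset.sdiff_subset hT hT' hw hw' γ,
    walkSum_telescope _ (fun z => H z / j) (fun z w h => ?_) γ, hH.normalized z₀ hz₀, zero_div,
    sub_zero]
  obtain ⟨u, v, hu, hv, e⟩ := exists_isBlack_edge h.1
  have h1 := hH.increment z w u v (edgeGraph_sdiff_le h) hu hv e
  rw [hinc h.1 hu ((isWhite_iff_not_isBlack v).1 hv) e] at h1
  have h2 : H w - H z = j * (expStep Ω z w - expStep (Ω \ {u₀, v₀}) z w) := by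
    exact_mod_cast h1
  rw [← sub_div, h2, mul_div_cancel_left₀ _ hj]

/-- The uniqueness argument applied to the indicator of the unreachable vertices. With one boundary
side per pole the whole arc is joined by slit edges, and no pole has an isolated corner. -/
theorem reachable_of_hasOneBoundarySide (hc : IsBoundaryLoop Ω c) (huv : u₀ ≠ v₀)
    (ha : leftFace (c a) (c (a + 1)) = u₀) (hb : leftFace (c b) (c (b + 1)) = v₀)
    (hu₀s : ¬ IsStrait Ω u₀) (hv₀s : ¬ IsStrait Ω v₀) (hu₀n : ∃ t ∈ nbrs u₀, t ∈ Ω)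
    (hv₀n : ∃ t ∈ nbrs v₀, t ∈ Ω) (hu₀ : HasOneBoundarySide Ω u₀)
    (hv₀ : HasOneBoundarySide Ω v₀) (hadj : v₀ ∉ nbrs u₀) {z₀ z : Vertex}
    (hz₀ : z₀ ∈ boundaryArc c b a) (hz : z ∈ vertexSet Ω) :
    (edgeGraph (Ω \ {u₀, v₀})).Reachable z₀ z := by
  classical
  set f : Vertex → ℝ := fun z => if (edgeGraph (Ω \ {u₀, v₀})).Reachable z₀ z then 0 else 1
    with hf
  have hstep : ∀ z w, (slitGraph Ω u₀ v₀).Adj z w → f z = f w := fun z w h => by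
    have h := slitGraph_le_edgeGraph hadj h
    simp only [hf, show (edgeGraph (Ω \ {u₀, v₀})).Reachable z₀ z ↔
      (edgeGraph (Ω \ {u₀, v₀})).Reachable z₀ w from
        ⟨fun r => r.trans h.reachable, fun r => r.trans h.symm.reachable⟩]
  have huniq : ∀ {s : Face} {i e : ZMod n}, HasOneBoundarySide Ω s →
      leftFace (c e) (c (e + 1)) = s → i ≠ e → leftFace (c i) (c (i + 1)) ≠ s := by
    intro s i e hs he hi hl
    refine hi (hc.injective (edge_unique (hc.edge i).1 (hc.edge e).1 (hl.trans he.symm) ?_).1)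
    refine hs.unique ⟨?_, (hc.edge i).2.2⟩ ⟨?_, (hc.edge e).2.2⟩
    · rw [← hl]
      exact (hc.edge i).1.mem_nbrs
    · rw [← he]
      exact (hc.edge e).1.mem_nbrs
  have hloop : ∀ i, i ≠ a → i ≠ b → (f ∘ c) (i + 1) = (f ∘ c) i := fun i h1 h2 =>
    (hstep _ _ (slitGraph_adj_of_left_ne (hc.edge i).1 (hc.edge i).2.1 (huniq hu₀ ha h1)
      (huniq hv₀ hb h2))).symm
  obtain ⟨i₀, hi₀, rfl⟩ := mem_boundaryArc.1 hz₀
  have h0 : f (c i₀) = 0 := if_pos (SimpleGraph.Reachable.refl _)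
  have key := eq_zero_of_arc hc huv ha hb hu₀s hv₀s hu₀n hv₀n hstep
    (fun z hz => by
      obtain ⟨i, hi, rfl⟩ := mem_boundaryArc.1 hz
      exact (eq_of_inArc hloop hi).trans ((eq_of_inArc hloop hi₀).symm.trans h0))
    (fun z s hs hz hout => by
      rcases hs with rfl | rfl
      · exact (hu₀.two_nbrs_false hz hout).elim
      · exact (hv₀.two_nbrs_false hz hout).elim) z hz
  by_contra h
  simp only [hf, if_neg h, one_ne_zero] at key

end Primitive

end DoubleDimer

/-! ### Assembly of the main theorem. -/

theorem mainTheorem6 (Ω : Finset DoubleDimer.Face) (n : ℕ) [NeZero n]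
    (c : ZMod n → DoubleDimer.Vertex) (hc : DoubleDimer.IsBoundaryLoop Ω c)
    (u₀ v₀ : DoubleDimer.Face) (a b : ZMod n)
    (hu₀ : DoubleDimer.IsBlack0 u₀) (hv₀ : DoubleDimer.IsWhite0 v₀)
    (ha : DoubleDimer.leftFace (c a) (c (a + 1)) = u₀)
    (hb : DoubleDimer.leftFace (c b) (c (b + 1)) = v₀)
    (hu₀s : ¬ DoubleDimer.IsStrait Ω u₀) (hv₀s : ¬ DoubleDimer.IsStrait Ω v₀)
    (hT : (DoubleDimer.tilings Ω).Nonempty)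
    (hT' : (DoubleDimer.tilings (Ω \ {u₀, v₀})).Nonempty) :
    DoubleDimer.HeightWellDefined Ω ∧
    DoubleDimer.HeightWellDefined (Ω \ {u₀, v₀}) ∧
    (∃! F, DoubleDimer.IsF Ω v₀ F) ∧
    (∃! G, DoubleDimer.IsG Ω u₀ G) ∧
    ∀ F G : DoubleDimer.Face → ℂ, DoubleDimer.IsF Ω v₀ F → DoubleDimer.IsG Ω u₀ G →
      4 * Complex.I * G v₀ * DoubleDimer.dbar F v₀ ≠ 0 ∧
      4 * Complex.I * G v₀ * DoubleDimer.dbar F v₀ =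
        -4 * Complex.I * F u₀ * DoubleDimer.dbar G u₀ ∧
      (∃! H, DoubleDimer.IsPrimitive Ω u₀ v₀ (DoubleDimer.boundaryArc c b a) F G H) ∧
      ∀ H : DoubleDimer.Vertex → ℝ,
        DoubleDimer.IsPrimitive Ω u₀ v₀ (DoubleDimer.boundaryArc c b a) F G H →
        (∀ z ∈ DoubleDimer.boundaryArc c a b, z ∈ (DoubleDimer.slitGraph Ω u₀ v₀).support →
          (H z : ℂ) = 4 * Complex.I * G v₀ * DoubleDimer.dbar F v₀) ∧
        (DoubleDimer.HasOneBoundarySide Ω u₀ → DoubleDimer.HasOneBoundarySide Ω v₀ →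
          v₀ ∉ DoubleDimer.nbrs u₀ →
          ∀ z₀ ∈ DoubleDimer.boundaryArc c b a, ∀ z ∈ DoubleDimer.vertexSet Ω,
            (DoubleDimer.expectedHeight Ω (Ω \ {u₀, v₀}) z₀ z : ℂ) =
              (H z : ℂ) / (4 * Complex.I * G v₀ * DoubleDimer.dbar F v₀)) ∧
        (∀ z₀ ∈ DoubleDimer.boundaryArc c b a,
          z₀ ∈ DoubleDimer.vertexSet (Ω \ {u₀, v₀}) →
          ∀ z ∈ DoubleDimer.vertexSet (Ω \ {u₀, v₀}),
            (DoubleDimer.edgeGraph (Ω \ {u₀, v₀})).Reachable z₀ z →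
            (DoubleDimer.expectedHeight Ω (Ω \ {u₀, v₀}) z₀ z : ℂ) =
              (H z : ℂ) / (4 * Complex.I * G v₀ * DoubleDimer.dbar F v₀)) := by
  classical
  have hu₀Ω : u₀ ∈ Ω := ha ▸ (hc.edge a).2.1
  have hv₀Ω : v₀ ∈ Ω := hb ▸ (hc.edge b).2.1
  have hub : DoubleDimer.IsBlack u₀ := (DoubleDimer.face_types u₀).1.2 (Or.inl hu₀)
  have hvb : ¬ DoubleDimer.IsBlack v₀ := (DoubleDimer.face_types v₀).2.2.1.2 (Or.inl hv₀)
  have huv : u₀ ≠ v₀ := by rintro rfl; exact hvb hub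
  have hΩ := hc.complementConnected ⟨u₀, hu₀Ω⟩
  have hΩ' := hΩ.sdiff_pair (hc.edge a).1 (hc.edge a).2.2 (hc.edge b).1 (hc.edge b).2.2
  rw [ha, hb] at hΩ'
  have hw := DoubleDimer.heightWellDefined hΩ
  have hw' := DoubleDimer.heightWellDefined hΩ'
  obtain ⟨T₀, hT₀⟩ := id hT
  have hT₀ := DoubleDimer.mem_tilings.1 hT₀
  have hu₀n := hT₀.exists_mem_nbrs hu₀Ω
  have hv₀n := hT₀.exists_mem_nbrs hv₀Ω
  refine ⟨hw, hw', DoubleDimer.existsUnique_isF hΩ hT hv₀ hv₀Ω,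
    DoubleDimer.existsUnique_isG hΩ hT hu₀ hu₀Ω, fun F G hF hG => ?_⟩
  obtain ⟨hJ0, hJ1, hJ⟩ := DoubleDimer.green hΩ hΩ' hT hT' hu₀ hv₀ hu₀Ω hv₀Ω hF hG
  -- The constant equals -4i F(u₀) · i = 4 F(u₀), and F is real at `u₀`, a black face of type 0.
  obtain ⟨j, hj⟩ : ∃ j : ℝ, 4 * Complex.I * G v₀ * DoubleDimer.dbar F v₀ = j := by
    refine ⟨4 * (F u₀).re, ?_⟩
    have h1 : F u₀ = ((F u₀).re : ℂ) := Complex.ext rfl (by simp [hF.real u₀ hu₀])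
    rw [hJ1, hG.pole, h1]
    push_cast [Complex.ofReal_re]
    linear_combination (-4 * ((F u₀).re : ℂ)) * Complex.I_mul_I
  refine ⟨hJ0, hJ1, ?_⟩
  rw [hj] at hJ0 hJ ⊢
  have hj0 : j ≠ 0 := by exact_mod_cast hJ0
  have hinc : ∀ {z w : DoubleDimer.Vertex} {u v : DoubleDimer.Face}, _ → _ → _ → _ → _ :=
    fun {z w u v} => DoubleDimer.pos_sub_pos_mul hT hT' hJ (z := z) (w := w) (u := u) (v := v)
  obtain ⟨f, hf, hf0, hf1⟩ := DoubleDimer.exists_meanHeight hc hub hvb ha hb hΩ hT hT'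
  -- On slit edges both unit flows vanish, so the mean height has exactly the increments required of
  -- H up to the factor `j`.
  have hP := DoubleDimer.exists_isPrimitive (Ω := Ω) (u₀ := u₀) (v₀ := v₀) (F := F) (G := G)
    (fun z w h => by
      rw [hf z w h.1, DoubleDimer.edgeFlow_eq_zero ha (hc.edge a).2.2 h.2.1,
        DoubleDimer.edgeFlow_eq_zero hb (hc.edge b).2.2 h.2.2, add_zero, sub_zero]) hf0 hinc
  have huniq := fun H hH => DoubleDimer.IsPrimitive.eq (H := H) hc huv ha hb hu₀s hv₀s hu₀n hv₀n
    hH hP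
  refine ⟨⟨_, hP, huniq⟩, fun H hH => ⟨fun z hz hzs => ?_, fun h1 h2 h3 z₀ hz₀ z hz => ?_,
    fun z₀ hz₀ _ z _ hr => ?_⟩⟩
  · rw [huniq H hH]
    simp only [if_pos hzs, hf1 z hz, mul_one]
  · exact_mod_cast hH.expectedHeight_eq hT hT' hw hw' hj0 hinc hz₀
      (DoubleDimer.reachable_of_hasOneBoundarySide hc huv ha hb hu₀s hv₀s hu₀n hv₀n h1 h2 h3 hz₀ hz)
  · exact_mod_cast hH.expectedHeight_eq hT hT' hw hw' hj0 hinc hz₀ hr
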